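/- For $l=1,\dots,n$ let $M_l=G_l/H_l$ be a Hermitian symmetric space: $G_l$ is a real Lie group, $H_l\subset G_l$ is a closed subgroup, $G_l/H_l$ is connected, there is an involutive smooth automorphism $\sigma_l$ of $G_l$ such that $H_l$ lies between the identity component of the fixed point group $G_l^{\sigma_l}$ and $G_l^{\sigma_l}$ itself, and the homogeneous space $M_l$ carries a $G_l$-invariant complex structure, of complex dimension $m_l$. Let $Q_l$ be a $G_l$-invariant smooth Hermitian metric on $M_l$; we write $Q_l(z_l,v_l)$ for the squared length of $v_l\in T^{1,0}_{z_l}M_l$. Let $M=M_1\times\cdots\times M_n$ be the product complex manifold, with projections $\pi_l:M\to M_l$. For $t\in[0,\infty)$ and an integer $k\ge 2$ define, for $(z,v)\in T^{1,0}M$, $$F_{t,k}(z,v)=\frac1{\sqrt{1+t}}\sqrt{\sum_{l=1}^n Q_l(\pi_l(z),(\pi_l)_*v)+t\,\sqrt[k]{\sum_{l=1}^n Q_l(\pi_l(z),(\pi_l)_*v)^k}}.$$ Terminology. In local holomorphic coordinates $(z^\alpha,v^\alpha)$ on the holomorphic tangent bundle of a complex manifold, a strongly pseudoconvex complex Finsler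 metric is a continuous function $F\ge 0$ on this bundle, vanishing exactly on the zero section, such that $G=F^2$ is $C^\infty$ off the zero section, $G(z,\lambda v)=|\lambda|^2G(z,v)$ for $\lambda\in\mathbb C$, and the Hermitian matrix $(G_{\alpha\bar\beta})=\big(\partial^2G/\partial v^\alpha\partial\bar v^\beta\big)$ is positive definite for $v\ne0$. It is strongly convex if the real Hessian of $G$ along the fibres is positive definite for $v\neq 0$. Put $\Gamma^\alpha_{;\mu}=\sum_\tau G^{\bar\tau\alpha}\,\partial^2G/\partial\bar v^\tau\partial z^\mu$, where $(G^{\bar\tau\alpha})$ is the inverse matrix of $(G_{\alpha\bar\beta})$, and $\Gamma^\alpha_{\nu;\mu}=\partial\Gamma^\alpha_{;\mu}/\partial v^\nu$. The metric is Kähler–Berwald if $\sum_\nu(\Gamma^\alpha_{\nu;\mu}-\Gamma^\alpha_{\mu;\nu})v^\nu=0$ for all $\alpha,\mu$ (Kähler–Finsler) and all $\Gamma^\alpha_{\nu;\mu}$ are independent of $v$ (complex Berwald). Its holomorphic sectional curvature at $(z,v)$, $v\neq0$, is $$K=-\frac{2}{G^2}\sum_{\gamma,\alpha,\mu}\frac{\partial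 G}{\partial v^\gamma}\,\delta_{\bar\mu}\big(\Gamma^\gamma_{;\alpha}\big)v^\alpha\overline{v^\mu},\qquad \delta_{\bar\mu}=\frac{\partial}{\partial\bar z^\mu}-\sum_\lambda\overline{\Gamma^\lambda_{;\mu}}\,\frac{\partial}{\partial\bar v^\lambda}.$$ Let $K_{t,k}$ and $K_l$ be the holomorphic sectional curvatures of $F_{t,k}$ and of $Q_l$ (the latter with $G=Q_l$). A connected complex manifold with a strongly pseudoconvex complex Finsler metric $F$ is a symmetric complex Finsler space if every point $p$ is an isolated fixed point of an involutive holomorphic transformation preserving $F$ (we allow the identity in dimension $0$). Then: (1) $F_{t,k}$ is a strongly convex Kähler–Berwald metric on $M$ (in particular a strongly pseudoconvex complex Finsler metric). (2) $F_{t,k}$ is invariant under $G_1\times\cdots\times G_n$ and makes $(M,F_{t,k})$ a symmetric complex Finsler space. (3) If $c\ge 0$ and $K_l\equiv c$ for all $l$, then $K_{t,k}(z,v)\in\left[\dfrac{(1+t)c}{n+t\sqrt[k]{n}},\,c\right]$ for all $z\in M$ and $0\ne v\in T^{1,0}_zM$. (4) If $c<0$ and $K_l\equiv c$ for all $l$,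 then $K_{t,k}(z,v)\in\left[c,\,\dfrac{(1+t)c}{n+t\sqrt[k]{n}}\right]$ for all $z\in M$ and $0\ne v\in T^{1,0}_zM$. -/

import Mathlib

open scoped Manifold ContDiff

noncomputable section

namespace ComplexFinsler

/-! ### Wirtinger derivatives on a complex normed space -/

section Wirtinger

variable {E : Type*} [NormedAddCommGroup E] [NormedSpace ℂ E]

/-- The Wirtinger derivative `∂f/∂z^X` in the (complex) direction `X`. For `X` the `α`-th vector
of a complex basis this is `∂f/∂z^α`. -/
def wirt (f : E → ℂ) (z X : E) : ℂ :=
  (1 / 2) * (fderiv ℝ f z X - Complex.I * fderiv ℝ f z (Complex.I • X))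

/-- The conjugate Wirtinger derivative; for `X` the `α`-th vector of a complex basis this is
the derivative with respect to the conjugate of `z^α`. -/
def wirtBar (f : E → ℂ) (z X : E) : ℂ :=
  (1 / 2) * (fderiv ℝ f z X + Complex.I * fderiv ℝ f z (Complex.I • X))

end Wirtinger

/-! ### Local formulas

Here `g z v` is the square `G = F²` of a complex Finsler metric in local holomorphic coordinates
`(z, v)` on the holomorphic tangent bundle; `z` and `v` range over the model space `E`, and
coordinates are taken with respect to a complex basis `b` of `E`. -/

section Local

variable {E : Type*} [NormedAddCommGroup E] [NormedSpace ℂ E]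
  {ι : Type*} [Fintype ι] [DecidableEq ι] (b : Module.Basis ι ℂ E) (g : E → E → ℝ)

/-- `G_α = ∂G/∂v^α`. -/
def fiberDeriv (α : ι) (z v : E) : ℂ :=
  wirt (fun w => (g z w : ℂ)) v (b α)

/-- The complex fundamental tensor: the `(α, β)` entry is the derivative of `G` with respect to
`v^α` and the conjugate of `v^β`. -/
def leviMatrix (z v : E) : Matrix ι ι ℂ :=
  Matrix.of fun α β => wirtBar (fun w => fiberDeriv b g α z w) v (b β)

/-- The Chern-Finsler nonlinear connection coefficients `Γ^α_{;μ}(z, v)`: the sum over `τ` of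
the `(τ, α)` entry of the inverse of the fundamental tensor times the derivative of `G` with
respect to `z^μ` and the conjugate of `v^τ`. -/
def chernFinsler (α μ : ι) (z v : E) : ℂ :=
  ∑ τ, (leviMatrix b g z v)⁻¹ τ α *
    wirt (fun ζ => wirtBar (fun w => (g ζ w : ℂ)) v (b τ)) z (b μ)

/-- The horizontal Chern-Finsler connection coefficients `Γ^α_{ν;μ} = ∂Γ^α_{;μ}/∂v^ν`. -/
def horizontalCoeff (α ν μ : ι) (z v : E) : ℂ :=
  wirt (fun w => chernFinsler b g α μ z w) v (b ν)

/-- The derivation `δ_{μ̄}` (conjugate horizontal derivative in the direction `μ`) applied to a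
function `f` of `(z, v)`. -/
def deltaBar (μ : ι) (f : E → E → ℂ) (z v : E) : ℂ :=
  wirtBar (fun ζ => f ζ v) z (b μ) -
    ∑ l, (starRingEnd ℂ) (chernFinsler b g l μ z v) * wirtBar (fun w => f z w) v (b l)

/-- The holomorphic sectional curvature at `(z, v)`:
`-(2 / G²) ∑ G_γ δ_{μ̄}(Γ^γ_{;α}) v^α v̄^μ`. -/
def localHolSecCurv (z v : E) : ℂ :=
  -(2 / (g z v : ℂ) ^ 2) * ∑ γ, ∑ α, ∑ μ,
    fiberDeriv b g γ z v * deltaBar b g μ (fun ζ w => chernFinsler b g γ α ζ w) z v *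
      b.repr v α * (starRingEnd ℂ) (b.repr v μ)

end Local

/-! ### Complex Finsler metrics on a complex manifold

`M` is a complex manifold modelled on `E` through a (boundaryless) model `I`; the holomorphic
tangent space at `x` is the complex vector space `TangentSpace I x`. -/

section Manifold

variable {E : Type*} [NormedAddCommGroup E] [NormedSpace ℂ E]
  {H : Type*} [TopologicalSpace H] (I : ModelWithCorners ℂ E H)
  {M : Type*} [TopologicalSpace M] [ChartedSpace H M]

/-- A function on the tangent bundle, written in the coordinates `(z, v)` of a chart `e`:
the point with coordinates `z`, and the tangent vector at it with coordinates `v`. -/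
def inChart {β : Type*} (F : (x : M) → TangentSpace I x → β) (e : OpenPartialHomeomorph M H) :
    E → E → β :=
  fun z v => F ((e.extend I).symm z) (mfderiv 𝓘(ℂ, E) I (e.extend I).symm z v)

/-- The function `G = F²`. -/
def sqMetric (F : (x : M) → TangentSpace I x → ℝ) : (x : M) → TangentSpace I x → ℝ :=
  fun x v => F x v ^ 2

section Basis

variable {ι : Type*} [Fintype ι] [DecidableEq ι] (b : Module.Basis ι ℂ E)

open scoped ComplexOrder in
/-- Strongly pseudoconvex complex Finsler metrics. Continuity on the tangent bundle and smoothness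
of `G = F²` off the zero section are expressed in the local coordinates `(z, v)`. -/
structure IsStronglyPseudoconvex (F : (x : M) → TangentSpace I x → ℝ) : Prop where
  continuous : ∀ e ∈ atlas H M,
    ContinuousOn (fun p : E × E => inChart I F e p.1 p.2) ((e.extend I).target ×ˢ Set.univ)
  nonneg : ∀ x v, 0 ≤ F x v
  eq_zero_iff : ∀ x v, F x v = 0 ↔ v = 0
  smooth : ∀ e ∈ atlas H M,
    ContDiffOn ℝ ∞ (fun p : E × E => inChart I (sqMetric I F) e p.1 p.2)
      ((e.extend I).target ×ˢ {0}ᶜ)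
  homogeneous : ∀ x (c : ℂ) (v : TangentSpace I x), sqMetric I F x (c • v) = ‖c‖ ^ 2 * sqMetric I F x v
  posDef : ∀ e ∈ atlas H M, ∀ z ∈ (e.extend I).target, ∀ v : E, v ≠ 0 →
    (leviMatrix b (inChart I (sqMetric I F) e) z v).PosDef

/-- Strong convexity: the real fundamental tensor, half the real Hessian of `G = F²` along the
fibres, is positive definite off the zero section. -/
def IsStronglyConvex (F : (x : M) → TangentSpace I x → ℝ) : Prop :=
  ∀ e ∈ atlas H M, ∀ z ∈ (e.extend I).target, ∀ v : E, v ≠ 0 → ∀ X : E, X ≠ 0 →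
    0 < (1 / 2) * fderiv ℝ (fun w => fderiv ℝ (inChart I (sqMetric I F) e z) w X) v X

/-- The Kähler-Finsler condition `(Γ^α_{ν;μ} - Γ^α_{μ;ν}) v^ν = 0`. -/
def IsKahlerFinsler (F : (x : M) → TangentSpace I x → ℝ) : Prop :=
  ∀ e ∈ atlas H M, ∀ z ∈ (e.extend I).target, ∀ v : E, v ≠ 0 → ∀ α μ : ι,
    ∑ ν, (horizontalCoeff b (inChart I (sqMetric I F) e) α ν μ z v -
      horizontalCoeff b (inChart I (sqMetric I F) e) α μ ν z v) * b.repr v ν = 0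

/-- The complex Berwald condition: `Γ^α_{ν;μ}(z, v)` does not depend on `v`. -/
def IsComplexBerwald (F : (x : M) → TangentSpace I x → ℝ) : Prop :=
  ∀ e ∈ atlas H M, ∀ z ∈ (e.extend I).target, ∀ v w : E, v ≠ 0 → w ≠ 0 → ∀ α ν μ : ι,
    horizontalCoeff b (inChart I (sqMetric I F) e) α ν μ z v =
      horizontalCoeff b (inChart I (sqMetric I F) e) α ν μ z w

/-- Strongly convex Kähler-Berwald metrics: strongly pseudoconvex and strongly convex complex
Finsler metrics that are both Kähler-Finsler and complex Berwald. -/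
structure IsStronglyConvexKahlerBerwald (F : (x : M) → TangentSpace I x → ℝ) : Prop where
  pseudoconvex : IsStronglyPseudoconvex I b F
  convex : IsStronglyConvex I F
  kahler : IsKahlerFinsler I b F
  berwald : IsComplexBerwald I b F

/-- The holomorphic sectional curvature at `(x, v)` of the metric whose square is `G`, computed in
the preferred chart at `x`. -/
def holSecCurv (G : (x : M) → TangentSpace I x → ℝ) (x : M) (v : TangentSpace I x) : ℂ :=
  localHolSecCurv b (inChart I G (chartAt H x)) (extChartAt I x x)
    (mfderiv I 𝓘(ℂ, E) (extChartAt I x) x v)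

/-- Symmetric complex Finsler spaces: connected, with, for every point `p`, an involutive
holomorphic isometry having `p` as an isolated fixed point. -/
structure IsSymmetricComplexFinslerSpace (F : (x : M) → TangentSpace I x → ℝ) : Prop where
  pseudoconvex : IsStronglyPseudoconvex I b F
  connected : ConnectedSpace M
  symmetric : ∀ p : M, ∃ s : M → M, (∀ x, s (s x) = x) ∧ MDifferentiable I I s ∧
    (∀ x v, F (s x) (mfderiv I I s x v) = F x v) ∧
    s p = p ∧ ∃ U ∈ nhds p, ∀ x ∈ U, s x = x → x = p

end Basis

/-- A function on the tangent bundle is invariant under a group (or set) `K` acting on `M`. -/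
def IsInvariantMetric (K : Type*) [SMul K M] (F : (x : M) → TangentSpace I x → ℝ) : Prop :=
  ∀ (a : K) (x : M) (v : TangentSpace I x),
    F (a • x) (mfderiv I I (fun y : M => a • y) x v) = F x v

variable (M) in
/-- Smooth Hermitian metrics on `M`. -/
structure HermitianMetric where
  /-- The Hermitian form on the holomorphic tangent space at `x`. -/
  form : (x : M) → TangentSpace I x →ₗ[ℂ] TangentSpace I x →ₗ⋆[ℂ] ℂ
  conj_symm : ∀ x v w, (starRingEnd ℂ) (form x v w) = form x w v
  pos : ∀ x v, v ≠ 0 → 0 < (form x v v).re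
  smooth : ∀ e ∈ atlas H M, ∀ X Y : E,
    ContDiffOn ℝ ∞
      (fun z : E => form ((e.extend I).symm z)
        (mfderiv 𝓘(ℂ, E) I (e.extend I).symm z X) (mfderiv 𝓘(ℂ, E) I (e.extend I).symm z Y))
      (e.extend I).target

/-- The quadratic function `Q(x, v) = h_x(v, v)` of a Hermitian metric. -/
def HermitianMetric.quad {I : ModelWithCorners ℂ E H} (h : HermitianMetric I M) (x : M)
    (v : TangentSpace I x) : ℝ :=
  (h.form x v v).re

end Manifold

/-! ### Hermitian symmetric coset spaces -/

section Coset

variable (V : Type*) [NormedAddCommGroup V] [NormedSpace ℝ V]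
  (E : Type*) [NormedAddCommGroup E] [NormedSpace ℂ E]
  {G : Type*} [Group G] [TopologicalSpace G] [ChartedSpace V G]

/-- `G/K`, for a Lie group `G` (modelled on `V`) and a subgroup `K`, is a symmetric coset space with a `G`-invariant
complex structure. The topology of `G/K` is the quotient topology, and the charts (with values in
the complex space `E`) are those of the complex structure. -/
structure IsComplexSymmetricCoset (K : Subgroup G) [ChartedSpace E (G ⧸ K)] : Prop where
  closed : IsClosed (K : Set G)
  connected : ConnectedSpace (G ⧸ K)
  /-- The smooth structure underlying the complex structure is that of the homogeneous space: the
  one for which the projection is a smooth submersion. -/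
  submersion : Manifold.IsSubmersion 𝓘(ℝ, V) 𝓘(ℝ, E) ∞ (fun g : G => (g : G ⧸ K))
  /-- The complex structure is invariant under `G`. -/
  holomorphic : ∀ g : G, MDifferentiable 𝓘(ℂ, E) 𝓘(ℂ, E) (fun x : G ⧸ K => g • x)
  /-- There is an involutive automorphism `σ` of `G` such that `K` lies between the identity
  component of the fixed point group of `σ` and this fixed point group. -/
  symmetric : ∃ σ : G ≃* G, ContMDiff 𝓘(ℝ, V) 𝓘(ℝ, V) ∞ σ ∧ (∀ g, σ (σ g) = g) ∧
    connectedComponentIn {g : G | σ g = g} 1 ⊆ K ∧ (K : Set G) ⊆ {g : G | σ g = g}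

end Coset

/-! ### Products -/

section Product

variable {n : ℕ} {E : Fin n → Type*} [∀ l, NormedAddCommGroup (E l)] [∀ l, NormedSpace ℂ (E l)]
  (M : Fin n → Type*) [∀ l, TopologicalSpace (M l)] [∀ l, ChartedSpace (E l) (M l)]

/-- The model of the product of complex manifolds `M l` modelled on `E l`. -/
abbrev prodModel (E : Fin n → Type*) [∀ l, NormedAddCommGroup (E l)]
    [∀ l, NormedSpace ℂ (E l)] : ModelWithCorners ℂ (∀ l, E l) (ModelPi E) :=
  ModelWithCorners.pi fun l => 𝓘(ℂ, E l)

variable {M}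

/-- The metric `F_{t,k}` on the product, built from functions `Q l` on the tangent bundles of the
factors; the outer power `1 / k` is the real `k`-th root, and tangent vectors are pushed forward by the
projections. -/
def prodFinsler (Q : ∀ l, (x : M l) → TangentSpace 𝓘(ℂ, E l) x → ℝ) (t : ℝ) (k : ℕ)
    (x : ∀ l, M l) (v : TangentSpace (prodModel E) x) : ℝ :=
  let q : Fin n → ℝ := fun l =>
    Q l (x l) (mfderiv (prodModel E) 𝓘(ℂ, E l) (fun y : ∀ l, M l => y l) x v)
  1 / Real.sqrt (1 + t) * Real.sqrt (∑ l, q l + t * (∑ l, q l ^ k) ^ (1 / (k : ℝ)))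

end Product

/-- The complex coordinate space `ℂ^m`. -/
abbrev Cn (m : ℕ) : Type := EuclideanSpace ℂ (Fin m)

/-- The standard basis of `ℂ^m`. -/
abbrev stdBasis (m : ℕ) : Module.Basis (Fin m) ℂ (Cn m) :=
  (EuclideanSpace.basisFun (Fin m) ℂ).toBasis

/-- The standard basis of `ℂ^{m_1} × ⋯ × ℂ^{m_n}`. -/
abbrev prodBasis {n : ℕ} (m : Fin n → ℕ) : Module.Basis (Σ l, Fin (m l)) ℂ (∀ l, Cn (m l)) :=
  Pi.basis fun l => stdBasis (m l)

end ComplexFinsler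

end

open ComplexFinsler

/-! Write `x_l = Q_l(v_l)` and `G = f(x_1, …, x_n)` with `f = mixFun t k`, which is homogeneous of
degree one. The central device is a family of complex bilinear maps `A_z` such that the derivative
of `G` along the base in direction `X` equals its derivative along the fibre in direction `A_z(X,
v)` (`IsConnectionOn`). Since `A_z(X, v)` is holomorphic in `v`, differentiating this relation in
the conjugate fibre variable and inverting the Levi matrix gives `Γ_{;μ}(z, v) = A_z(b_μ, v)`
(`chernFinsler_eq`). Linearity in `v` is the Berwald property, symmetry of `A_z` the Kähler
property, and the curvature reduces to `curvatureSum`. By the chain rule both sides of the relation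
for `Q_l` are multiplied by the same `∂f/∂x_l`, so the product of connections of the factors serves
`G` for every `t` and `k` (`isConnectionOn_piConnection`).

The factors have symmetric connections because they have point symmetries. The automorphism `σ`
induces an involution of the coset space. Its differential at the base point is `-1`: vectors fixed
by `dσ` are tangent to curves of fixed points of `σ`, which lie in the subgroup and project to a
point (`exists_fixed_curve`, `fderiv_induced_eq_neg`). Left translations carry this symmetry
everywhere (`exists_isPointSymmetry`). Differentiating the isometry equation of a symmetry `φ` at
its fixed point shows that `-(1/2) D²φ` is the required bilinear map
(`exists_connection_of_symmetry`). Products of the symmetries of the factors are symmetries of the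
product.

Strong convexity holds because along a line each `x_l` is a quadratic polynomial: the root term has
nonnegative second derivative by Cauchy-Schwarz (`exists_deriv_powerMean`), and `∑ x_l` supplies
strictness. It implies strong pseudoconvexity (`leviMatrix_posDef`).

If all factors have curvature `c`, then `K = c ∑ (∂f/∂x_l) x_l² / f²`. The ratio lies between `(1 +
t) / (n + t n^(1/k))` and `1` by `mixFun_sq_le` and `sum_mixDeriv_mul_sq_le`. -/

noncomputable section

namespace ComplexFinsler

/-! ### Wirtinger calculus. -/

section WirtingerCalculus

variable {E F : Type*} [NormedAddCommGroup E] [NormedSpace ℂ E]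
  [NormedAddCommGroup F] [NormedSpace ℂ F]

lemma fderiv_complex_smul (f : E → ℂ) (z X : E) (c : ℂ) :
    fderiv ℝ f z (c • X) = c.re * fderiv ℝ f z X + c.im * fderiv ℝ f z (Complex.I • X) := by
  have h : c • X = c.re • X + c.im • (Complex.I • X) := by
    conv_lhs => rw [← Complex.re_add_im c]
    rw [add_smul, mul_smul, Complex.coe_smul, Complex.coe_smul]
  rw [h, map_add, map_smul, map_smul, Complex.real_smul, Complex.real_smul]

lemma wirt_add (f : E → ℂ) (z X Y : E) : wirt f z (X + Y) = wirt f z X + wirt f z Y := by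
  simp only [wirt, smul_add, map_add]; ring

lemma wirtBar_add (f : E → ℂ) (z X Y : E) :
    wirtBar f z (X + Y) = wirtBar f z X + wirtBar f z Y := by
  simp only [wirtBar, smul_add, map_add]; ring

lemma wirt_smul (f : E → ℂ) (z X : E) (c : ℂ) : wirt f z (c • X) = c * wirt f z X := by
  have h1 := fderiv_complex_smul f z X c
  have h2 := fderiv_complex_smul f z X (Complex.I * c)
  rw [mul_smul] at h2
  simp only [wirt, h1, h2, Complex.mul_re, Complex.mul_im, Complex.I_re, Complex.I_im]
  conv_rhs => rw [← Complex.re_add_im c]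
  push_cast
  linear_combination (1 / 2 * (c.im : ℂ) * fderiv ℝ f z (Complex.I • X)) * Complex.I_sq

lemma wirtBar_smul (f : E → ℂ) (z X : E) (c : ℂ) :
    wirtBar f z (c • X) = (starRingEnd ℂ) c * wirtBar f z X := by
  have h1 := fderiv_complex_smul f z X c
  have h2 := fderiv_complex_smul f z X (Complex.I * c)
  rw [mul_smul] at h2
  have h3 : (starRingEnd ℂ) c = c.re - c.im * Complex.I := by
    apply Complex.ext <;> simp
  simp only [wirtBar, h1, h2, Complex.mul_re, Complex.mul_im, Complex.I_re, Complex.I_im, h3]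
  push_cast
  linear_combination (1 / 2 * (c.im : ℂ) * fderiv ℝ f z (Complex.I • X)) * Complex.I_sq

/-- The Wirtinger derivative as a complex linear map in the direction. -/
def wirtL (f : E → ℂ) (z : E) : E →ₗ[ℂ] ℂ where
  toFun := wirt f z
  map_add' := wirt_add f z
  map_smul' c X := wirt_smul f z X c

/-- The conjugate Wirtinger derivative as an antilinear map in the direction. -/
def wirtBarL (f : E → ℂ) (z : E) : E →ₗ⋆[ℂ] ℂ where
  toFun := wirtBar f z
  map_add' := wirtBar_add f z
  map_smul' c X := wirtBar_smul f z X c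

lemma wirt_sum {ι : Type*} (s : Finset ι) (f : E → ℂ) (z : E) (X : ι → E) :
    wirt f z (∑ i ∈ s, X i) = ∑ i ∈ s, wirt f z (X i) := map_sum (wirtL f z) X s

lemma wirtBar_sum {ι : Type*} (s : Finset ι) (f : E → ℂ) (z : E) (X : ι → E) :
    wirtBar f z (∑ i ∈ s, X i) = ∑ i ∈ s, wirtBar f z (X i) := map_sum (wirtBarL f z) X s

lemma wirt_zero_dir (f : E → ℂ) (z : E) : wirt f z 0 = 0 := map_zero (wirtL f z)

lemma wirtBar_zero_dir (f : E → ℂ) (z : E) : wirtBar f z 0 = 0 := map_zero (wirtBarL f z)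

lemma wirt_eq_of_hasFDerivAt {f : E → ℂ} {z : E} {L : E →L[ℝ] ℂ} (h : HasFDerivAt f L z) (X : E) :
    wirt f z X = (1 / 2) * (L X - Complex.I * L (Complex.I • X)) := by
  rw [wirt, h.fderiv]

lemma wirtBar_eq_of_hasFDerivAt {f : E → ℂ} {z : E} {L : E →L[ℝ] ℂ} (h : HasFDerivAt f L z)
    (X : E) : wirtBar f z X = (1 / 2) * (L X + Complex.I * L (Complex.I • X)) := by
  rw [wirtBar, h.fderiv]

lemma wirt_congr {f g : E → ℂ} {z : E} (h : f =ᶠ[nhds z] g) (X : E) : wirt f z X = wirt g z X := by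
  simp only [wirt, h.fderiv_eq]

lemma wirtBar_congr {f g : E → ℂ} {z : E} (h : f =ᶠ[nhds z] g) (X : E) :
    wirtBar f z X = wirtBar g z X := by
  simp only [wirtBar, h.fderiv_eq]

lemma wirt_of_complex {f : E → ℂ} {z : E} {L : E →L[ℂ] ℂ} (h : HasFDerivAt f L z) (X : E) :
    wirt f z X = L X := by
  rw [wirt_eq_of_hasFDerivAt (h.restrictScalars ℝ)]
  simp only [ContinuousLinearMap.coe_restrictScalars', map_smul, smul_eq_mul]
  linear_combination (-(1 / 2) * L X) * Complex.I_sq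

lemma wirtBar_of_complex {f : E → ℂ} {z : E} {L : E →L[ℂ] ℂ} (h : HasFDerivAt f L z) (X : E) :
    wirtBar f z X = 0 := by
  rw [wirtBar_eq_of_hasFDerivAt (h.restrictScalars ℝ)]
  simp only [ContinuousLinearMap.coe_restrictScalars', map_smul, smul_eq_mul]
  linear_combination (1 / 2 * L X) * Complex.I_sq

lemma wirtBar_mul {f g : E → ℂ} {z : E} (hf : DifferentiableAt ℝ f z)
    (hg : DifferentiableAt ℝ g z) (X : E) :
    wirtBar (fun w => f w * g w) z X = f z * wirtBar g z X + wirtBar f z X * g z := by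
  rw [show (fun w => f w * g w) = f * g from rfl,
    wirtBar_eq_of_hasFDerivAt (hf.hasFDerivAt.mul hg.hasFDerivAt)]
  simp only [wirtBar, add_apply, smul_apply, smul_eq_mul]
  ring

lemma wirtBar_finset_sum {ι : Type*} (s : Finset ι) {f : ι → E → ℂ} {z : E}
    (hf : ∀ i ∈ s, DifferentiableAt ℝ (f i) z) (X : E) :
    wirtBar (fun w => ∑ i ∈ s, f i w) z X = ∑ i ∈ s, wirtBar (f i) z X := by
  rw [wirtBar_eq_of_hasFDerivAt (HasFDerivAt.fun_sum fun i hi => (hf i hi).hasFDerivAt)]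
  simp only [wirtBar, sum_apply, Finset.mul_sum, ← Finset.sum_add_distrib]

lemma wirt_slice_fst {f : E × F → ℂ} {p : E × F} (hf : DifferentiableAt ℝ f p) (X : E) :
    wirt (fun ζ => f (ζ, p.2)) p.1 X = wirt f p (X, 0) := by
  have h := HasFDerivAt.comp p.1 (f := fun ζ : E => (ζ, p.2)) (g := f) hf.hasFDerivAt
    ((hasFDerivAt_id (𝕜 := ℝ) p.1).prodMk (hasFDerivAt_const p.2 p.1))
  rw [show (fun ζ => f (ζ, p.2)) = f ∘ fun ζ : E => (ζ, p.2) from rfl, wirt_eq_of_hasFDerivAt h]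
  simp [wirt]

lemma wirtBar_slice_snd {f : E × F → ℂ} {p : E × F} (hf : DifferentiableAt ℝ f p) (X : F) :
    wirtBar (fun w => f (p.1, w)) p.2 X = wirtBar f p (0, X) := by
  have h := HasFDerivAt.comp p.2 (f := fun w : F => (p.1, w)) (g := f) hf.hasFDerivAt
    ((hasFDerivAt_const (𝕜 := ℝ) p.1 p.2).prodMk (hasFDerivAt_id p.2))
  rw [show (fun w => f (p.1, w)) = f ∘ fun w : F => (p.1, w) from rfl, wirtBar_eq_of_hasFDerivAt h]
  simp [wirtBar]

lemma hasFDerivAt_fderiv_apply {f : E → ℂ} {z : E} (hf : ContDiffAt ℝ 2 f z) (X : E) :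
    HasFDerivAt (fun p => fderiv ℝ f p X) ((fderiv ℝ (fderiv ℝ f) z).flip X) z := by
  have h : DifferentiableAt ℝ (fderiv ℝ f) z :=
    (hf.fderiv_right (m := 1) (by norm_num)).differentiableAt (by norm_num)
  have := h.hasFDerivAt.clm_apply (hasFDerivAt_const X z)
  rwa [ContinuousLinearMap.comp_zero, zero_add] at this

lemma second_fderiv_symm {f : E → ℂ} {z : E} (hf : ContDiffAt ℝ 2 f z) (X Y : E) :
    fderiv ℝ (fderiv ℝ f) z X Y = fderiv ℝ (fderiv ℝ f) z Y X :=
  (hf.isSymmSndFDerivAt (by simp)).eq X Y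

lemma hasFDerivAt_wirt {f : E → ℂ} {z : E} (hf : ContDiffAt ℝ 2 f z) (X : E) :
    HasFDerivAt (fun p => wirt f p X) ((1 / 2 : ℂ) • ((fderiv ℝ (fderiv ℝ f) z).flip X -
      Complex.I • (fderiv ℝ (fderiv ℝ f) z).flip (Complex.I • X))) z :=
  (((hasFDerivAt_fderiv_apply hf X).sub
    ((hasFDerivAt_fderiv_apply hf (Complex.I • X)).const_mul Complex.I)).const_mul (1 / 2))

lemma hasFDerivAt_wirtBar {f : E → ℂ} {z : E} (hf : ContDiffAt ℝ 2 f z) (X : E) :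
    HasFDerivAt (fun p => wirtBar f p X) ((1 / 2 : ℂ) • ((fderiv ℝ (fderiv ℝ f) z).flip X +
      Complex.I • (fderiv ℝ (fderiv ℝ f) z).flip (Complex.I • X))) z :=
  (((hasFDerivAt_fderiv_apply hf X).add
    ((hasFDerivAt_fderiv_apply hf (Complex.I • X)).const_mul Complex.I)).const_mul (1 / 2))

/-- The expression through the real Hessian, with the order of the arguments normalised by its
symmetry, serves twice: it makes the Wirtinger derivatives commute, and it lets positivity pass from
the real Hessian to the Levi matrix. -/
lemma wirtBar_wirt_eq {f : E → ℂ} {z : E} (hf : ContDiffAt ℝ 2 f z) (X Y : E) :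
    wirtBar (fun p => wirt f p X) z Y = (1 / 4) *
      (fderiv ℝ (fderiv ℝ f) z X Y + fderiv ℝ (fderiv ℝ f) z (Complex.I • X) (Complex.I • Y) +
      Complex.I * (fderiv ℝ (fderiv ℝ f) z X (Complex.I • Y) -
        fderiv ℝ (fderiv ℝ f) z (Complex.I • X) Y)) := by
  rw [wirtBar_eq_of_hasFDerivAt (hasFDerivAt_wirt hf X)]
  simp only [smul_apply, sub_apply,
    ContinuousLinearMap.flip_apply, smul_eq_mul, second_fderiv_symm hf Y,
    second_fderiv_symm hf (Complex.I • Y)]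
  linear_combination (-(1 / 4) * fderiv ℝ (fderiv ℝ f) z (Complex.I • X) (Complex.I • Y)) *
    Complex.I_sq

/-- Wirtinger derivatives of a twice differentiable function commute. -/
lemma wirt_wirtBar_comm {f : E → ℂ} {z : E} (hf : ContDiffAt ℝ 2 f z) (X Y : E) :
    wirt (fun p => wirtBar f p Y) z X = wirtBar (fun p => wirt f p X) z Y := by
  rw [wirtBar_wirt_eq hf, wirt_eq_of_hasFDerivAt (hasFDerivAt_wirtBar hf Y)]
  simp only [smul_apply, add_apply,
    ContinuousLinearMap.flip_apply, smul_eq_mul]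
  linear_combination (-(1 / 4) * fderiv ℝ (fderiv ℝ f) z (Complex.I • X) (Complex.I • Y)) *
    Complex.I_sq

section Projection

variable {κ : Type*} [Fintype κ] [DecidableEq κ] {V : κ → Type*} [∀ l, NormedAddCommGroup (V l)]
  [∀ l, NormedSpace ℂ (V l)]

/-- Differentiability is not assumed: if `f` is not differentiable, restriction to the slice
`Function.update z l` shows that the composite is not either, and both derivatives take the default
value `0`. The curvature sums need this generality, as the connections in them carry no regularity
hypothesis in the base point. -/
lemma fderiv_comp_proj (l : κ) (f : V l → ℂ) (z X : ∀ l, V l) :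
    fderiv ℝ (fun w : ∀ l, V l => f (w l)) z X = fderiv ℝ f (z l) (X l) := by
  by_cases hf : DifferentiableAt ℝ f (z l)
  · have h := HasFDerivAt.comp z (f := fun w : ∀ l, V l => w l) (g := f) hf.hasFDerivAt
      (ContinuousLinearMap.proj (R := ℝ) (φ := V) l).hasFDerivAt
    rw [show (fun w : ∀ l, V l => f (w l)) = f ∘ fun w : ∀ l, V l => w l from rfl, h.fderiv]
    simp
  · have hf' : ¬ DifferentiableAt ℝ (fun w : ∀ l, V l => f (w l)) z := by
      intro h
      apply hf
      have h1 : HasFDerivAt (fun x : V l => Function.update z l x)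
          (ContinuousLinearMap.pi (Pi.single l (ContinuousLinearMap.id ℝ (V l)))) (z l) :=
        hasFDerivAt_update z (z l)
      have h2 : DifferentiableAt ℝ (fun w : ∀ l, V l => f (w l)) (Function.update z l (z l)) := by
        rwa [Function.update_eq_self]
      have := h2.comp (z l) h1.differentiableAt
      simpa [Function.comp_def] using this
    rw [fderiv_zero_of_not_differentiableAt hf, fderiv_zero_of_not_differentiableAt hf']
    rfl

lemma wirtBar_comp_proj (l : κ) (f : V l → ℂ) (z X : ∀ l, V l) :
    wirtBar (fun w : ∀ l, V l => f (w l)) z X = wirtBar f (z l) (X l) := by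
  simp only [wirtBar, fderiv_comp_proj, Pi.smul_apply]

end Projection

end WirtingerCalculus

/-! ### Bilinear Chern-Finsler connections in local coordinates. -/

section LocalConnection

lemma two_le_infty : (2 : WithTop ℕ∞) ≤ ∞ := WithTop.coe_le_coe.mpr le_top

variable {E : Type*} [NormedAddCommGroup E] [NormedSpace ℂ E]

/-- A family `A z` of complex bilinear maps that is a Chern connection for the function `g z v`
on `U`: the horizontal Wirtinger derivatives of `g` are vertical ones along `A z X v`. -/
def IsConnectionOn (U : Set E) (g : E → E → ℝ) (A : E → E →ₗ[ℂ] E →ₗ[ℂ] E) : Prop :=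
  ∀ z ∈ U, ∀ v : E, v ≠ 0 → ∀ X : E,
    wirt (fun ζ => (g ζ v : ℂ)) z X = wirt (fun w => (g z w : ℂ)) v (A z X v)

/-- Positivity of the real Hessian along the fibre at `(z, v)`. -/
def FiberConvexAt (g : E → E → ℝ) (z v : E) : Prop :=
  ∀ X : E, X ≠ 0 → 0 < (1 / 2) * fderiv ℝ (fun w => fderiv ℝ (g z) w X) v X

lemma contDiffAt_ofReal_comp {g : E → ℝ} {v : E} {n : WithTop ℕ∞} (hg : ContDiffAt ℝ n g v) :
    ContDiffAt ℝ n (fun w => (g w : ℂ)) v :=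
  Complex.ofRealCLM.contDiff.contDiffAt.comp v hg

lemma second_fderiv_ofReal {g : E → ℝ} {v : E} (hg : ContDiffAt ℝ 2 g v) (X Y : E) :
    fderiv ℝ (fderiv ℝ fun w => (g w : ℂ)) v Y X =
      (fderiv ℝ (fun w => fderiv ℝ g w X) v Y : ℝ) := by
  have h1 := hasFDerivAt_fderiv_apply (contDiffAt_ofReal_comp hg) X
  have hd : ∀ᶠ w in nhds v, DifferentiableAt ℝ g w :=
    (hg.eventually (by simp)).mono fun w hw => hw.differentiableAt (by norm_num)
  have h2 : (fun p => fderiv ℝ (fun w => (g w : ℂ)) p X) =ᶠ[nhds v]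
      fun p => ((fderiv ℝ g p X : ℝ) : ℂ) := by
    filter_upwards [hd] with w hw
    have := (Complex.ofRealCLM.hasFDerivAt (x := g w)).comp w hw.hasFDerivAt
    rw [show (fun w => (g w : ℂ)) = Complex.ofRealCLM ∘ g from rfl, this.fderiv]
    rfl
  have h3 : DifferentiableAt ℝ (fun p => fderiv ℝ g p X) v :=
    ((hg.fderiv_right (m := 1) (by norm_num)).differentiableAt (by norm_num)).clm_apply
      (differentiableAt_const X)
  have h4 : HasFDerivAt (fun p => ((fderiv ℝ g p X : ℝ) : ℂ))
      (Complex.ofRealCLM.comp (fderiv ℝ (fun p => fderiv ℝ g p X) v)) v :=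
    (Complex.ofRealCLM.hasFDerivAt (x := fderiv ℝ g v X)).comp v h3.hasFDerivAt
  have h5 := (h1.congr_of_eventuallyEq h2.symm).unique h4
  have h6 := congrArg (fun L : E →L[ℝ] ℂ => L Y) h5
  simpa using h6

variable {ι : Type*} [Fintype ι] [DecidableEq ι] (b : Module.Basis ι ℂ E)

omit [DecidableEq ι] in
open scoped ComplexOrder in
/-- A function with positive definite real Hessian has a positive definite Levi matrix. -/
lemma leviMatrix_posDef {g : E → E → ℝ} {z v : E} (hg : ContDiffAt ℝ 2 (g z) v)
    (hc : FiberConvexAt g z v) : (leviMatrix b g z v).PosDef := by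
  have hf := contDiffAt_ofReal_comp hg
  set S : E → E → ℝ := fun X Y => fderiv ℝ (fun w => fderiv ℝ (g z) w X) v Y with hS
  have hD : ∀ X Y, fderiv ℝ (fderiv ℝ fun w => (g z w : ℂ)) v X Y = S X Y := fun X Y => by
    rw [second_fderiv_symm hf, second_fderiv_ofReal hg]
  have hsymm : ∀ X Y, S X Y = S Y X := fun X Y => by
    have := second_fderiv_symm hf X Y
    rw [hD, hD] at this
    exact_mod_cast this
  set T : E → E → ℂ := fun X Y => wirtBar (fun p => wirt (fun w => (g z w : ℂ)) p X) v Y with hT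
  have hTS : ∀ X Y, T X Y = (1 / 4) * (S X Y + S (Complex.I • X) (Complex.I • Y) +
      Complex.I * (S X (Complex.I • Y) - S (Complex.I • X) Y)) := fun X Y => by
    simp only [hT, wirtBar_wirt_eq hf, hD]
  have hM : ∀ α β, leviMatrix b g z v α β = T (b α) (b β) := fun α β => rfl
  have hTsum : ∀ (x : ι → ℂ) Y, T (∑ i, x i • b i) Y = ∑ i, x i * T (b i) Y := fun x Y => by
    simp only [hT, wirt_sum, wirt_smul]
    rw [wirtBar_finset_sum]
    · refine Finset.sum_congr rfl fun i _ => ?_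
      rw [wirtBar_mul (differentiableAt_const _) (hasFDerivAt_wirt hf _).differentiableAt,
        wirtBar_of_complex (hasFDerivAt_const (x i) v)]
      simp
    · exact fun i _ => (differentiableAt_const _).mul (hasFDerivAt_wirt hf _).differentiableAt
  refine Matrix.PosDef.of_dotProduct_mulVec_pos ?_ fun x hx => ?_
  · ext α β
    rw [Matrix.conjTranspose_apply, hM, hM, hTS, hTS, hsymm (b α) (b β),
      hsymm (Complex.I • b α) (Complex.I • b β), hsymm (b α) (Complex.I • b β),
      hsymm (Complex.I • b α) (b β)]
    simp only [star_mul', star_add, star_sub, RCLike.star_def, Complex.conj_ofReal,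
      Complex.conj_I, map_div₀, map_one, map_ofNat]
    ring
  -- The quadratic form conjugates its left argument while `T` is linear in the first slot and
  -- antilinear in the second, so the test vector must carry the conjugate coordinates.
  · set Z : E := ∑ i, star (x i) • b i with hZ
    have hZ0 : Z ≠ 0 := by
      intro h0
      apply hx
      have := Fintype.linearIndependent_iff.mp b.linearIndependent _ h0
      funext i
      simpa using this i
    have hsum : star x ⬝ᵥ (leviMatrix b g z v).mulVec x = T Z Z := by
      rw [hZ, hTsum, dotProduct]
      refine Finset.sum_congr rfl fun i _ => ?_
      rw [Pi.star_apply, Matrix.mulVec, dotProduct]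
      congr 1
      simp only [hT, wirtBar_sum, wirtBar_smul]
      refine Finset.sum_congr rfl fun j _ => ?_
      rw [hM]
      simp [hT, mul_comm]
    -- Symmetry of `S` cancels the imaginary part, leaving the real Hessian evaluated on `Z` and on
    -- `i Z`.
    have hval : T Z Z = ((1 / 4 * (S Z Z + S (Complex.I • Z) (Complex.I • Z)) : ℝ) : ℂ) := by
      rw [hTS, hsymm (Complex.I • Z) Z]
      push_cast
      ring
    rw [hsum, hval]
    have h1 := hc Z hZ0
    have h2 := hc (Complex.I • Z) (smul_ne_zero Complex.I_ne_zero hZ0)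
    have : (0 : ℝ) < 1 / 4 * (S Z Z + S (Complex.I • Z) (Complex.I • Z)) := by
      simp only [hS]; linarith
    exact_mod_cast this

variable {b} {U : Set E} {g : E → E → ℝ} {A : E → E →ₗ[ℂ] E →ₗ[ℂ] E} {z v : E}

lemma contDiffAt_of_slit (hU : IsOpen U)
    (hg : ContDiffOn ℝ ∞ (fun p : E × E => g p.1 p.2) (U ×ˢ {0}ᶜ)) (hz : z ∈ U) (hv : v ≠ 0) :
    ContDiffAt ℝ ∞ (fun p : E × E => g p.1 p.2) (z, v) :=
  hg.contDiffAt ((hU.prod isOpen_compl_singleton).mem_nhds ⟨hz, hv⟩)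

lemma contDiffAt_fiber (hg : ContDiffAt ℝ ∞ (fun p : E × E => g p.1 p.2) (z, v)) :
    ContDiffAt ℝ ∞ (g z) v :=
  ContDiffAt.comp v (f := fun w : E => (z, w)) hg (contDiffAt_const.prodMk contDiffAt_id)

/-- The Chern-Finsler connection coefficients are the coordinates of a connection `A`. -/
lemma chernFinsler_eq (hg : ContDiffAt ℝ ∞ (fun p : E × E => g p.1 p.2) (z, v))
    (hdet : IsUnit (leviMatrix b g z v).det) (hA : IsConnectionOn U g A) (hz : z ∈ U) (hv : v ≠ 0)
    (α μ : ι) : chernFinsler b g α μ z v = b.repr (A z (b μ) v) α := by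
  have : FiniteDimensional ℂ E := Module.Finite.of_basis b
  set f : E × E → ℂ := fun p => (g p.1 p.2 : ℂ) with hf
  have hcf : ContDiffAt ℝ ∞ f (z, v) := Complex.ofRealCLM.contDiff.contDiffAt.comp (z, v) hg
  have hcf2 : ContDiffAt ℝ 2 f (z, v) := hcf.of_le two_le_infty
  have hev : ∀ᶠ p in nhds (z, v), DifferentiableAt ℝ f p :=
    (hcf2.eventually (by simp)).mono fun p hp => hp.differentiableAt (by norm_num)
  have hev1 : ∀ᶠ ζ in nhds z, DifferentiableAt ℝ f (ζ, v) :=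
    (show Filter.Tendsto (fun ζ : E => (ζ, v)) (nhds z) (nhds (z, v)) from
      (continuous_id.prodMk continuous_const).tendsto z).eventually hev
  have hev2 : ∀ᶠ w in nhds v, DifferentiableAt ℝ f (z, w) :=
    (show Filter.Tendsto (fun w : E => (z, w)) (nhds v) (nhds (z, v)) from
      (continuous_const.prodMk continuous_id).tendsto v).eventually hev
  set a : ι → E →L[ℂ] ℂ := fun β =>
    LinearMap.toContinuousLinearMap ((b.coord β).comp (A z (b μ))) with ha
  have hav : ∀ β w, a β w = b.repr (A z (b μ) w) β := fun β w => rfl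
  have hda : ∀ β, DifferentiableAt ℝ (fun w => a β w) v := fun β =>
    ((a β).hasFDerivAt.restrictScalars ℝ).differentiableAt
  have hdG : ∀ β, DifferentiableAt ℝ (fun w => fiberDeriv b g β z w) v := fun β =>
    (hasFDerivAt_wirt (contDiffAt_ofReal_comp
      ((contDiffAt_fiber hg).of_le two_le_infty)) (b β)).differentiableAt
  -- Both derivatives are seen as derivatives of one function on `E × E` and interchanged. The
  -- connection equation then replaces the base derivative by `∑ a_β(w) G_β`, and since `a_β` is
  -- holomorphic in `w` the conjugate derivative falls on `G_β` alone.
  have key : ∀ τ, wirt (fun ζ => wirtBar (fun w => (g ζ w : ℂ)) v (b τ)) z (b μ) =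
      ∑ β, a β v * leviMatrix b g z v β τ := by
    intro τ
    have h1 : (fun ζ => wirtBar (fun w => (g ζ w : ℂ)) v (b τ)) =ᶠ[nhds z]
        fun ζ => wirtBar f (ζ, v) (0, b τ) := by
      filter_upwards [hev1] with ζ hζ
      exact wirtBar_slice_snd (f := f) (p := (ζ, v)) hζ (b τ)
    have h2 : (fun w => wirt f (z, w) (b μ, 0)) =ᶠ[nhds v]
        fun w => ∑ β, a β w * fiberDeriv b g β z w := by
      filter_upwards [hev2, isOpen_compl_singleton.mem_nhds hv] with w hw hw0
      rw [← wirt_slice_fst (f := f) (p := (z, w)) hw (b μ)]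
      refine (hA z hz w hw0 (b μ)).trans ?_
      conv_lhs => rw [← b.sum_repr (A z (b μ) w)]
      simp only [wirt_sum, wirt_smul, fiberDeriv, hav]
    rw [wirt_congr h1, wirt_slice_fst (f := fun p => wirtBar f p (0, b τ)) (p := (z, v))
      (hasFDerivAt_wirtBar hcf2 _).differentiableAt, wirt_wirtBar_comm hcf2,
      ← wirtBar_slice_snd (f := fun p => wirt f p (b μ, 0)) (p := (z, v))
        (hasFDerivAt_wirt hcf2 _).differentiableAt, wirtBar_congr h2,
      wirtBar_finset_sum (f := fun β w => a β w * fiberDeriv b g β z w) Finset.univ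
        fun β _ => (hda β).mul (hdG β)]
    refine Finset.sum_congr rfl fun β _ => ?_
    rw [wirtBar_mul (hda β) (hdG β), wirtBar_of_complex (a β).hasFDerivAt, zero_mul, add_zero]
    rfl
  have hinv := Matrix.mul_nonsing_inv _ hdet
  calc chernFinsler b g α μ z v
      = ∑ τ, ∑ β, a β v * (leviMatrix b g z v β τ * (leviMatrix b g z v)⁻¹ τ α) := by
        simp only [chernFinsler, key, Finset.mul_sum]
        refine Finset.sum_congr rfl fun τ _ => Finset.sum_congr rfl fun β _ => by ring
    _ = ∑ β, a β v * (leviMatrix b g z v * (leviMatrix b g z v)⁻¹) β α := by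
        rw [Finset.sum_comm]
        simp only [Matrix.mul_apply, Finset.mul_sum]
    _ = b.repr (A z (b μ) v) α := by
        simp [hinv, Matrix.one_apply, hav]

open scoped ComplexOrder in
lemma chernFinsler_eq_on (hU : IsOpen U)
    (hg : ContDiffOn ℝ ∞ (fun p : E × E => g p.1 p.2) (U ×ˢ {0}ᶜ))
    (hc : ∀ z ∈ U, ∀ v : E, v ≠ 0 → FiberConvexAt g z v) (hA : IsConnectionOn U g A)
    (hz : z ∈ U) (hv : v ≠ 0) (α μ : ι) :
    chernFinsler b g α μ z v = b.repr (A z (b μ) v) α := by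
  have h1 := contDiffAt_of_slit hU hg hz hv
  refine chernFinsler_eq h1 ?_ hA hz hv α μ
  exact (Matrix.isUnit_iff_isUnit_det _).mp
    (leviMatrix_posDef b ((contDiffAt_fiber h1).of_le two_le_infty) (hc z hz v hv)).isUnit

/-- Near `v` the coefficient `Γ^α_{;μ}` is a complex linear function of the fibre variable, hence
its own derivative. The result no longer contains `v`, and its symmetry in `μ, ν` is the symmetry of
`A`. -/
lemma horizontalCoeff_eq (hU : IsOpen U)
    (hg : ContDiffOn ℝ ∞ (fun p : E × E => g p.1 p.2) (U ×ˢ {0}ᶜ))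
    (hc : ∀ z ∈ U, ∀ v : E, v ≠ 0 → FiberConvexAt g z v) (hA : IsConnectionOn U g A)
    (hz : z ∈ U) (hv : v ≠ 0) (α ν μ : ι) :
    horizontalCoeff b g α ν μ z v = b.repr (A z (b μ) (b ν)) α := by
  have : FiniteDimensional ℂ E := Module.Finite.of_basis b
  have h : (fun w => chernFinsler b g α μ z w) =ᶠ[nhds v]
      (LinearMap.toContinuousLinearMap ((b.coord α).comp (A z (b μ))) : E →L[ℂ] ℂ) := by
    filter_upwards [isOpen_compl_singleton.mem_nhds hv] with w hw
    exact chernFinsler_eq_on hU hg hc hA hz hw α μ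
  rw [horizontalCoeff, wirt_congr h, wirt_of_complex (ContinuousLinearMap.hasFDerivAt _)]
  rfl

/-- Holomorphy of `Γ` in the fibre variable kills the vertical part of `δ_{μ̄}`. -/
lemma deltaBar_chernFinsler_eq (hU : IsOpen U)
    (hg : ContDiffOn ℝ ∞ (fun p : E × E => g p.1 p.2) (U ×ˢ {0}ᶜ))
    (hc : ∀ z ∈ U, ∀ v : E, v ≠ 0 → FiberConvexAt g z v) (hA : IsConnectionOn U g A)
    (hz : z ∈ U) (hv : v ≠ 0) (γ α μ : ι) :
    deltaBar b g μ (fun ζ w => chernFinsler b g γ α ζ w) z v =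
      wirtBar (fun ζ => b.repr (A ζ (b α) v) γ) z (b μ) := by
  have : FiniteDimensional ℂ E := Module.Finite.of_basis b
  have h : (fun w => chernFinsler b g γ α z w) =ᶠ[nhds v]
      (LinearMap.toContinuousLinearMap ((b.coord γ).comp (A z (b α))) : E →L[ℂ] ℂ) := by
    filter_upwards [isOpen_compl_singleton.mem_nhds hv] with w hw
    exact chernFinsler_eq_on hU hg hc hA hz hw γ α
  have h' : (fun ζ => chernFinsler b g γ α ζ v) =ᶠ[nhds z]
      fun ζ => b.repr (A ζ (b α) v) γ := by
    filter_upwards [hU.mem_nhds hz] with ζ hζ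
    exact chernFinsler_eq_on hU hg hc hA hζ hv γ α
  simp only [deltaBar, wirtBar_congr h', wirtBar_congr h,
    wirtBar_of_complex (ContinuousLinearMap.hasFDerivAt _), mul_zero, Finset.sum_const_zero,
    sub_zero]

/-- The sum `∑ G_γ ∂_{μ̄}(A^γ_α(z)v) v^α v̄^μ` in the holomorphic sectional curvature. -/
def curvatureSum (b : Module.Basis ι ℂ E) (g : E → E → ℝ) (A : E → E →ₗ[ℂ] E →ₗ[ℂ] E)
    (z v : E) : ℂ :=
  ∑ γ, ∑ α, ∑ μ, fiberDeriv b g γ z v * wirtBar (fun ζ => b.repr (A ζ (b α) v) γ) z (b μ) *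
    b.repr v α * (starRingEnd ℂ) (b.repr v μ)

/-- In this form the metric enters, apart from its connection, only through `G` and its first fibre
derivatives at the point, which is what makes a chain rule for the curvature possible. -/
lemma localHolSecCurv_eq (hU : IsOpen U)
    (hg : ContDiffOn ℝ ∞ (fun p : E × E => g p.1 p.2) (U ×ˢ {0}ᶜ))
    (hc : ∀ z ∈ U, ∀ v : E, v ≠ 0 → FiberConvexAt g z v) (hA : IsConnectionOn U g A)
    (hz : z ∈ U) (hv : v ≠ 0) :
    localHolSecCurv b g z v = -(2 / (g z v : ℂ) ^ 2) * curvatureSum b g A z v := by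
  simp only [localHolSecCurv, curvatureSum, deltaBar_chernFinsler_eq hU hg hc hA hz hv]

end LocalConnection

/-! ### Convexity of the mixed power mean and the two inequalities for the curvature. -/

section PowerMean

variable {κ : Type*} [Fintype κ] {t : ℝ} {k : ℕ}

/-- The function `(1 + t)⁻¹ (∑ x_l + t (∑ x_l ^ k) ^ (1 / k))`, which gives the square of the
product metric in terms of the squared lengths `x_l` of the components. -/
def mixFun (t : ℝ) (k : ℕ) (x : κ → ℝ) : ℝ :=
  (1 + t)⁻¹ * (∑ l, x l + t * (∑ l, x l ^ k) ^ (1 / (k : ℝ)))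

/-- The partial derivatives of `mixFun`. -/
def mixDeriv (t : ℝ) (k : ℕ) (x : κ → ℝ) (l : κ) : ℝ :=
  (1 + t)⁻¹ * (1 + t * (∑ j, x j ^ k) ^ (1 / (k : ℝ) - 1) * x l ^ (k - 1))

lemma hasFDerivAt_mixFun (hk : k ≠ 0) {x : κ → ℝ} (hx : ∑ l, x l ^ k ≠ 0) :
    HasFDerivAt (mixFun t k)
      (∑ l, mixDeriv t k x l • (ContinuousLinearMap.proj l : (κ → ℝ) →L[ℝ] ℝ)) x := by
  have hp : ∀ l, HasFDerivAt (fun y : κ → ℝ => y l)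
      (ContinuousLinearMap.proj l : (κ → ℝ) →L[ℝ] ℝ) x := fun l =>
    (ContinuousLinearMap.proj (R := ℝ) (φ := fun _ : κ => ℝ) l).hasFDerivAt
  have h1 : HasFDerivAt (fun y : κ → ℝ => ∑ l, y l) _ x := HasFDerivAt.fun_sum fun l _ => hp l
  have h2 : HasFDerivAt (fun y : κ → ℝ => ∑ l, y l ^ k) _ x :=
    HasFDerivAt.fun_sum fun l _ => (hp l).pow k
  have h3 := (h1.add ((h2.rpow_const (p := 1 / (k : ℝ)) (Or.inl hx)).const_mul t)).const_mul
    (1 + t)⁻¹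
  refine h3.congr_fderiv ?_
  ext X
  have hk' : (k : ℝ) ≠ 0 := Nat.cast_ne_zero.mpr hk
  simp only [mixDeriv, smul_apply, add_apply, sum_apply, ContinuousLinearMap.proj_apply,
    smul_eq_mul, nsmul_eq_mul, Finset.mul_sum, ← Finset.sum_add_distrib]
  refine Finset.sum_congr rfl fun l _ => ?_
  field_simp

lemma contDiffAt_mixFun {x : κ → ℝ} (hx : ∑ l, x l ^ k ≠ 0) :
    ContDiffAt ℝ ∞ (mixFun t k) x := by
  have h1 : ContDiffAt ℝ ∞ (fun y : κ → ℝ => ∑ l, y l) x :=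
    ContDiffAt.sum fun l _ => (contDiff_apply ℝ ℝ l).contDiffAt
  have h2 : ContDiffAt ℝ ∞ (fun y : κ → ℝ => ∑ l, y l ^ k) x :=
    ContDiffAt.sum fun l _ => (contDiff_apply ℝ ℝ l).contDiffAt.pow k
  exact contDiffAt_const.mul (h1.add (contDiffAt_const.mul (h2.rpow_const_of_ne hx)))

lemma continuous_mixFun (hk : k ≠ 0) : Continuous (mixFun t k : (κ → ℝ) → ℝ) := by
  have h2 : Continuous fun x : κ → ℝ => (∑ l, x l ^ k) ^ (1 / (k : ℝ)) :=
    Continuous.rpow_const (by fun_prop) fun x => Or.inr (by positivity)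
  unfold mixFun
  fun_prop

lemma sum_pow_pos_of_ne {x : κ → ℝ} (hx : ∀ l, 0 ≤ x l) {l : κ} (hl : x l ≠ 0) :
    0 < ∑ j, x j ^ k :=
  Finset.sum_pos' (fun j _ => pow_nonneg (hx j) k)
    ⟨l, Finset.mem_univ l, pow_pos (lt_of_le_of_ne (hx l) hl.symm) k⟩

lemma mixFun_nonneg (ht : 0 ≤ t) {x : κ → ℝ} (hx : ∀ l, 0 ≤ x l) : 0 ≤ mixFun t k x := by
  have h1 : 0 ≤ ∑ l, x l := Finset.sum_nonneg fun l _ => hx l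
  have h2 : 0 ≤ (∑ l, x l ^ k) ^ (1 / (k : ℝ)) :=
    Real.rpow_nonneg (Finset.sum_nonneg fun l _ => pow_nonneg (hx l) k) _
  unfold mixFun
  positivity

lemma mixFun_pos (ht : 0 ≤ t) {x : κ → ℝ} (hx : ∀ l, 0 ≤ x l) {l : κ} (hl : x l ≠ 0) :
    0 < mixFun t k x := by
  have h1 : 0 < ∑ j, x j := Finset.sum_pos' (fun j _ => hx j)
    ⟨l, Finset.mem_univ l, lt_of_le_of_ne (hx l) hl.symm⟩
  have h2 : 0 ≤ (∑ l, x l ^ k) ^ (1 / (k : ℝ)) :=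
    Real.rpow_nonneg (Finset.sum_nonneg fun l _ => pow_nonneg (hx l) k) _
  unfold mixFun
  positivity

lemma mixFun_smul (hk : k ≠ 0) {x : κ → ℝ} (hx : ∀ l, 0 ≤ x l) {c : ℝ} (hc : 0 ≤ c) :
    mixFun t k (fun l => c * x l) = c * mixFun t k x := by
  have h : (∑ l, (c * x l) ^ k) ^ (1 / (k : ℝ)) = c * (∑ l, x l ^ k) ^ (1 / (k : ℝ)) := by
    simp only [mul_pow, ← Finset.mul_sum]
    rw [Real.mul_rpow (pow_nonneg hc k) (Finset.sum_nonneg fun l _ => pow_nonneg (hx l) k),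
      one_div, Real.pow_rpow_inv_natCast hc hk]
  rw [mixFun, mixFun, h, ← Finset.mul_sum]
  ring

/-- Second-order behaviour of an `ℓ^k` norm along quadratic polynomials. -/
lemma exists_deriv_powerMean (hk : 2 ≤ k) (a b c : κ → ℝ) (ha : ∀ l, 0 ≤ a l) (hc : ∀ l, 0 ≤ c l)
    (hS : 0 < ∑ l, a l ^ k) :
    ∃ (N' : ℝ → ℝ) (D : ℝ),
      (∀ᶠ s in nhds (0 : ℝ), HasDerivAt
        (fun s : ℝ => (∑ l, (a l + s * b l + s ^ 2 * c l) ^ k) ^ (1 / (k : ℝ))) (N' s) s) ∧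
      HasDerivAt N' D 0 ∧ 0 ≤ D := by
  -- With `k = j + 2` the exponents `k - 1` and `k - 2` become `j + 1` and `j`, free of truncated
  -- subtraction.
  obtain ⟨j, rfl⟩ := Nat.exists_eq_add_of_le' hk
  set p : ℝ := 1 / ((j + 2 : ℕ) : ℝ) with hp
  have hk0 : ((j + 2 : ℕ) : ℝ) ≠ 0 := by positivity
  set u : κ → ℝ → ℝ := fun l s => a l + s * b l + s ^ 2 * c l with hu
  set u' : κ → ℝ → ℝ := fun l s => b l + 2 * s * c l with hu'
  set S : ℝ → ℝ := fun s => ∑ l, u l s ^ (j + 2) with hSdef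
  set P : ℝ → ℝ := fun s => ∑ l, u l s ^ (j + 1) * u' l s with hP
  have hu1 : ∀ l s, HasDerivAt (u l) (u' l s) s := fun l s => by
    have := (((hasDerivAt_id s).mul_const (b l)).const_add (a l)).add
      (((hasDerivAt_id s).pow 2).mul_const (c l))
    refine this.congr_deriv ?_
    simp [hu']
  have hu2 : ∀ l s, HasDerivAt (u' l) (2 * c l) s := fun l s => by
    have := (((hasDerivAt_id s).const_mul 2).mul_const (c l)).const_add (b l)
    simpa [hu'] using this.congr_deriv (by simp)
  have hS1 : ∀ s, HasDerivAt S (((j + 2 : ℕ) : ℝ) * P s) s := fun s => by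
    have : HasDerivAt S (∑ l, ((j + 2 : ℕ) : ℝ) * u l s ^ (j + 1) * u' l s) s :=
      HasDerivAt.fun_sum fun l _ => (hu1 l s).pow (j + 2)
    refine this.congr_deriv ?_
    simp only [hP, Finset.mul_sum, mul_assoc]
  set D0 : ℝ := ∑ l, (((j + 1 : ℕ) : ℝ) * a l ^ j * b l * b l + a l ^ (j + 1) * (2 * c l)) with hD0
  have hu0 : ∀ l, u l 0 = a l := fun l => by simp [hu]
  have hu0' : ∀ l, u' l 0 = b l := fun l => by simp [hu']
  have hP1 : HasDerivAt P D0 0 := by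
    have : HasDerivAt P _ 0 :=
      HasDerivAt.fun_sum fun l (_ : l ∈ Finset.univ) => ((hu1 l 0).pow (j + 1)).mul (hu2 l 0)
    refine this.congr_deriv ?_
    simp [hD0, hu0, hu0']
  have hS0 : S 0 = ∑ l, a l ^ (j + 2) := by simp [hSdef, hu0]
  have hS0pos : 0 < S 0 := hS0 ▸ hS
  -- As `S' = k P` and `p = 1 / k`, the factor `k p = 1` disappears from the derivative of `S ^ p`.
  refine ⟨fun s => S s ^ (p - 1) * P s,
    (((j + 2 : ℕ) : ℝ) * P 0) * (p - 1) * S 0 ^ (p - 1 - 1) * P 0 + S 0 ^ (p - 1) * D0, ?_, ?_, ?_⟩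
  · filter_upwards [(hS1 0).continuousAt.eventually (lt_mem_nhds hS0pos)] with s hs
    refine ((hS1 s).rpow_const (p := p) (Or.inl hs.ne')).congr_deriv ?_
    rw [hp]
    field_simp
  · exact ((hS1 0).rpow_const (p := p - 1) (Or.inl hS0pos.ne')).mul hP1
  · have hrp : S 0 ^ (p - 1) = S 0 ^ (p - 1 - 1) * S 0 := by
      rw [Real.rpow_sub_one hS0pos.ne' (p - 1)]
      field_simp
    have hkp : ((j + 2 : ℕ) : ℝ) * (p - 1) = -((j + 1 : ℕ) : ℝ) := by
      rw [mul_sub, hp, mul_one_div_cancel hk0]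
      push_cast
      ring
    have hP0 : P 0 = ∑ l, a l ^ (j + 1) * b l := by simp [hP, hu0, hu0']
    -- Cauchy-Schwarz for the splitting of `a^(j+1) b` into `a^((j+2)/2)` and `a^(j/2) b`.
    have hCS : P 0 ^ 2 ≤ S 0 * ∑ l, a l ^ j * b l ^ 2 := by
      rw [hP0, hS0]
      refine Finset.sum_sq_le_sum_mul_sum_of_sq_le_mul Finset.univ
        (fun l _ => pow_nonneg (ha l) _)
        (fun l _ => mul_nonneg (pow_nonneg (ha l) _) (sq_nonneg _)) fun l _ => le_of_eq (by ring)
    have hDge : ((j + 1 : ℕ) : ℝ) * ∑ l, a l ^ j * b l ^ 2 ≤ D0 := by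
      rw [hD0, Finset.mul_sum]
      refine Finset.sum_le_sum fun l _ => ?_
      have : 0 ≤ a l ^ (j + 1) * (2 * c l) :=
        mul_nonneg (pow_nonneg (ha l) _) (mul_nonneg zero_le_two (hc l))
      nlinarith
    have hfin : 0 ≤ -((j + 1 : ℕ) : ℝ) * P 0 ^ 2 + S 0 * D0 := by
      have h1 := mul_le_mul_of_nonneg_left hDge hS0pos.le
      have h2 := mul_le_mul_of_nonneg_left hCS (Nat.cast_nonneg (α := ℝ) (j + 1))
      nlinarith
    -- The second derivative is `S^(p-2) (-(k-1) P² + S D0)`, and `D0 ≥ (k-1) ∑ a^j b²`.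
    calc (0 : ℝ) ≤ S 0 ^ (p - 1 - 1) * (-((j + 1 : ℕ) : ℝ) * P 0 ^ 2 + S 0 * D0) :=
          mul_nonneg (Real.rpow_nonneg hS0pos.le _) hfin
      _ = _ := by rw [hrp, ← hkp]; ring

/-- The first inequality behind the curvature bounds. -/
lemma sum_mixDeriv_mul_sq_le (ht : 0 ≤ t) (hk : 2 ≤ k) {x : κ → ℝ} (hx : ∀ l, 0 ≤ x l)
    (hS : 0 < ∑ l, x l ^ k) : ∑ l, mixDeriv t k x l * x l ^ 2 ≤ mixFun t k x ^ 2 := by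
  obtain ⟨j, rfl⟩ := Nat.exists_eq_add_of_le' hk
  set S := ∑ l, x l ^ (j + 2) with hSdef
  set N := S ^ (1 / ((j + 2 : ℕ) : ℝ)) with hN
  have hN0 : 0 < N := Real.rpow_pos_of_pos hS _
  have hNk : N ^ (j + 2) = S := by
    rw [hN, one_div, Real.rpow_inv_natCast_pow hS.le (by omega)]
  set w := S ^ (1 / ((j + 2 : ℕ) : ℝ) - 1) with hw
  have hw0 : 0 < w := Real.rpow_pos_of_pos hS _
  have hwS : w * S = N := by
    rw [hw, Real.rpow_sub_one hS.ne']
    field_simp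
    rfl
  -- `N` is the `ℓ^k` norm of `x`: it dominates every coordinate, and below it is shown to be at
  -- most the `ℓ^1` norm `a`.
  have hxN : ∀ l, x l ≤ N := fun l => by
    refine le_of_pow_le_pow_left₀ (n := j + 2) (by omega) hN0.le ?_
    rw [hNk]
    exact Finset.single_le_sum (f := fun l => x l ^ (j + 2)) (fun i _ => pow_nonneg (hx i) _)
      (Finset.mem_univ l)
  set a := ∑ l, x l with ha
  have ha0 : 0 ≤ a := Finset.sum_nonneg fun l _ => hx l
  have hB : ∑ l, x l ^ 2 ≤ N * a := by
    rw [ha, Finset.mul_sum]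
    exact Finset.sum_le_sum fun l _ => by nlinarith [hx l, hxN l]
  have hxa : ∀ l, x l ≤ a := fun l =>
    Finset.single_le_sum (fun i _ => hx i) (Finset.mem_univ l)
  have hB' : ∑ l, x l ^ 2 ≤ a ^ 2 := by
    rw [sq a]
    nth_rewrite 2 [ha]
    rw [Finset.mul_sum]
    exact Finset.sum_le_sum fun l _ => by nlinarith [hx l, hxa l]
  have hC : w * ∑ l, x l ^ (j + 3) ≤ N ^ 2 := by
    have : ∑ l, x l ^ (j + 3) ≤ N * S := by
      rw [hSdef, Finset.mul_sum]
      refine Finset.sum_le_sum fun l _ => ?_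
      have := mul_le_mul_of_nonneg_right (hxN l) (pow_nonneg (hx l) (j + 2))
      calc x l ^ (j + 3) = x l * x l ^ (j + 2) := by ring
        _ ≤ _ := this
    calc w * ∑ l, x l ^ (j + 3) ≤ w * (N * S) := mul_le_mul_of_nonneg_left this hw0.le
      _ = N * (w * S) := by ring
      _ = N ^ 2 := by rw [hwS]; ring
  have hNa : N ≤ a := by
    have h1 : S ≤ N ^ (j + 1) * a := by
      rw [hSdef, ha, Finset.mul_sum]
      refine Finset.sum_le_sum fun l _ => ?_
      calc x l ^ (j + 2) = x l ^ (j + 1) * x l := by ring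
        _ ≤ _ := mul_le_mul_of_nonneg_right (pow_le_pow_left₀ (hx l) (hxN l) _) (hx l)
    rw [← hNk, pow_succ] at h1
    exact le_of_mul_le_mul_left h1 (pow_pos hN0 _)
  have ht1 : 0 < 1 + t := by linarith
  have hL : ∑ l, mixDeriv t (j + 2) x l * x l ^ 2 =
      (1 + t)⁻¹ * (∑ l, x l ^ 2 + t * (w * ∑ l, x l ^ (j + 3))) := by
    simp only [mixDeriv, Finset.mul_sum, ← Finset.sum_add_distrib]
    refine Finset.sum_congr rfl fun l _ => ?_
    rw [← hSdef, ← hw, show j + 2 - 1 = j + 1 from rfl]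
    ring
  rw [hL, mixFun, ← hSdef, ← hN, ← ha, mul_pow]
  -- Of the two bounds on `∑ x_l²`, the term without `t` uses `a²` and the term with `t` uses `N a`.
  -- The left side is then at most `a² + t N a + t N² + t² N²`, and `N ≤ a` finishes.
  have key : (1 + t) * (∑ l, x l ^ 2 + t * (w * ∑ l, x l ^ (j + 3))) ≤ (a + t * N) ^ 2 := by
    nlinarith [mul_le_mul_of_nonneg_left hC ht, mul_le_mul_of_nonneg_left hB ht,
      mul_le_mul_of_nonneg_left hC (mul_nonneg ht ht),
      mul_le_mul_of_nonneg_left hNa (mul_nonneg ht hN0.le)]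
  calc (1 + t)⁻¹ * (∑ l, x l ^ 2 + t * (w * ∑ l, x l ^ (j + 3)))
      = (1 + t)⁻¹ ^ 2 * ((1 + t) * (∑ l, x l ^ 2 + t * (w * ∑ l, x l ^ (j + 3)))) := by
        field_simp
    _ ≤ _ := mul_le_mul_of_nonneg_left key (by positivity)

/-- The second inequality behind the curvature bounds. -/
lemma mixFun_sq_le (ht : 0 ≤ t) (hk : 2 ≤ k) {x : κ → ℝ} (hx : ∀ l, 0 ≤ x l)
    (hS : 0 < ∑ l, x l ^ k) :
    (1 + t) * mixFun t k x ^ 2 ≤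
      (Fintype.card κ + t * (Fintype.card κ : ℝ) ^ (1 / (k : ℝ))) *
        ∑ l, mixDeriv t k x l * x l ^ 2 := by
  obtain ⟨j, rfl⟩ := Nat.exists_eq_add_of_le' hk
  set S := ∑ l, x l ^ (j + 2) with hSdef
  set N := S ^ (1 / ((j + 2 : ℕ) : ℝ)) with hN
  set w := S ^ (1 / ((j + 2 : ℕ) : ℝ) - 1) with hw
  have hw0 : 0 < w := Real.rpow_pos_of_pos hS _
  have hwS : w * S = N := by
    rw [hw, Real.rpow_sub_one hS.ne']
    field_simp
    rfl
  have ht1 : 0 < 1 + t := by linarith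
  have hφ : ∀ l, mixDeriv t (j + 2) x l = (1 + t)⁻¹ * (1 + t * w * x l ^ (j + 1)) := fun l => rfl
  have hφ0 : ∀ l, 0 ≤ mixDeriv t (j + 2) x l := fun l => by
    have := pow_nonneg (hx l) (j + 1)
    rw [hφ]
    positivity
  -- Euler's identity for a function homogeneous of degree one. It lets `mixFun` enter the weighted
  -- Cauchy-Schwarz inequality below, whose weights are the partial derivatives.
  have hEuler : ∑ l, mixDeriv t (j + 2) x l * x l = mixFun t (j + 2) x := by
    rw [mixFun, ← hSdef, ← hN, ← hwS, hSdef]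
    simp only [Finset.mul_sum, ← Finset.sum_add_distrib]
    refine Finset.sum_congr rfl fun l _ => ?_
    rw [hφ]
    ring
  have hCS : mixFun t (j + 2) x ^ 2 ≤
      (∑ l, mixDeriv t (j + 2) x l) * ∑ l, mixDeriv t (j + 2) x l * x l ^ 2 := by
    rw [← hEuler]
    exact Finset.sum_sq_le_sum_mul_sum_of_sq_le_mul Finset.univ (fun l _ => hφ0 l)
      (fun l _ => mul_nonneg (hφ0 l) (sq_nonneg _)) fun l _ => le_of_eq (by ring)
  -- Hölder against the constant function `1`, with exponents `k` and `k / (k - 1)`; the factor `w`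
  -- cancels the power of `S` that appears.
  have hHol : w * ∑ l, x l ^ (j + 1) ≤ (Fintype.card κ : ℝ) ^ (1 / ((j + 2 : ℕ) : ℝ)) := by
    have hpq : Real.HolderConjugate ((j + 2 : ℕ) : ℝ) (((j + 2 : ℕ) : ℝ) / ((j + 1 : ℕ) : ℝ)) := by
      rw [Real.holderConjugate_iff]
      refine ⟨by push_cast; linarith [Nat.cast_nonneg (α := ℝ) j], ?_⟩
      push_cast
      field_simp
      ring
    have h := Real.inner_le_Lp_mul_Lq_of_nonneg Finset.univ (f := fun _ : κ => (1 : ℝ))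
      (g := fun l => x l ^ (j + 1)) hpq (fun _ _ => zero_le_one)
      (fun l _ => pow_nonneg (hx l) _)
    have hpw : ∀ l, (x l ^ (j + 1)) ^ (((j + 2 : ℕ) : ℝ) / ((j + 1 : ℕ) : ℝ)) = x l ^ (j + 2) := by
      intro l
      rw [← Real.rpow_natCast (x l) (j + 1), ← Real.rpow_mul (hx l),
        ← Real.rpow_natCast (x l) (j + 2)]
      congr 1
      field_simp
    simp only [one_mul, hpw, Real.one_rpow, Finset.sum_const, Finset.card_univ, nsmul_eq_mul,
      mul_one, ← hSdef] at h
    have hww : w * S ^ (1 / (((j + 2 : ℕ) : ℝ) / ((j + 1 : ℕ) : ℝ))) = 1 := by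
      rw [hw, ← Real.rpow_add hS]
      convert Real.rpow_zero S using 2
      push_cast
      field_simp
      ring
    calc w * ∑ l, x l ^ (j + 1) ≤ w * _ := mul_le_mul_of_nonneg_left h hw0.le
      _ = (Fintype.card κ : ℝ) ^ (1 / ((j + 2 : ℕ) : ℝ)) *
          (w * S ^ (1 / (((j + 2 : ℕ) : ℝ) / ((j + 1 : ℕ) : ℝ)))) := by ring
      _ = _ := by rw [hww, mul_one]
  have hsum : (1 + t) * ∑ l, mixDeriv t (j + 2) x l ≤
      Fintype.card κ + t * (Fintype.card κ : ℝ) ^ (1 / ((j + 2 : ℕ) : ℝ)) := by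
    have : (1 + t) * ∑ l, mixDeriv t (j + 2) x l =
        Fintype.card κ + t * (w * ∑ l, x l ^ (j + 1)) := by
      simp only [hφ, ← Finset.mul_sum, Finset.sum_add_distrib, Finset.sum_const, Finset.card_univ,
        nsmul_eq_mul, mul_one]
      field_simp
    rw [this]
    linarith [mul_le_mul_of_nonneg_left hHol ht]
  calc (1 + t) * mixFun t (j + 2) x ^ 2
      ≤ (1 + t) * ((∑ l, mixDeriv t (j + 2) x l) * ∑ l, mixDeriv t (j + 2) x l * x l ^ 2) :=
        mul_le_mul_of_nonneg_left hCS ht1.le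
    _ = ((1 + t) * ∑ l, mixDeriv t (j + 2) x l) * ∑ l, mixDeriv t (j + 2) x l * x l ^ 2 := by ring
    _ ≤ _ := mul_le_mul_of_nonneg_right hsum
        (Finset.sum_nonneg fun l _ => mul_nonneg (hφ0 l) (sq_nonneg _))

end PowerMean

/-! ### Hermitian metrics in local coordinates. -/

section LocalHermitian

variable {E : Type*} [NormedAddCommGroup E] [NormedSpace ℂ E]

/-- `q z v` is, for `z` in `U`, a positive definite quadratic function of `v`, smooth in
`(z, v)`. -/
structure IsLocalHermitian (U : Set E) (q : E → E → ℝ) : Prop where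
  smooth : ContDiffOn ℝ ∞ (fun p : E × E => q p.1 p.2) (U ×ˢ Set.univ)
  zero : ∀ z ∈ U, q z 0 = 0
  pos : ∀ z ∈ U, ∀ v, v ≠ 0 → 0 < q z v
  quadratic : ∀ z ∈ U, ∀ v X, ∃ β : ℝ, ∀ s : ℝ, q z (v + s • X) = q z v + s * β + s ^ 2 * q z X

variable {U : Set E} {q : E → E → ℝ} {z v : E}

namespace IsLocalHermitian

lemma nonneg (h : IsLocalHermitian U q) (hz : z ∈ U) (v : E) : 0 ≤ q z v := by
  by_cases hv : v = 0
  · rw [hv, h.zero z hz]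
  · exact (h.pos z hz v hv).le

lemma contDiffAt (h : IsLocalHermitian U q) (hU : IsOpen U) (hz : z ∈ U) (v : E) :
    ContDiffAt ℝ ∞ (fun p : E × E => q p.1 p.2) (z, v) :=
  h.smooth.contDiffAt ((hU.prod isOpen_univ).mem_nhds ⟨hz, trivial⟩)

end IsLocalHermitian

/-- The second derivative of a function in a direction can be computed along a line. -/
lemma second_fderiv_of_line {f : E → ℝ} {v X : E} (hf : ContDiffAt ℝ 2 f v) {u' : ℝ → ℝ} {D : ℝ}
    (hu : ∀ᶠ s in nhds (0 : ℝ), HasDerivAt (fun s : ℝ => f (v + s • X)) (u' s) s)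
    (hu' : HasDerivAt u' D 0) : fderiv ℝ (fun w => fderiv ℝ f w X) v X = D := by
  have hline : ∀ s : ℝ, HasDerivAt (fun s : ℝ => v + s • X) X s := fun s => by
    simpa using ((hasDerivAt_id s).smul_const X).const_add v
  have hd : ∀ᶠ w in nhds v, DifferentiableAt ℝ f w :=
    (hf.eventually (by simp)).mono fun w hw => hw.differentiableAt (by norm_num)
  have htend : Filter.Tendsto (fun s : ℝ => v + s • X) (nhds 0) (nhds v) := by
    have := (hline 0).continuousAt.tendsto
    simpa using this
  have h1 : (fun s : ℝ => fderiv ℝ f (v + s • X) X) =ᶠ[nhds 0] u' := by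
    filter_upwards [hu, htend.eventually hd] with s hs hds
    exact (hds.hasFDerivAt.comp_hasDerivAt s (hline s)).unique hs
  have h3 : DifferentiableAt ℝ (fun p => fderiv ℝ f p X) (v + (0 : ℝ) • X) := by
    simpa using ((hf.fderiv_right (m := 1) (by norm_num)).differentiableAt
      (by norm_num)).clm_apply (differentiableAt_const X)
  have h4 := h3.hasFDerivAt.comp_hasDerivAt (0 : ℝ) (hline 0)
  have h5 := (h4.congr_of_eventuallyEq h1.symm).unique hu'
  simpa using h5

/-- Half the second derivative of the quadratic polynomial `s ↦ q z (v + s X)` is its leading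
coefficient `q z X`. -/
lemma IsLocalHermitian.fiberConvexAt (h : IsLocalHermitian U q) (hU : IsOpen U) (hz : z ∈ U)
    (v : E) : FiberConvexAt q z v := by
  intro X hX
  obtain ⟨β, hβ⟩ := h.quadratic z hz v X
  have hu : ∀ s : ℝ, HasDerivAt (fun s : ℝ => q z (v + s • X)) (β + 2 * s * q z X) s := fun s => by
    simp only [hβ]
    have := (((hasDerivAt_id s).mul_const β).const_add (q z v)).add
      (((hasDerivAt_id s).pow 2).mul_const (q z X))
    exact this.congr_deriv (by simp)
  have hu' : HasDerivAt (fun s : ℝ => β + 2 * s * q z X) (2 * q z X) 0 := by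
    have := (((hasDerivAt_id (0 : ℝ)).const_mul 2).mul_const (q z X)).const_add β
    exact this.congr_deriv (by simp)
  rw [second_fderiv_of_line ((contDiffAt_fiber (h.contDiffAt hU hz v)).of_le two_le_infty)
    (Filter.Eventually.of_forall hu) hu']
  linarith [h.pos z hz X hX]

end LocalHermitian

/-! ### The product metric in local coordinates: convexity, connection, curvature. -/

section LocalProduct

variable {κ : Type*} [Fintype κ] {V : κ → Type*} [∀ l, NormedAddCommGroup (V l)]
  [∀ l, NormedSpace ℂ (V l)] {U : ∀ l, Set (V l)} {q : ∀ l, V l → V l → ℝ} {t : ℝ} {k : ℕ}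

/-- The local expression of the square of the product metric. -/
def mixSq (q : ∀ l, V l → V l → ℝ) (t : ℝ) (k : ℕ) (z v : ∀ l, V l) : ℝ :=
  mixFun t k fun l => q l (z l) (v l)

/-- The coefficients depend only on the values `f l (z l)`, so they are the same whether the squared
lengths are varied along the base or along the fibre. This is why the connection of the product does
not see `t` and `k`. -/
lemma wirt_mixFun (hk : k ≠ 0) {f : ∀ l, V l → ℝ} {z : ∀ l, V l}
    (hf : ∀ l, DifferentiableAt ℝ (f l) (z l)) (hS : ∑ l, f l (z l) ^ k ≠ 0) (X : ∀ l, V l) :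
    wirt (fun w : ∀ l, V l => (mixFun t k (fun l => f l (w l)) : ℂ)) z X =
      ∑ l, mixDeriv t k (fun l => f l (z l)) l * wirt (fun w => (f l w : ℂ)) (z l) (X l) := by
  have h1 : HasFDerivAt (fun w : ∀ l, V l => fun l => f l (w l))
      (ContinuousLinearMap.pi fun l => (fderiv ℝ (f l) (z l)).comp
        (ContinuousLinearMap.proj (R := ℝ) (φ := V) l)) z :=
    hasFDerivAt_pi.mpr fun l => (hf l).hasFDerivAt.comp z
      (ContinuousLinearMap.proj (R := ℝ) (φ := V) l).hasFDerivAt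
  have h2 : HasFDerivAt (fun w : ∀ l, V l => mixFun t k (fun l => f l (w l))) _ z :=
    HasFDerivAt.comp (g := mixFun t k) z (hasFDerivAt_mixFun (t := t) hk hS) h1
  have h3 : HasFDerivAt (fun w : ∀ l, V l => (mixFun t k (fun l => f l (w l)) : ℂ)) _ z :=
    (Complex.ofRealCLM.hasFDerivAt (x := mixFun t k (fun l => f l (z l)))).comp z h2
  have h4 : ∀ l, HasFDerivAt (fun w => (f l w : ℂ)) (Complex.ofRealCLM.comp (fderiv ℝ (f l) (z l)))
      (z l) := fun l => (Complex.ofRealCLM.hasFDerivAt (x := f l (z l))).comp (z l) (hf l).hasFDerivAt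
  rw [wirt_eq_of_hasFDerivAt h3]
  simp only [wirt_eq_of_hasFDerivAt (h4 _)]
  simp only [ContinuousLinearMap.comp_apply, Complex.ofRealCLM_apply, sum_apply, smul_apply,
    ContinuousLinearMap.proj_apply, ContinuousLinearMap.coe_pi', smul_eq_mul, Pi.smul_apply,
    Complex.ofReal_sum, Complex.ofReal_mul, Finset.mul_sum, ← Finset.sum_sub_distrib]
  exact Finset.sum_congr rfl fun l _ => by ring

omit [∀ l, NormedSpace ℂ (V l)] in
lemma isOpen_pi_univ (hU : ∀ l, IsOpen (U l)) : IsOpen (Set.univ.pi U) :=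
  isOpen_set_pi Set.finite_univ fun l _ => hU l

section

variable (hU : ∀ l, IsOpen (U l)) (hq : ∀ l, IsLocalHermitian (U l) (q l)) {z v : ∀ l, V l}

include hq

/-- A single nonzero component suffices, so the radicand stays away from the singularity of the root
at every nonzero `v`, even when some components vanish. -/
lemma mixSq_sum_pos (hz : z ∈ Set.univ.pi U) (hv : v ≠ 0) : 0 < ∑ l, q l (z l) (v l) ^ k := by
  obtain ⟨l, hl⟩ := Function.ne_iff.mp hv
  exact sum_pow_pos_of_ne (fun l => (hq l).nonneg (hz l trivial) (v l))
    ((hq l).pos (z l) (hz l trivial) (v l) hl).ne'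

lemma mixSq_pos (ht : 0 ≤ t) (hz : z ∈ Set.univ.pi U) (hv : v ≠ 0) : 0 < mixSq q t k z v := by
  obtain ⟨l, hl⟩ := Function.ne_iff.mp hv
  exact mixFun_pos ht (fun l => (hq l).nonneg (hz l trivial) (v l))
    ((hq l).pos (z l) (hz l trivial) (v l) hl).ne'

lemma contDiffOn_components :
    ContDiffOn ℝ ∞ (fun p : (∀ l, V l) × (∀ l, V l) => fun l => q l (p.1 l) (p.2 l))
      (Set.univ.pi U ×ˢ Set.univ) := by
  refine contDiffOn_pi.mpr fun l => ?_
  refine (hq l).smooth.comp (f := fun p : (∀ l, V l) × (∀ l, V l) => (p.1 l, p.2 l)) ?_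
    fun p hp => ⟨hp.1 l trivial, trivial⟩
  have h1 := (ContinuousLinearMap.proj (R := ℝ) (φ := V) l).contDiff (n := ∞)
  exact ((h1.comp contDiff_fst).prodMk (h1.comp contDiff_snd)).contDiffOn

lemma continuousOn_mixSq (hk : k ≠ 0) :
    ContinuousOn (fun p : (∀ l, V l) × (∀ l, V l) => mixSq q t k p.1 p.2)
      (Set.univ.pi U ×ˢ Set.univ) :=
  (continuous_mixFun hk).comp_continuousOn (contDiffOn_components hq).continuousOn

include hU

lemma contDiffOn_mixSq :
    ContDiffOn ℝ ∞ (fun p : (∀ l, V l) × (∀ l, V l) => mixSq q t k p.1 p.2)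
      (Set.univ.pi U ×ˢ {0}ᶜ) := by
  intro p hp
  have h1 := (contDiffOn_components hq).contDiffAt
    (((isOpen_pi_univ hU).prod isOpen_univ).mem_nhds ⟨hp.1, trivial⟩)
  exact ((contDiffAt_mixFun (mixSq_sum_pos hq hp.1 hp.2).ne').comp p h1).contDiffWithinAt

/-- The root term contributes a nonnegative second derivative; strict positivity comes entirely from
the sum of the quadratic functions, whose second derivative is `2 C > 0`. -/
lemma mixSq_fiberConvexAt (ht : 0 ≤ t) (hk : 2 ≤ k) (hz : z ∈ Set.univ.pi U) (hv : v ≠ 0) :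
    FiberConvexAt (mixSq q t k) z v := by
  intro X hX
  have hz' : ∀ l, z l ∈ U l := fun l => hz l trivial
  choose β hβ using fun l => (hq l).quadratic (z l) (hz' l) (v l) (X l)
  obtain ⟨N', D, hN, hN', hD⟩ := exists_deriv_powerMean hk (fun l => q l (z l) (v l)) β
    (fun l => q l (z l) (X l)) (fun l => (hq l).nonneg (hz' l) _)
    (fun l => (hq l).nonneg (hz' l) _) (mixSq_sum_pos hq hz hv)
  set B := ∑ l, β l with hB
  set C := ∑ l, q l (z l) (X l) with hC
  have hCpos : 0 < C := by
    have := mixSq_sum_pos (k := 1) hq hz hX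
    simpa using this
  have hlin : ∀ s : ℝ, HasDerivAt (fun s : ℝ => ∑ l, q l (z l) (v l + s • X l))
      (B + 2 * s * C) s := fun s => by
    have : HasDerivAt (fun s : ℝ => ∑ l, q l (z l) (v l) + s * B + s ^ 2 * C) (B + 2 * s * C) s := by
      have := (((hasDerivAt_id s).mul_const B).const_add (∑ l, q l (z l) (v l))).add
        (((hasDerivAt_id s).pow 2).mul_const C)
      exact this.congr_deriv (by simp)
    convert this using 2 with s'
    simp only [hβ, Finset.sum_add_distrib, hB, hC, Finset.mul_sum]
  have hu : ∀ᶠ s in nhds (0 : ℝ), HasDerivAt (fun s : ℝ => mixSq q t k z (v + s • X))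
      ((1 + t)⁻¹ * (B + 2 * s * C + t * N' s)) s := by
    filter_upwards [hN] with s hs
    have := ((hlin s).add (hs.const_mul t)).const_mul (1 + t)⁻¹
    refine this.congr_of_eventuallyEq (Filter.Eventually.of_forall fun s' => ?_)
    simp only [mixSq, mixFun, Pi.add_apply, Pi.smul_apply, hβ]
  have hu' : HasDerivAt (fun s : ℝ => (1 + t)⁻¹ * (B + 2 * s * C + t * N' s))
      ((1 + t)⁻¹ * (2 * C + t * D)) 0 := by
    have h1 := (((hasDerivAt_id (0 : ℝ)).const_mul 2).mul_const C).const_add B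
    have h2 := (h1.add (hN'.const_mul t)).const_mul (1 + t)⁻¹
    exact h2.congr_deriv (by simp)
  have hcd : ContDiffAt ℝ 2 (mixSq q t k z) v :=
    (contDiffAt_fiber (contDiffAt_of_slit (isOpen_pi_univ hU) (contDiffOn_mixSq hU hq) hz hv)).of_le
      two_le_infty
  rw [second_fderiv_of_line hcd hu hu']
  positivity

end

/-- The product of bilinear connections. -/
def piConnection (A : ∀ l, V l → V l →ₗ[ℂ] V l →ₗ[ℂ] V l) (z : ∀ l, V l) :
    (∀ l, V l) →ₗ[ℂ] (∀ l, V l) →ₗ[ℂ] (∀ l, V l) :=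
  LinearMap.mk₂ ℂ (fun X v l => A l (z l) (X l) (v l))
    (fun X Y v => by ext l; simp) (fun c X v => by ext l; simp)
    (fun X v w => by ext l; simp) (fun c X v => by ext l; simp)

omit [Fintype κ] in
lemma piConnection_apply (A : ∀ l, V l → V l →ₗ[ℂ] V l →ₗ[ℂ] V l) (z X v : ∀ l, V l) (l : κ) :
    piConnection A z X v l = A l (z l) (X l) (v l) := rfl

/-- Expanding both sides by `wirt_mixFun` gives the same coefficients, so the equation can be
checked factor by factor. -/
lemma isConnectionOn_piConnection (hU : ∀ l, IsOpen (U l))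
    (hq : ∀ l, IsLocalHermitian (U l) (q l)) {A : ∀ l, V l → V l →ₗ[ℂ] V l →ₗ[ℂ] V l}
    (hA : ∀ l, IsConnectionOn (U l) (q l) (A l)) (hk : k ≠ 0) :
    IsConnectionOn (Set.univ.pi U) (mixSq q t k) (piConnection A) := by
  intro z hz v hv X
  have hz' : ∀ l, z l ∈ U l := fun l => hz l trivial
  have hd : ∀ l, DifferentiableAt ℝ (fun p : V l × V l => q l p.1 p.2) (z l, v l) := fun l =>
    ((hq l).contDiffAt (hU l) (hz' l) (v l)).differentiableAt (by simp)
  have hd1 : ∀ l, DifferentiableAt ℝ (fun ζ => q l ζ (v l)) (z l) := fun l =>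
    (hd l).comp (z l) (f := fun ζ : V l => (ζ, v l))
      (differentiableAt_id.prodMk (differentiableAt_const _))
  have hd2 : ∀ l, DifferentiableAt ℝ (q l (z l)) (v l) := fun l =>
    (hd l).comp (v l) (f := fun w : V l => (z l, w))
      ((differentiableAt_const _).prodMk differentiableAt_id)
  have hS := (mixSq_sum_pos (k := k) hq hz hv).ne'
  simp only [mixSq]
  rw [wirt_mixFun (f := fun l ζ => q l ζ (v l)) hk hd1 hS X,
    wirt_mixFun (f := fun l => q l (z l)) hk hd2 hS (piConnection A z X v)]
  refine Finset.sum_congr rfl fun l _ => ?_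
  congr 1
  rw [piConnection_apply]
  -- The connection equation of a factor is available only for `v l ≠ 0`. At `v l = 0` both sides
  -- vanish: `q l ζ 0 = 0` near `z l`, and the connection is linear in `v`.
  by_cases hvl : v l = 0
  · rw [hvl, map_zero, wirt_zero_dir]
    have h0 : (fun ζ => (q l ζ 0 : ℂ)) =ᶠ[nhds (z l)] fun _ => 0 := by
      filter_upwards [(hU l).mem_nhds (hz' l)] with ζ hζ
      rw [(hq l).zero ζ hζ, Complex.ofReal_zero]
    rw [wirt_congr h0, wirt_of_complex (hasFDerivAt_const (0 : ℂ) (z l))]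
    simp
  · exact hA l (z l) (hz' l) (v l) hvl (X l)

section Curvature

variable [DecidableEq κ] {ι : κ → Type*} [∀ l, Fintype (ι l)] [∀ l, DecidableEq (ι l)]
  (b : ∀ l, Module.Basis (ι l) ℂ (V l))

omit [∀ l, DecidableEq (ι l)] in
-- Component `l` of the product connection depends only on the components `l` of the point and of
-- the two vectors, so only terms with all three indices in one block survive; the fibre derivative
-- supplies the weight `mixDeriv`.
lemma curvatureSum_piConnection (hU : ∀ l, IsOpen (U l))
    (hq : ∀ l, IsLocalHermitian (U l) (q l)) (A : ∀ l, V l → V l →ₗ[ℂ] V l →ₗ[ℂ] V l)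
    (hk : k ≠ 0) {z v : ∀ l, V l} (hz : z ∈ Set.univ.pi U) (hv : v ≠ 0) :
    curvatureSum (Pi.basis b) (mixSq q t k) (piConnection A) z v =
      ∑ l, mixDeriv t k (fun l => q l (z l) (v l)) l *
        curvatureSum (b l) (q l) (A l) (z l) (v l) := by
  have hz' : ∀ l, z l ∈ U l := fun l => hz l trivial
  have hd2 : ∀ l, DifferentiableAt ℝ (q l (z l)) (v l) := fun l =>
    (contDiffAt_fiber ((hq l).contDiffAt (hU l) (hz' l) (v l))).differentiableAt (by simp)
  have hS := (mixSq_sum_pos (k := k) hq hz hv).ne'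
  have hfib : ∀ (l : κ) (c : ι l), fiberDeriv (Pi.basis b) (mixSq q t k) ⟨l, c⟩ z v =
      mixDeriv t k (fun l => q l (z l) (v l)) l * fiberDeriv (b l) (q l) c (z l) (v l) := by
    intro l c
    simp only [fiberDeriv, mixSq]
    rw [wirt_mixFun (f := fun l => q l (z l)) hk hd2 hS, Finset.sum_eq_single l]
    · simp [Pi.basis_apply]
    · intro j _ hj
      simp [Pi.basis_apply, Pi.single_eq_of_ne hj, wirt_zero_dir]
    · simp
  have hrepr : ∀ (w : ∀ l, V l) (l : κ) (c : ι l),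
      (Pi.basis b).repr w ⟨l, c⟩ = (b l).repr (w l) c := fun w l c => Pi.basis_repr b w ⟨l, c⟩
  have hw : ∀ (l : κ) (c : ι l) (l' : κ) (a : ι l') (l'' : κ) (m : ι l''),
      wirtBar (fun ζ => (b l).repr (piConnection A ζ (Pi.basis b ⟨l', a⟩) v l) c) z
        (Pi.basis b ⟨l'', m⟩) =
      wirtBar (fun ζ => (b l).repr (A l ζ ((Pi.basis b ⟨l', a⟩ : ∀ l, V l) l) (v l)) c) (z l)
        ((Pi.basis b ⟨l'', m⟩ : ∀ l, V l) l) := by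
    intro l c l' a l'' m
    exact wirtBar_comp_proj l
      (fun ζ => (b l).repr (A l ζ ((Pi.basis b ⟨l', a⟩ : ∀ l, V l) l) (v l)) c) z _
  simp only [curvatureSum, Fintype.sum_sigma, hfib, hrepr, hw, Finset.mul_sum]
  refine Finset.sum_congr rfl fun l _ => Finset.sum_congr rfl fun c _ => ?_
  rw [Finset.sum_eq_single l]
  · refine Finset.sum_congr rfl fun a _ => ?_
    rw [Finset.sum_eq_single l]
    · refine Finset.sum_congr rfl fun m _ => ?_
      simp only [Pi.basis_apply, Pi.single_eq_same]
      ring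
    -- A base direction from another block does not move `z l`.
    · intro j _ hj
      refine Finset.sum_eq_zero fun m _ => ?_
      rw [Pi.basis_apply b ⟨j, m⟩, Pi.single_eq_of_ne (i := j) (i' := l) hj.symm, wirtBar_zero_dir]
      ring
    · simp
  -- A connection index from another block makes the coefficient identically zero in `ζ`.
  · intro j _ hj
    refine Finset.sum_eq_zero fun a _ => Finset.sum_eq_zero fun i _ =>
      Finset.sum_eq_zero fun m _ => ?_
    rw [Pi.basis_apply b ⟨j, a⟩, Pi.single_eq_of_ne (i := j) (i' := l) hj.symm]
    simp only [map_zero, LinearMap.zero_apply, Finsupp.coe_zero, Pi.zero_apply]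
    rw [wirtBar_of_complex (hasFDerivAt_const (0 : ℂ) (z l))]
    ring
  · simp

/-- Curvature of the product metric when all factors have constant curvature `c`. -/
lemma localHolSecCurv_mixSq (hU : ∀ l, IsOpen (U l)) (hq : ∀ l, IsLocalHermitian (U l) (q l))
    {A : ∀ l, V l → V l →ₗ[ℂ] V l →ₗ[ℂ] V l} (hA : ∀ l, IsConnectionOn (U l) (q l) (A l))
    (ht : 0 ≤ t) (hk : 2 ≤ k) {z v : ∀ l, V l} (hz : z ∈ Set.univ.pi U) (hv : v ≠ 0) (c : ℝ)
    (hc : ∀ l, v l ≠ 0 → localHolSecCurv (b l) (q l) (z l) (v l) = c) :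
    ∃ ρ : ℝ, (1 + t) / (Fintype.card κ + t * (Fintype.card κ : ℝ) ^ (1 / (k : ℝ))) ≤ ρ ∧ ρ ≤ 1 ∧
      localHolSecCurv (Pi.basis b) (mixSq q t k) z v = (ρ * c : ℝ) := by
  have hk0 : k ≠ 0 := by omega
  have hz' : ∀ l, z l ∈ U l := fun l => hz l trivial
  set x : κ → ℝ := fun l => q l (z l) (v l) with hx
  have hx0 : ∀ l, 0 ≤ x l := fun l => (hq l).nonneg (hz' l) _
  have hS : 0 < ∑ l, x l ^ k := mixSq_sum_pos hq hz hv
  have hG : 0 < mixFun t k x := mixSq_pos hq ht hz hv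
  -- Curvature `c` means `-(2 / x²)` times the sum is `c`. For `v l = 0` the curvature hypothesis
  -- says nothing, but both sides are zero.
  have hcs : ∀ l, curvatureSum (b l) (q l) (A l) (z l) (v l) = -(c * (x l : ℂ) ^ 2 / 2) := by
    intro l
    by_cases hvl : v l = 0
    · have : x l = 0 := by simp only [hx, hvl, (hq l).zero _ (hz' l)]
      simp [curvatureSum, hvl, this]
    · have h1 := hc l hvl
      rw [localHolSecCurv_eq (hU l) ((hq l).smooth.mono (Set.prod_mono_right (Set.subset_univ _)))
        (fun z hz v _ => (hq l).fiberConvexAt (hU l) hz v) (hA l) (hz' l) hvl] at h1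
      have h2 : (x l : ℂ) ≠ 0 := by
        exact_mod_cast ((hq l).pos (z l) (hz' l) (v l) hvl).ne'
      have h3 : (q l (z l) (v l) : ℂ) = x l := rfl
      rw [h3] at h1
      rw [← h1]
      field_simp
  refine ⟨(∑ l, mixDeriv t k x l * x l ^ 2) / mixFun t k x ^ 2, ?_, ?_, ?_⟩
  -- A nonzero `v` forces at least one factor, hence a positive denominator.
  · obtain ⟨l, -⟩ := Function.ne_iff.mp hv
    have : Nonempty κ := ⟨l⟩
    have hcard : (0 : ℝ) < Fintype.card κ := by exact_mod_cast Fintype.card_pos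
    rw [div_le_div_iff₀ (by positivity) (by positivity)]
    rw [mul_comm (∑ l, _)]
    exact mixFun_sq_le ht hk hx0 hS
  · rw [div_le_one (by positivity)]
    exact sum_mixDeriv_mul_sq_le ht hk hx0 hS
  · rw [localHolSecCurv_eq (isOpen_pi_univ hU) (contDiffOn_mixSq hU hq)
      (fun z hz v hv => mixSq_fiberConvexAt hU hq ht hk hz hv)
      (isConnectionOn_piConnection hU hq hA hk0) hz hv, curvatureSum_piConnection b hU hq A hk0 hz hv]
    simp only [hcs]
    have h3 : mixSq q t k z v = mixFun t k x := rfl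
    have h4 : (mixFun t k x : ℂ) ≠ 0 := by exact_mod_cast hG.ne'
    rw [h3]
    push_cast
    rw [neg_mul, ← mul_neg, ← Finset.sum_neg_distrib, Finset.mul_sum, Finset.sum_div, Finset.sum_mul]
    refine Finset.sum_congr rfl fun l _ => ?_
    simp only [← hx]
    field_simp

end Curvature

end LocalProduct

/-! ### Local symmetries produce symmetric connections. -/

section Symmetry

variable {E : Type*} [NormedAddCommGroup E] [NormedSpace ℂ E] {U : Set E} {q : E → E → ℝ}

/-- In the expansion at the origin, `s = 1` forces the linear coefficient to vanish and `s = -1`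
then gives evenness. -/
lemma IsLocalHermitian.neg (h : IsLocalHermitian U q) {z : E} (hz : z ∈ U) (v : E) :
    q z (-v) = q z v := by
  obtain ⟨β, hβ⟩ := h.quadratic z hz 0 v
  have h1 := hβ 1
  have h2 := hβ (-1)
  simp only [h.zero z hz, zero_add, one_smul, neg_smul] at h1 h2
  linarith

/-- A local holomorphic isometry with derivative `-1` at a fixed point produces a symmetric
bilinear Chern connection at this point: minus one half of its second derivative. -/
lemma exists_connection_of_symmetry (hU : IsOpen U) (hq : IsLocalHermitian U q) {z₀ : E}
    (hz₀ : z₀ ∈ U) {φ : E → E} (hφ : ContDiffAt ℝ 2 φ z₀)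
    (hφd : ∀ᶠ z in nhds z₀, DifferentiableAt ℂ φ z) (hφ₀ : φ z₀ = z₀)
    (hφ' : ∀ v, fderiv ℂ φ z₀ v = -v)
    (hiso : ∀ᶠ z in nhds z₀, ∀ v, q (φ z) (fderiv ℂ φ z v) = q z v) :
    ∃ A : E →ₗ[ℂ] E →ₗ[ℂ] E, (∀ X Y, A X Y = A Y X) ∧
      ∀ v X, wirt (fun ζ => (q ζ v : ℂ)) z₀ X = wirt (fun w => (q z₀ w : ℂ)) v (A X v) := by
  have hfd : ∀ᶠ z in nhds z₀, ∀ v, fderiv ℝ φ z v = fderiv ℂ φ z v := by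
    filter_upwards [hφd] with z hz v
    rw [(hz.hasFDerivAt.restrictScalars ℝ).fderiv]
    rfl
  have hD : HasFDerivAt (fderiv ℝ φ) (fderiv ℝ (fderiv ℝ φ) z₀) z₀ :=
    ((hφ.fderiv_right (m := 1) (by norm_num)).differentiableAt (by norm_num)).hasFDerivAt
  set C := fderiv ℝ (fderiv ℝ φ) z₀ with hC
  have hDv : ∀ v, HasFDerivAt (fun z => fderiv ℝ φ z v) (C.flip v) z₀ := fun v => by
    have := hD.clm_apply (hasFDerivAt_const v z₀)
    rwa [ContinuousLinearMap.comp_zero, zero_add] at this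
  have hsymm : ∀ X Y, C X Y = C Y X := fun X Y => (hφ.isSymmSndFDerivAt (by simp)).eq X Y
  -- The differential of `φ` is complex linear at every nearby point, so its derivative is complex
  -- linear in the vector slot; symmetry carries this over to the other slot.
  have hsmul : ∀ (c : ℂ) X v, C X (c • v) = c • C X v := by
    intro c X v
    have h1 : (fun z => fderiv ℝ φ z (c • v)) =ᶠ[nhds z₀] fun z => c • fderiv ℝ φ z v := by
      filter_upwards [hfd] with z hz
      rw [hz, hz, map_smul]
    have h2 := ((hDv v).const_smul c).congr_of_eventuallyEq h1
    simpa using congrArg (fun L : E →L[ℝ] E => L X) ((hDv (c • v)).unique h2)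
  have hsmul' : ∀ (c : ℂ) X v, C (c • X) v = c • C X v := fun c X v => by
    rw [hsymm, hsmul, hsymm]
  refine ⟨LinearMap.mk₂ ℂ (fun X v => (-(1 / 2) : ℂ) • C X v) ?_ ?_ ?_ ?_, ?_, ?_⟩
  · intro X Y v; simp
  · intro c X v; rw [hsmul', smul_comm]
  · intro X v w; simp
  · intro c X v; rw [hsmul, smul_comm]
  · intro X Y; simp only [LinearMap.mk₂_apply, hsymm X Y]
  · intro v X
    have hqd : HasFDerivAt (fun p : E × E => q p.1 p.2)
        (fderiv ℝ (fun p : E × E => q p.1 p.2) (z₀, v)) (z₀, v) :=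
      ((hq.contDiffAt hU hz₀ v).differentiableAt (by simp)).hasFDerivAt
    set L := fderiv ℝ (fun p : E × E => q p.1 p.2) (z₀, v) with hL
    have hφ0 : HasFDerivAt φ (fderiv ℝ φ z₀) z₀ :=
      (hφ.differentiableAt (by norm_num)).hasFDerivAt
    have hφ0' : ∀ w, fderiv ℝ φ z₀ w = -w := fun w => (hfd.self_of_nhds w).trans (hφ' w)
    -- Inserting `-v` makes the isometry equation pass through the same point `(z₀, v)` on both
    -- sides; evenness of `q` absorbs the sign.
    have hpt : (φ z₀, fderiv ℝ φ z₀ (-v)) = (z₀, v) := by rw [hφ₀, hφ0', neg_neg]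
    have h1 : HasFDerivAt (fun z => q (φ z) (fderiv ℝ φ z (-v)))
        (L.comp ((fderiv ℝ φ z₀).prod (C.flip (-v)))) z₀ := by
      have h2 : HasFDerivAt (fun p : E × E => q p.1 p.2) L (φ z₀, fderiv ℝ φ z₀ (-v)) := by
        rw [hpt]; exact hqd
      exact h2.comp z₀ (f := fun z => (φ z, fderiv ℝ φ z (-v))) (hφ0.prodMk (hDv (-v)))
    have h2 : HasFDerivAt (fun ζ => q ζ v) (L.comp ((ContinuousLinearMap.id ℝ E).prod 0)) z₀ :=
      hqd.comp z₀ (f := fun ζ => (ζ, v)) ((hasFDerivAt_id z₀).prodMk (hasFDerivAt_const v z₀))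
    have h3 : HasFDerivAt (fun w => q z₀ w) (L.comp ((0 : E →L[ℝ] E).prod
        (ContinuousLinearMap.id ℝ E))) v :=
      hqd.comp v (f := fun w => (z₀, w)) ((hasFDerivAt_const z₀ v).prodMk (hasFDerivAt_id v))
    have h4 : (fun z => q (φ z) (fderiv ℝ φ z (-v))) =ᶠ[nhds z₀] fun ζ => q ζ v := by
      filter_upwards [hiso, hfd, hU.mem_nhds hz₀] with z hz hz' hzU
      rw [hz', hz, hq.neg hzU]
    -- The differentiated isometry equation reads `-L(Y, 0) - L(0, C Y v) = L(Y, 0)`, whence the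
    -- factor `-1/2`.
    have h5 : ∀ Y, L (Y, 0) = L (0, (-(1 / 2) : ℂ) • C Y v) := by
      intro Y
      have h6 := congrArg (fun T : E →L[ℝ] ℝ => T Y) (h1.unique (h2.congr_of_eventuallyEq h4))
      simp only [ContinuousLinearMap.comp_apply, ContinuousLinearMap.prod_apply, hφ0',
        ContinuousLinearMap.flip_apply, (C Y).map_neg, ContinuousLinearMap.id_apply, zero_apply] at h6
      have h7 : ((-Y, -C Y v) : E × E) = -(Y, 0) - (0, C Y v) := by simp
      have h8 : ((0, (-(1 / 2) : ℂ) • C Y v) : E × E) = (-(1 / 2) : ℝ) • (0, C Y v) := by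
        have : (-(1 / 2) : ℂ) = ((-(1 / 2) : ℝ) : ℂ) := by push_cast; rfl
        rw [Prod.smul_mk, smul_zero, this, Complex.coe_smul]
      rw [h7, map_sub, map_neg] at h6
      rw [h8, map_smul, smul_eq_mul]
      linarith
    have h2' : HasFDerivAt (fun ζ => (q ζ v : ℂ)) _ z₀ :=
      (Complex.ofRealCLM.hasFDerivAt (x := q z₀ v)).comp z₀ h2
    have h3' : HasFDerivAt (fun w => (q z₀ w : ℂ)) _ v :=
      (Complex.ofRealCLM.hasFDerivAt (x := q z₀ v)).comp v h3
    rw [wirt_eq_of_hasFDerivAt h2', wirt_eq_of_hasFDerivAt h3']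
    simp only [ContinuousLinearMap.comp_apply, ContinuousLinearMap.prod_apply, zero_apply,
      ContinuousLinearMap.id_apply, LinearMap.mk₂_apply, h5, hsmul']
    rw [smul_comm Complex.I]

end Symmetry

/-! ### Hermitian metrics on a manifold in a chart. -/

section ChartOfManifold

variable {E : Type*} [NormedAddCommGroup E] [NormedSpace ℂ E]
  {M : Type*} [TopologicalSpace M] [ChartedSpace E M]

omit [ChartedSpace E M] in
lemma extend_self_target (e : OpenPartialHomeomorph M E) :
    (e.extend 𝓘(ℂ, E)).target = e.target := by simp [mfld_simps]

lemma inChart_self {β : Type*} (F : (x : M) → TangentSpace 𝓘(ℂ, E) x → β)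
    (e : OpenPartialHomeomorph M E) (z v : E) :
    inChart 𝓘(ℂ, E) F e z v = F (e.symm z) (mfderiv 𝓘(ℂ, E) 𝓘(ℂ, E) e.symm z v) := rfl

variable [IsManifold 𝓘(ℂ, E) ω M] {e : OpenPartialHomeomorph M E}

instance : IsManifold 𝓘(ℂ, E) 1 M := IsManifold.of_le (n := ω) le_top

lemma chart_mdifferentiable (he : e ∈ atlas E M) : e.MDifferentiable 𝓘(ℂ, E) 𝓘(ℂ, E) :=
  mdifferentiable_of_mem_atlas he

lemma mfderiv_chart_comp_symm (he : e ∈ atlas E M) {z : E} (hz : z ∈ e.target) (v : E) :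
    mfderiv 𝓘(ℂ, E) 𝓘(ℂ, E) e (e.symm z) (mfderiv 𝓘(ℂ, E) 𝓘(ℂ, E) e.symm z v) = v := by
  have h := (chart_mdifferentiable he).comp_symm_deriv hz
  exact congrArg (fun L : E →L[ℂ] E => L v) h

lemma mfderiv_symm_comp_chart (he : e ∈ atlas E M) {x : M} (hx : x ∈ e.source)
    (v : TangentSpace 𝓘(ℂ, E) x) :
    mfderiv 𝓘(ℂ, E) 𝓘(ℂ, E) e.symm (e x) (mfderiv 𝓘(ℂ, E) 𝓘(ℂ, E) e x v) = v := by
  have h := (chart_mdifferentiable he).symm_comp_deriv hx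
  exact congrArg (fun L : E →L[ℂ] E => L v) h

lemma mfderiv_symm_ne_zero (he : e ∈ atlas E M) {z : E} (hz : z ∈ e.target) {v : E} (hv : v ≠ 0) :
    mfderiv 𝓘(ℂ, E) 𝓘(ℂ, E) e.symm z v ≠ 0 := by
  intro h0
  have h := mfderiv_chart_comp_symm he hz v
  rw [h0, map_zero] at h
  exact hv h.symm

omit [IsManifold 𝓘(ℂ, E) ω M] in
/-- The Hermitian form of a metric in a chart. -/
lemma exists_chartForm (Q : HermitianMetric 𝓘(ℂ, E) M) (e : OpenPartialHomeomorph M E) :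
    ∃ B : E → E →ₗ[ℂ] E →ₗ⋆[ℂ] ℂ, ∀ z X Y, B z X Y = Q.form (e.symm z)
      (mfderiv 𝓘(ℂ, E) 𝓘(ℂ, E) e.symm z X) (mfderiv 𝓘(ℂ, E) 𝓘(ℂ, E) e.symm z Y) := by
  refine ⟨fun z => ?_, ?_⟩
  · let J : E →L[ℂ] E := mfderiv 𝓘(ℂ, E) 𝓘(ℂ, E) e.symm z
    let B : E →ₗ[ℂ] E →ₗ⋆[ℂ] ℂ := Q.form (e.symm z)
    exact LinearMap.mk₂'ₛₗ (RingHom.id ℂ) (starRingEnd ℂ) (fun X Y => B (J X) (J Y))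
      (fun X Y v => by simp) (fun c X v => by simp) (fun X v w => by simp) (fun c X v => by simp)
  · intro z X Y
    rfl

/-- The squared length of a Hermitian metric in a chart. -/
lemma isLocalHermitian_inChart [FiniteDimensional ℂ E] (Q : HermitianMetric 𝓘(ℂ, E) M)
    (he : e ∈ atlas E M) : IsLocalHermitian e.target (inChart 𝓘(ℂ, E) Q.quad e) where
  smooth := by
    obtain ⟨B, hB⟩ := exists_chartForm Q e
    -- Joint smoothness follows by expansion in a basis: only the coefficients depend on `z`, and
    -- they are smooth by definition of the metric.
    set b := Module.finBasis ℂ E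
    have h1 : ∀ α β, ContDiffOn ℝ ∞ (fun z : E => B z (b α) (b β)) e.target := fun α β => by
      have := Q.smooth e he (b α) (b β)
      rw [extend_self_target] at this
      exact this.congr fun z _ => hB z _ _
    have hco : ∀ α, ContDiff ℝ ∞ fun v : E => b.repr v α := fun α =>
      ((LinearMap.toContinuousLinearMap (b.coord α)).restrictScalars ℝ).contDiff
    have h2 : ContDiffOn ℝ ∞ (fun p : E × E => (∑ α, ∑ β, b.repr p.2 α *
        ((starRingEnd ℂ) (b.repr p.2 β) * B p.1 (b α) (b β))).re) (e.target ×ˢ Set.univ) := by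
      refine Complex.reCLM.contDiff.comp_contDiffOn ?_
      refine ContDiffOn.sum fun α _ => ContDiffOn.sum fun β _ => ?_
      refine ((hco α).comp contDiff_snd).contDiffOn.mul ((ContDiff.contDiffOn ?_).mul ?_)
      · exact Complex.conjCLE.contDiff.comp ((hco β).comp contDiff_snd)
      · exact (h1 α β).comp contDiff_fst.contDiffOn fun p hp => hp.1
    refine h2.congr fun p _ => ?_
    rw [inChart_self, HermitianMetric.quad, ← hB]
    congr 1
    conv_lhs => rw [← b.sum_repr p.2]
    simp only [map_sum, map_smul, LinearMap.map_smulₛₗ, LinearMap.sum_apply, LinearMap.smul_apply,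
      smul_eq_mul, Finset.mul_sum]
    rw [Finset.sum_comm]
    refine Finset.sum_congr rfl fun α _ => Finset.sum_congr rfl fun β _ => ?_
    ring
  zero z _ := by
    obtain ⟨B, hB⟩ := exists_chartForm Q e
    rw [inChart_self, HermitianMetric.quad, ← hB]
    simp
  pos z hz v hv := Q.pos _ _ (mfderiv_symm_ne_zero he hz hv)
  quadratic z _ v X := by
    obtain ⟨B, hB⟩ := exists_chartForm Q e
    refine ⟨(B z v X).re + (B z X v).re, fun s => ?_⟩
    simp only [inChart_self, HermitianMetric.quad, ← hB]
    have hs : v + s • X = v + (s : ℂ) • X := by rw [Complex.coe_smul]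
    rw [hs]
    simp only [map_add, map_smul, LinearMap.map_smulₛₗ, LinearMap.add_apply, LinearMap.smul_apply,
      smul_eq_mul, Complex.conj_ofReal, Complex.add_re, Complex.re_ofReal_mul]
    ring

end ChartOfManifold

/-! ### Involutions near a fixed point. -/

section InvolutionInverse

variable {V E : Type*} [NormedAddCommGroup V] [NormedSpace ℝ V] [CompleteSpace V]
  [NormedAddCommGroup E] [NormedSpace ℝ E]

/-- Every fixed vector of the differential of an involution is tangent to a curve of fixed
points. -/
lemma exists_fixed_curve {σ : V → V} {y₀ : V} {A : V →L[ℝ] V} (hσ : HasStrictFDerivAt σ A y₀)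
    (hσ₀ : σ y₀ = y₀) (hσσ : ∀ᶠ y in nhds y₀, σ (σ y) = y) {X : V} (hX : A X = X) :
    ∃ γ : ℝ → V, (∀ᶠ s in nhds (0 : ℝ), ContinuousAt γ s) ∧ γ 0 = y₀ ∧ HasDerivAt γ X 0 ∧
      ∀ᶠ s in nhds (0 : ℝ), σ (γ s) = γ s := by
  have hAA : A.comp A = ContinuousLinearMap.id ℝ V := by
    have h1 : HasFDerivAt σ A (σ y₀) := by rw [hσ₀]; exact hσ.hasFDerivAt
    have h2 := h1.comp y₀ hσ.hasFDerivAt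
    exact h2.unique ((hasFDerivAt_id y₀).congr_of_eventuallyEq hσσ)
  have hAA' : ∀ w, A (A w) = w := fun w => congrArg (fun L : V →L[ℝ] V => L w) hAA
  -- Averaging over the involution yields a local coordinate that linearises it: since `A² = 1`, `f`
  -- has differential the identity and satisfies `f ∘ σ = A ∘ f`. The curve is the preimage of the
  -- line `s X`, whose points are fixed by `A`.
  set f : V → V := fun y => (1 / 2 : ℝ) • ((y - y₀) + A (σ y - y₀)) with hf
  have hf' : HasStrictFDerivAt f ((ContinuousLinearEquiv.refl ℝ V : V ≃L[ℝ] V) : V →L[ℝ] V) y₀ := by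
    have h := (((hasStrictFDerivAt_id (𝕜 := ℝ) y₀).sub_const y₀).add
      (A.hasStrictFDerivAt.comp y₀ (hσ.sub_const y₀))).const_smul (1 / 2 : ℝ)
    refine h.congr_fderiv ?_
    ext w
    simp only [smul_apply, add_apply, ContinuousLinearMap.comp_apply, hAA',
      ContinuousLinearMap.id_apply, ContinuousLinearEquiv.coe_coe, ContinuousLinearEquiv.refl_apply]
    module
  have hf0 : f y₀ = 0 := by simp [hf, hσ₀]
  have hfσ : ∀ᶠ y in nhds y₀, f (σ y) = A (f y) := by
    filter_upwards [hσσ] with y hy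
    simp only [hf, hy, map_smul, map_add, hAA']
    rw [add_comm]
  set Φ := hf'.toOpenPartialHomeomorph f with hΦ
  have hΦf : ∀ y, Φ y = f y := fun y => rfl
  have hy₀ : y₀ ∈ Φ.source := hf'.mem_toOpenPartialHomeomorph_source
  have h0 : (0 : V) ∈ Φ.target := by
    have := Φ.map_source hy₀
    rwa [hΦf, hf0] at this
  have hinv0 : Φ.symm 0 = y₀ := by
    have := Φ.left_inv hy₀
    rwa [hΦf, hf0] at this
  have hcont : Continuous fun s : ℝ => s • X := continuous_id.smul continuous_const
  have hT : ∀ᶠ s in nhds (0 : ℝ), s • X ∈ Φ.target :=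
    hcont.continuousAt.eventually_mem (by simpa using Φ.open_target.mem_nhds h0)
  set γ : ℝ → V := fun s => Φ.symm (s • X) with hγ
  have hγ0 : γ 0 = y₀ := by simp [hγ, hinv0]
  have hγc : ∀ᶠ s in nhds (0 : ℝ), ContinuousAt γ s := by
    filter_upwards [hT] with s hs
    exact ContinuousAt.comp (f := fun s : ℝ => s • X) (Φ.continuousAt_symm hs) hcont.continuousAt
  have htend : Filter.Tendsto γ (nhds 0) (nhds y₀) := by
    have := hγc.self_of_nhds.tendsto
    rwa [hγ0] at this
  refine ⟨γ, hγc, hγ0, ?_, ?_⟩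
  · have h1 := hf'.to_localInverse.hasFDerivAt
    rw [hf0] at h1
    have h1' : HasFDerivAt (hf'.localInverse f _ y₀)
        (((ContinuousLinearEquiv.refl ℝ V).symm : V ≃L[ℝ] V) : V →L[ℝ] V) ((0 : ℝ) • X) := by
      rwa [zero_smul]
    have h2 := h1'.comp_hasDerivAt (0 : ℝ) ((hasDerivAt_id (0 : ℝ)).smul_const X)
    have h3 : HasDerivAt γ _ 0 := h2
    exact h3.congr_deriv (by simp)
  · have hσt : Filter.Tendsto (fun s => σ (γ s)) (nhds 0) (nhds y₀) := by
      have := hσ.continuousAt.tendsto.comp htend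
      rwa [hσ₀] at this
    filter_upwards [hT, htend.eventually hfσ, hσt.eventually (Φ.open_source.mem_nhds hy₀)]
      with s hs h1 h2
    have h3 : f (γ s) = s • X := Φ.right_inv hs
    have h4 : f (σ (γ s)) = f (γ s) := by rw [h1, h3, map_smul, hX]
    exact Φ.injOn h2 (Φ.map_target hs) h4

/-- If a submersion `π` is constant along curves of fixed points of an involution `σ`, then the
map `τ` induced by `σ` has differential `-1`. -/
lemma fderiv_induced_eq_neg {σ : V → V} {y₀ : V} {A : V →L[ℝ] V} (hσ : HasStrictFDerivAt σ A y₀)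
    (hσ₀ : σ y₀ = y₀) (hσσ : ∀ᶠ y in nhds y₀, σ (σ y) = y) {π : V → E} {P : V →L[ℝ] E}
    (hπ : HasFDerivAt π P y₀) (hP : Function.Surjective P)
    (hcurve : ∀ γ : ℝ → V, (∀ᶠ s in nhds (0 : ℝ), ContinuousAt γ s) → γ 0 = y₀ →
      (∀ᶠ s in nhds (0 : ℝ), σ (γ s) = γ s) → ∀ᶠ s in nhds (0 : ℝ), π (γ s) = π y₀)
    {τ : E → E} {T : E →L[ℝ] E} (hτ : HasFDerivAt τ T (π y₀))
    (hcomm : ∀ᶠ y in nhds y₀, τ (π y) = π (σ y)) (w : E) : T w = -w := by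
  have hAA' : ∀ w, A (A w) = w := fun w => by
    have h1 : HasFDerivAt σ A (σ y₀) := by rw [hσ₀]; exact hσ.hasFDerivAt
    have h2 := (h1.comp y₀ hσ.hasFDerivAt).unique
      ((hasFDerivAt_id y₀).congr_of_eventuallyEq hσσ)
    exact congrArg (fun L : V →L[ℝ] V => L w) h2
  have hker : ∀ X, A X = X → P X = 0 := by
    intro X hX
    obtain ⟨γ, hγc, hγ0, hγd, hγf⟩ := exists_fixed_curve hσ hσ₀ hσσ hX
    have h1 := hcurve γ hγc hγ0 hγf
    have hπ' : HasFDerivAt π P (γ 0) := by rwa [hγ0]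
    exact (hπ'.comp_hasDerivAt 0 hγd).unique
      ((hasDerivAt_const (0 : ℝ) (π y₀)).congr_of_eventuallyEq h1)
  obtain ⟨X, rfl⟩ := hP w
  have h1 : HasFDerivAt π P (σ y₀) := by rwa [hσ₀]
  have h2 := (hτ.comp y₀ hπ).unique ((h1.comp y₀ hσ.hasFDerivAt).congr_of_eventuallyEq hcomm)
  have h3 : T (P X) = P (A X) := congrArg (fun L : V →L[ℝ] E => L X) h2
  -- `X + A X` is always fixed by `A`, so `P (A X) = -P X`.
  have h4 := hker (X + A X) (by rw [map_add, hAA', add_comm])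
  rw [map_add] at h4
  rw [h3]
  exact eq_neg_of_add_eq_zero_right h4

end InvolutionInverse

/-! ### The underlying smooth structure, submersions and chart expressions. -/

section RealStructure

variable {E : Type*} [NormedAddCommGroup E] [NormedSpace ℂ E]
  {M : Type*} [TopologicalSpace M] [ChartedSpace E M]

lemma isManifold_real [IsManifold 𝓘(ℂ, E) ω M] : IsManifold 𝓘(ℝ, E) ∞ M := by
  refine isManifold_of_contDiffOn 𝓘(ℝ, E) ∞ M fun e e' he he' => ?_
  have h := ((contDiffGroupoid ω 𝓘(ℂ, E)).compatible he he')
  rw [contDiffGroupoid, mem_groupoid_of_pregroupoid] at h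
  have h1 : ContDiffOn ℂ ω (𝓘(ℂ, E) ∘ (e.symm ≫ₕ e') ∘ 𝓘(ℂ, E).symm)
      (𝓘(ℂ, E).symm ⁻¹' (e.symm ≫ₕ e').source ∩ Set.range 𝓘(ℂ, E)) := h.1
  exact (h1.restrict_scalars ℝ).of_le le_top

end RealStructure

section Submersion

variable {V E : Type*} [NormedAddCommGroup V] [NormedSpace ℝ V]
  [NormedAddCommGroup E] [NormedSpace ℝ E]
  {P : Type*} [TopologicalSpace P] [ChartedSpace V P]
  {N : Type*} [TopologicalSpace N] [ChartedSpace E N]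

/-- Submersions have smooth local sections. -/
lemma exists_localSection {π : P → N} (hπ : Manifold.IsSubmersion 𝓘(ℝ, V) 𝓘(ℝ, E) ∞ π) (a : P) :
    ∃ σ : N → P, ContMDiffAt 𝓘(ℝ, E) 𝓘(ℝ, V) ∞ σ (π a) ∧ σ (π a) = a ∧
      ∀ᶠ y in nhds (π a), π (σ y) = y := by
  have h := hπ.isSubmersionOfComplement_complement a
  set φ := h.domChart
  set ψ := h.codChart
  set L := h.equiv
  have ha : a ∈ φ.source := h.mem_domChart_source
  have hπa : π a ∈ ψ.source := h.mem_codChart_source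
  have hw : ∀ y ∈ φ.target, ψ (π (φ.symm y)) = (L y).1 := fun y hy =>
    h.writtenInCharts (by simpa [mfld_simps] using hy)
  set c : hπ.complement := (L (φ a)).2
  have h1 : ψ (π a) = (L (φ a)).1 := by
    have := hw (φ a) (φ.map_source ha)
    rwa [φ.left_inv ha] at this
  -- In submersion charts `π` is a linear projection, so freezing the complementary coordinate at
  -- its value at `a` defines a section.
  set u : N → V := fun y => L.symm (ψ y, c) with hu
  have hu0 : u (π a) = φ a := by
    simp only [hu, h1, c, Prod.mk.eta, ContinuousLinearEquiv.symm_apply_apply]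
  have hψ : ContMDiffAt 𝓘(ℝ, E) 𝓘(ℝ, E) ∞ ψ (π a) :=
    contMDiffAt_of_mem_maximalAtlas h.codChart_mem_maximalAtlas hπa
  have huc : ContMDiffAt 𝓘(ℝ, E) 𝓘(ℝ, V) ∞ u (π a) := by
    have hL : ContDiff ℝ ∞ fun w : E => L.symm (w, c) :=
      L.symm.contDiff.comp (contDiff_id.prodMk contDiff_const)
    exact hL.contMDiff.contMDiffAt.comp (π a) hψ
  have hmem : ∀ᶠ y in nhds (π a), u y ∈ φ.target :=
    huc.continuousAt.eventually_mem (by rw [hu0]; exact φ.open_target.mem_nhds (φ.map_source ha))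
  refine ⟨fun y => φ.symm (u y), ?_, ?_, ?_⟩
  · have : ContMDiffAt 𝓘(ℝ, V) 𝓘(ℝ, V) ∞ φ.symm (u (π a)) := by
      rw [hu0]
      exact contMDiffAt_symm_of_mem_maximalAtlas h.domChart_mem_maximalAtlas (φ.map_source ha)
    exact this.comp (π a) huc
  · simp only [hu0, φ.left_inv ha]
  · filter_upwards [hmem, ψ.open_source.mem_nhds hπa] with y hy hyψ
    refine ψ.injOn (h.mapsto_domChart_source_codChart_source (φ.map_target hy)) hyψ ?_
    rw [hw _ hy]
    simp [hu]

/-- A map from the base of a surjective submersion is smooth if its composition with the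
submersion is. -/
lemma contMDiff_of_comp_submersion {π : P → N} (hπ : Manifold.IsSubmersion 𝓘(ℝ, V) 𝓘(ℝ, E) ∞ π)
    (hsurj : Function.Surjective π) {E' : Type*} [NormedAddCommGroup E'] [NormedSpace ℝ E']
    {N' : Type*} [TopologicalSpace N'] [ChartedSpace E' N'] {f : N → N'}
    (hf : ContMDiff 𝓘(ℝ, V) 𝓘(ℝ, E') ∞ (f ∘ π)) : ContMDiff 𝓘(ℝ, E) 𝓘(ℝ, E') ∞ f := by
  intro x
  obtain ⟨a, rfl⟩ := hsurj x
  obtain ⟨σ, hσ, hσa, hπσ⟩ := exists_localSection hπ a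
  have h1 : ContMDiffAt 𝓘(ℝ, E) 𝓘(ℝ, E') ∞ ((f ∘ π) ∘ σ) (π a) :=
    hf.contMDiffAt.comp (π a) hσ
  refine h1.congr_of_eventuallyEq ?_
  filter_upwards [hπσ] with y hy
  simp [hy]

end Submersion

section ChartExpression

variable {V E : Type*} [NormedAddCommGroup V] [NormedSpace ℝ V]
  [NormedAddCommGroup E] [NormedSpace ℝ E]
  {P : Type*} [TopologicalSpace P] [ChartedSpace V P] [IsManifold 𝓘(ℝ, V) ∞ P]
  {N : Type*} [TopologicalSpace N] [ChartedSpace E N] [IsManifold 𝓘(ℝ, E) ∞ N]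

/-- Smooth maps are smooth in charts. -/
lemma contDiffAt_chartExpression {e : OpenPartialHomeomorph P V} (he : e ∈ atlas V P)
    {e' : OpenPartialHomeomorph N E} (he' : e' ∈ atlas E N) {f : P → N} {y : V}
    (hy : y ∈ e.target) (hf : ContMDiffAt 𝓘(ℝ, V) 𝓘(ℝ, E) ∞ f (e.symm y))
    (hfy : f (e.symm y) ∈ e'.source) : ContDiffAt ℝ ∞ (fun w => e' (f (e.symm w))) y := by
  have h1 : ContMDiffAt 𝓘(ℝ, V) 𝓘(ℝ, V) ∞ e.symm y :=
    contMDiffAt_symm_of_mem_maximalAtlas (IsManifold.subset_maximalAtlas he) hy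
  have h2 : ContMDiffAt 𝓘(ℝ, E) 𝓘(ℝ, E) ∞ e' (f (e.symm y)) :=
    contMDiffAt_of_mem_maximalAtlas (IsManifold.subset_maximalAtlas he') hfy
  have h3 := h2.comp (e.symm y) hf
  exact (h3.comp y h1).contDiffAt

end ChartExpression

/-! ### Holomorphic isometries and point symmetries. -/

section PointSymmetry

variable {E : Type*} [NormedAddCommGroup E] [NormedSpace ℂ E]
  {M : Type*} [TopologicalSpace M] [ChartedSpace E M]

/-- `s` is complex differentiable at `x` and its differential preserves `F`. -/
def IsHolomorphicIsometryAt (F : (x : M) → TangentSpace 𝓘(ℂ, E) x → ℝ) (s : M → M) (x : M) :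
    Prop :=
  MDifferentiableAt 𝓘(ℂ, E) 𝓘(ℂ, E) s x ∧
    ∀ v, F (s x) (mfderiv 𝓘(ℂ, E) 𝓘(ℂ, E) s x v) = F x v

lemma IsHolomorphicIsometryAt.comp {F : (x : M) → TangentSpace 𝓘(ℂ, E) x → ℝ} {s s' : M → M} {x : M}
    (h : IsHolomorphicIsometryAt F s (s' x)) (h' : IsHolomorphicIsometryAt F s' x) :
    IsHolomorphicIsometryAt F (s ∘ s') x := by
  refine ⟨h.1.comp x h'.1, fun v => ?_⟩
  rw [mfderiv_comp x h.1 h'.1, ← h'.2 v, ← h.2]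
  rfl

/-- `s` is a holomorphic involutive isometry with fixed point `p` and differential `-1` there. -/
structure IsPointSymmetry (F : (x : M) → TangentSpace 𝓘(ℂ, E) x → ℝ) (p : M) (s : M → M) :
    Prop where
  involutive : ∀ x, s (s x) = x
  isometry : ∀ x, IsHolomorphicIsometryAt F s x
  smooth : ContMDiff 𝓘(ℝ, E) 𝓘(ℝ, E) ∞ s
  fixed : s p = p
  deriv : HasMFDerivAt 𝓘(ℂ, E) 𝓘(ℂ, E) s p (-ContinuousLinearMap.id ℂ E : E →L[ℂ] E)

end PointSymmetry

/-! ### Point symmetries of Hermitian symmetric coset spaces. -/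

section Coset

variable {V E : Type*} [NormedAddCommGroup V] [NormedSpace ℝ V]
  [NormedAddCommGroup E] [NormedSpace ℂ E]
  {G : Type*} [Group G] {K : Subgroup G}

/-- The map of cosets induced by an automorphism fixing the subgroup pointwise. -/
def cosetMap (σ : G ≃* G) (hσK : (K : Set G) ⊆ {g : G | σ g = g}) : G ⧸ K → G ⧸ K :=
  Quotient.map' σ fun a b hab => by
    rw [QuotientGroup.leftRel_apply] at hab ⊢
    rw [← map_inv, ← map_mul, show σ (a⁻¹ * b) = a⁻¹ * b from hσK hab]
    exact hab

variable {σ : G ≃* G} (hσK : (K : Set G) ⊆ {g : G | σ g = g})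

lemma cosetMap_mk (a : G) : cosetMap σ hσK (a : G ⧸ K) = (σ a : G) := rfl

/-- This equivariance transports what is known of the symmetry at the base point to every other
point. -/
lemma cosetMap_smul (g : G) (x : G ⧸ K) : cosetMap σ hσK (g • x) = σ g • cosetMap σ hσK x := by
  obtain ⟨a, rfl⟩ := QuotientGroup.mk_surjective x
  rw [cosetMap_mk, MulAction.Quotient.smul_coe, MulAction.Quotient.smul_coe, cosetMap_mk,
    smul_eq_mul, smul_eq_mul, map_mul]

lemma cosetMap_involutive (hσσ : ∀ g, σ (σ g) = g) (x : G ⧸ K) :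
    cosetMap σ hσK (cosetMap σ hσK x) = x := by
  obtain ⟨a, rfl⟩ := QuotientGroup.mk_surjective x
  rw [cosetMap_mk, cosetMap_mk, hσσ]

lemma cosetMap_one : cosetMap σ hσK ((1 : G) : G ⧸ K) = ((1 : G) : G ⧸ K) := by
  rw [cosetMap_mk, map_one]

variable [TopologicalSpace G] [ChartedSpace V G]

/-- Curves of fixed points of `σ` through the identity lie in `K`. -/
lemma eventually_mem_of_fixed_curve
    (hcomp : connectedComponentIn {g : G | σ g = g} 1 ⊆ K) {γ : ℝ → G}
    (hγ : ∀ᶠ s in nhds (0 : ℝ), ContinuousAt γ s) (hγ0 : γ 0 = 1)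
    (hfix : ∀ᶠ s in nhds (0 : ℝ), σ (γ s) = γ s) : ∀ᶠ s in nhds (0 : ℝ), γ s ∈ K := by
  obtain ⟨ε, hε, hball⟩ := Metric.eventually_nhds_iff_ball.mp (hγ.and hfix)
  have hconn : IsPreconnected (γ '' Metric.ball 0 ε) :=
    (convex_ball (0 : ℝ) ε).isPreconnected.image γ fun s hs => (hball s hs).1.continuousWithinAt
  have hsub : γ '' Metric.ball 0 ε ⊆ connectedComponentIn {g : G | σ g = g} 1 := by
    refine hconn.subset_connectedComponentIn ⟨0, Metric.mem_ball_self hε, hγ0⟩ ?_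
    rintro _ ⟨s, hs, rfl⟩
    exact (hball s hs).2
  filter_upwards [Metric.ball_mem_nhds (0 : ℝ) hε] with s hs
  exact hcomp (hsub ⟨s, hs, rfl⟩)

variable [ChartedSpace E (G ⧸ K)]

lemma contMDiff_cosetMap (hM : IsComplexSymmetricCoset V E K)
    (hσ : ContMDiff 𝓘(ℝ, V) 𝓘(ℝ, V) ∞ σ) :
    ContMDiff 𝓘(ℝ, E) 𝓘(ℝ, E) ∞ (cosetMap σ hσK) :=
  contMDiff_of_comp_submersion hM.submersion QuotientGroup.mk_surjective
    (hM.submersion.contMDiff.comp hσ)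

lemma isHolomorphicIsometryAt_smul (hM : IsComplexSymmetricCoset V E K)
    {F : (x : G ⧸ K) → TangentSpace 𝓘(ℂ, E) x → ℝ} (hF : IsInvariantMetric 𝓘(ℂ, E) G F) (g : G)
    (x : G ⧸ K) : IsHolomorphicIsometryAt F (fun y => g • y) x :=
  ⟨hM.holomorphic g x, hF g x⟩

variable [LieGroup 𝓘(ℝ, V) ∞ G]

lemma contMDiff_smul_coset (hM : IsComplexSymmetricCoset V E K) (g : G) :
    ContMDiff 𝓘(ℝ, E) 𝓘(ℝ, E) ∞ (fun x : G ⧸ K => g • x) :=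
  contMDiff_of_comp_submersion hM.submersion QuotientGroup.mk_surjective
    (hM.submersion.contMDiff.comp (contMDiff_mul_left (a := g)))

variable [CompleteSpace V] [IsManifold 𝓘(ℂ, E) ω (G ⧸ K)]

/-- The differential of the symmetry at the base point is `-1`. -/
lemma hasMFDerivAt_cosetMap (hM : IsComplexSymmetricCoset V E K)
    (hσ : ContMDiff 𝓘(ℝ, V) 𝓘(ℝ, V) ∞ σ) (hσσ : ∀ g, σ (σ g) = g)
    (hcomp : connectedComponentIn {g : G | σ g = g} 1 ⊆ K) :
    HasMFDerivAt 𝓘(ℂ, E) 𝓘(ℂ, E) (cosetMap σ hσK) ((1 : G) : G ⧸ K)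
      (-ContinuousLinearMap.id ℂ E : E →L[ℂ] E) := by
  have : IsManifold 𝓘(ℝ, E) ∞ (G ⧸ K) := isManifold_real
  have : IsManifold 𝓘(ℝ, V) ∞ G := inferInstance
  set o : G ⧸ K := ((1 : G) : G ⧸ K) with ho
  set s := cosetMap σ hσK with hs
  have hso : s o = o := cosetMap_one hσK
  have hsc : ContMDiff 𝓘(ℝ, E) 𝓘(ℝ, E) ∞ s := contMDiff_cosetMap hσK hM hσ
  set π : G → G ⧸ K := fun g => (g : G ⧸ K) with hπdef
  have hπ : ContMDiff 𝓘(ℝ, V) 𝓘(ℝ, E) ∞ π := hM.submersion.contMDiff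
  set c := chartAt V (1 : G) with hc
  set ψ := chartAt E o with hψ
  have h1c : (1 : G) ∈ c.source := mem_chart_source V 1
  have hoψ : o ∈ ψ.source := mem_chart_source E o
  have hyt : c 1 ∈ c.target := c.map_source h1c
  have hc1 : c.symm (c 1) = 1 := c.left_inv h1c
  have hψo : ψ.symm (ψ o) = o := ψ.left_inv hoψ
  have hcs : ContinuousAt c.symm (c 1) := c.continuousAt_symm hyt
  have hσ1 : ContDiffAt ℝ ∞ (fun w => c (σ (c.symm w))) (c 1) :=
    contDiffAt_chartExpression (chart_mem_atlas V 1) (chart_mem_atlas V 1) hyt hσ.contMDiffAt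
      (by rw [hc1, map_one]; exact h1c)
  have hπ1 : ContDiffAt ℝ ∞ (fun w => ψ (π (c.symm w))) (c 1) :=
    contDiffAt_chartExpression (chart_mem_atlas V 1) (chart_mem_atlas E o) hyt hπ.contMDiffAt
      (by rw [hc1]; exact hoψ)
  have hτ1 : ContDiffAt ℝ ∞ (fun w => ψ (s (ψ.symm w))) (ψ o) :=
    contDiffAt_chartExpression (chart_mem_atlas E o) (chart_mem_atlas E o) (ψ.map_source hoψ)
      hsc.contMDiffAt (by rw [hψo, hso]; exact hoψ)
  have hπy : ψ (π (c.symm (c 1))) = ψ o := by rw [hc1]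
  have hnear : ∀ᶠ y in nhds (c 1), y ∈ c.target := c.open_target.mem_nhds hyt
  have hσnear : ∀ᶠ y in nhds (c 1), σ (c.symm y) ∈ c.source := by
    have : ContinuousAt (fun y => σ (c.symm y)) (c 1) :=
      hσ.continuous.continuousAt.comp hcs
    exact this.eventually_mem (by simpa only [hc1, map_one] using c.open_source.mem_nhds h1c)
  have hπnear : ∀ᶠ y in nhds (c 1), π (c.symm y) ∈ ψ.source := by
    have : ContinuousAt (fun y => π (c.symm y)) (c 1) :=
      hπ.continuous.continuousAt.comp hcs
    exact this.eventually_mem (by rw [hc1]; exact ψ.open_source.mem_nhds hoψ)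
  -- In charts a local section is a right inverse of the projection, and so is its differential.
  have hsurj : Function.Surjective (fderiv ℝ (fun w => ψ (π (c.symm w))) (c 1)) := by
    obtain ⟨ξ, hξ, hξ1, hπξ⟩ := exists_localSection hM.submersion (1 : G)
    have hξd : ContDiffAt ℝ ∞ (fun w => c (ξ (ψ.symm w))) (ψ o) :=
      contDiffAt_chartExpression (chart_mem_atlas E o) (chart_mem_atlas V 1) (ψ.map_source hoψ)
        (by rw [hψo]; exact hξ) (by rw [hψo, hξ1]; exact h1c)
    have hξ0 : c (ξ (ψ.symm (ψ o))) = c 1 := by rw [hψo, hξ1]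
    have h1 : HasFDerivAt (fun w => ψ (π (c.symm w)))
        (fderiv ℝ (fun w => ψ (π (c.symm w))) (c 1)) (c (ξ (ψ.symm (ψ o)))) := by
      rw [hξ0]
      exact (hπ1.differentiableAt (by simp)).hasFDerivAt
    have h2 := h1.comp (ψ o) (hξd.differentiableAt (by simp)).hasFDerivAt
    have hψc : ContinuousAt ψ.symm (ψ o) := ψ.continuousAt_symm (ψ.map_source hoψ)
    have h3 : (fun w => ψ (π (c.symm (c (ξ (ψ.symm w)))))) =ᶠ[nhds (ψ o)] id := by
      have ht : Filter.Tendsto ψ.symm (nhds (ψ o)) (nhds o) := by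
        have := hψc.tendsto
        rwa [hψo] at this
      have hξc : ∀ᶠ x in nhds o, ξ x ∈ c.source :=
        hξ.continuousAt.eventually_mem (by rw [hξ1]; exact c.open_source.mem_nhds h1c)
      filter_upwards [ht.eventually hπξ, ht.eventually hξc,
        ψ.open_target.mem_nhds (ψ.map_source hoψ)] with w h4 h5 h6
      rw [c.left_inv h5]
      exact (congrArg ψ h4).trans (ψ.right_inv h6)
    have h4 := h2.unique ((hasFDerivAt_id (𝕜 := ℝ) (ψ o)).congr_of_eventuallyEq h3)
    exact fun w => ⟨_, congrArg (fun L : E →L[ℝ] E => L w) h4⟩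
  have key : ∀ w, fderiv ℝ (fun w => ψ (s (ψ.symm w))) (ψ o) w = -w := by
    refine fderiv_induced_eq_neg (σ := fun w => c (σ (c.symm w))) (y₀ := c 1)
      (π := fun w => ψ (π (c.symm w))) (hσ1.hasStrictFDerivAt (by simp)) ?_ ?_
      (hπ1.differentiableAt (by simp)).hasFDerivAt hsurj ?_ (τ := fun w => ψ (s (ψ.symm w))) ?_ ?_
    · simp only [hc1, map_one]
    · filter_upwards [hnear, hσnear] with y h1 h2
      rw [c.left_inv h2, hσσ, c.right_inv h1]
    · intro γ hγ hγ0 hfix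
      have ht : Filter.Tendsto γ (nhds 0) (nhds (c 1)) := by
        have := hγ.self_of_nhds.tendsto
        rwa [hγ0] at this
      -- Transported back to the group, the curve consists of fixed points of `σ` and starts at `1`,
      -- so it stays in `K` and projects to the base point.
      have h1 : ∀ᶠ r in nhds (0 : ℝ), c.symm (γ r) ∈ K := by
        refine eventually_mem_of_fixed_curve hcomp (γ := fun r => c.symm (γ r)) ?_ ?_ ?_
        · filter_upwards [hγ, ht.eventually hnear] with r h1 h2
          exact (c.continuousAt_symm h2).comp h1
        · simp only [hγ0, hc1]
        · filter_upwards [hfix, ht.eventually hσnear] with r h1 h2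
          rw [← c.left_inv h2]
          exact congrArg c.symm h1
      filter_upwards [h1] with r hr
      have : π (c.symm (γ r)) = o := by
        rw [ho, hπdef]
        refine (QuotientGroup.eq).mpr ?_
        simpa using hr
      change ψ (π (c.symm (γ r))) = ψ (π (c.symm (c 1)))
      rw [this, hc1]
    · simp only [hπy]
      exact (hτ1.differentiableAt (by simp)).hasFDerivAt
    · filter_upwards [hσnear, hπnear] with y h1 h2
      rw [ψ.left_inv h2, c.left_inv h1]
      rfl
  -- So far the symmetry is only known to be smooth over the reals. Its real derivative `-1` is
  -- complex linear, so it is complex differentiable at the base point.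
  have hder : HasFDerivAt (fun w => ψ (s (ψ.symm w))) (-ContinuousLinearMap.id ℂ E) (ψ o) := by
    refine hasFDerivAt_of_restrictScalars ℝ (hτ1.differentiableAt (by simp)).hasFDerivAt ?_
    ext w
    simp [key]
  refine ⟨hsc.continuous.continuousAt, ?_⟩
  have hwr : writtenInExtChartAt 𝓘(ℂ, E) 𝓘(ℂ, E) o s = fun w => ψ (s (ψ.symm w)) := by
    simp only [writtenInExtChartAt, hso, mfld_simps, extChartAt]
    rfl
  rw [hwr]
  exact hder.hasFDerivWithinAt

/-- Every point of a Hermitian symmetric coset space has a symmetry. -/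
lemma exists_isPointSymmetry (hM : IsComplexSymmetricCoset V E K)
    {F : (x : G ⧸ K) → TangentSpace 𝓘(ℂ, E) x → ℝ} (hF : IsInvariantMetric 𝓘(ℂ, E) G F)
    (hneg : ∀ (x : G ⧸ K) (v : TangentSpace 𝓘(ℂ, E) x), F x (-v) = F x v) (p : G ⧸ K) :
    ∃ s, IsPointSymmetry F p s := by
  obtain ⟨σ, hσ, hσσ, hcomp, hσK⟩ := hM.symmetric
  have hder := hasMFDerivAt_cosetMap hσK hM hσ hσσ hcomp
  set o : G ⧸ K := ((1 : G) : G ⧸ K) with ho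
  set s₀ := cosetMap σ hσK with hs₀
  have hso : s₀ o = o := cosetMap_one hσK
  have hiso_o : IsHolomorphicIsometryAt F s₀ o := by
    refine ⟨hder.mdifferentiableAt, fun v => ?_⟩
    rw [hder.mfderiv]
    -- The tangent space depends on the point, so the equation `s₀ o = o` is used by generalising
    -- over the point and substituting.
    have : ∀ y, y = o → ∀ w : E, F y (-w : E) = F o w := by
      rintro _ rfl w
      exact hneg o w
    exact this _ hso v
  have hiso₀ : ∀ x, IsHolomorphicIsometryAt F s₀ x := by
    intro x
    obtain ⟨h, rfl⟩ := QuotientGroup.mk_surjective x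
    have hx : h⁻¹ • (h : G ⧸ K) = o := by
      rw [ho, MulAction.Quotient.smul_coe, smul_eq_mul, inv_mul_cancel]
    -- Equivariance moves the point `h K` to the base point and back, so holomorphy and isometry
    -- need to be known only there.
    have hcongr : s₀ = (fun y => σ h • y) ∘ s₀ ∘ (fun y => h⁻¹ • y) := by
      funext y
      simp only [Function.comp_apply, hs₀, ← cosetMap_smul, smul_inv_smul]
    rw [hcongr]
    refine (isHolomorphicIsometryAt_smul hM hF _ _).comp
      (IsHolomorphicIsometryAt.comp ?_ (isHolomorphicIsometryAt_smul hM hF _ _))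
    simp only [hx]
    exact hiso_o
  obtain ⟨g, rfl⟩ := QuotientGroup.mk_surjective p
  have hg : g⁻¹ • (g : G ⧸ K) = o := by
    rw [ho, MulAction.Quotient.smul_coe, smul_eq_mul, inv_mul_cancel]
  have hgo : g • o = (g : G ⧸ K) := by rw [← hg, smul_inv_smul]
  refine ⟨(fun y => g • y) ∘ s₀ ∘ (fun y => g⁻¹ • y), ⟨?_, ?_, ?_, ?_, ?_⟩⟩
  · intro x
    simp only [Function.comp_apply, inv_smul_smul]
    exact (congrArg (g • ·) (cosetMap_involutive hσK hσσ _)).trans (smul_inv_smul g x)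
  · intro x
    exact (isHolomorphicIsometryAt_smul hM hF _ _).comp
      ((hiso₀ _).comp (isHolomorphicIsometryAt_smul hM hF _ _))
  · exact (contMDiff_smul_coset hM g).comp
      ((contMDiff_cosetMap hσK hM hσ).comp (contMDiff_smul_coset hM g⁻¹))
  · simp only [Function.comp_apply, hg, hso, hgo]
  · have h1 := (hM.holomorphic g⁻¹ (g : G ⧸ K)).hasMFDerivAt
    set D1 : E →L[ℂ] E := mfderiv 𝓘(ℂ, E) 𝓘(ℂ, E) (fun y : G ⧸ K => g⁻¹ • y) (g : G ⧸ K)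
    have h2 := (hM.holomorphic g o).hasMFDerivAt
    set D2 : E →L[ℂ] E := mfderiv 𝓘(ℂ, E) 𝓘(ℂ, E) (fun y : G ⧸ K => g • y) o
    have h2' : ∀ y, y = o → HasMFDerivAt 𝓘(ℂ, E) 𝓘(ℂ, E) (fun y : G ⧸ K => g • y) y D2 := by
      rintro _ rfl
      exact h2
    have h3' : ∀ y, y = o → HasMFDerivAt 𝓘(ℂ, E) 𝓘(ℂ, E) s₀ y
        (-ContinuousLinearMap.id ℂ E : E →L[ℂ] E) := by
      rintro _ rfl
      exact hder
    have h4 : HasMFDerivAt 𝓘(ℂ, E) 𝓘(ℂ, E) ((fun y => g • y) ∘ s₀ ∘ (fun y => g⁻¹ • y))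
        (g : G ⧸ K) (D2.comp ((-ContinuousLinearMap.id ℂ E).comp D1)) :=
      (h2' _ (by simp only [Function.comp_apply, hg, hso])).comp _ ((h3' _ hg).comp _ h1)
    have h5 : HasMFDerivAt 𝓘(ℂ, E) 𝓘(ℂ, E) ((fun y => g • y) ∘ (fun y => g⁻¹ • y))
        (g : G ⧸ K) (D2.comp D1) := (h2' _ hg).comp _ h1
    have h6 : D2.comp D1 = ContinuousLinearMap.id ℂ E := by
      have h7 : ((fun y : G ⧸ K => g • y) ∘ (fun y => g⁻¹ • y)) = id := by
        funext y
        simp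
      rw [h7] at h5
      exact hasMFDerivAt_unique h5 (hasMFDerivAt_id (g : G ⧸ K))
    -- The scalar `-1` commutes with the differentials of the translations, which are inverse to
    -- each other by the chain rule.
    have h8 : D2.comp ((-ContinuousLinearMap.id ℂ E).comp D1) = -ContinuousLinearMap.id ℂ E := by
      ext w
      simpa using congrArg (fun L : E →L[ℂ] E => -L w) h6
    have h9 : ∀ L : E →L[ℂ] E, L = -ContinuousLinearMap.id ℂ E →
        HasMFDerivAt 𝓘(ℂ, E) 𝓘(ℂ, E) ((fun y => g • y) ∘ s₀ ∘ (fun y => g⁻¹ • y)) (g : G ⧸ K) L →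
        HasMFDerivAt 𝓘(ℂ, E) 𝓘(ℂ, E) ((fun y => g • y) ∘ s₀ ∘ (fun y => g⁻¹ • y)) (g : G ⧸ K)
          (-ContinuousLinearMap.id ℂ E : E →L[ℂ] E) := by
      rintro _ rfl h
      exact h
    exact h9 _ h8 h4

end Coset

/-! ### The Kähler property of metrics with point symmetries. -/

section ConnectionOfSymmetries

variable {E : Type*} [NormedAddCommGroup E] [NormedSpace ℂ E]
  {M : Type*} [TopologicalSpace M] [ChartedSpace E M] [IsManifold 𝓘(ℂ, E) ω M]
  {e : OpenPartialHomeomorph M E}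

lemma inChart_mfderiv_chart (he : e ∈ atlas E M) (F : (x : M) → TangentSpace 𝓘(ℂ, E) x → ℝ)
    {y : M} (hy : y ∈ e.source) (u : TangentSpace 𝓘(ℂ, E) y) :
    inChart 𝓘(ℂ, E) F e (e y) (mfderiv 𝓘(ℂ, E) 𝓘(ℂ, E) e y u) = F y u := by
  have h : ∀ y', y' = y → ∀ w : E, w = u → F y' w = F y u := by
    rintro _ rfl _ rfl
    rfl
  exact h _ (e.left_inv hy) _ (mfderiv_symm_comp_chart he hy u)

/-- Point symmetries of a Hermitian metric give it a symmetric Chern connection in every chart;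
that is, the metric is Kähler. -/
lemma exists_connection_inChart [FiniteDimensional ℂ E] (Q : HermitianMetric 𝓘(ℂ, E) M)
    (hsym : ∀ p, ∃ s, IsPointSymmetry Q.quad p s) (he : e ∈ atlas E M) :
    ∃ A : E → E →ₗ[ℂ] E →ₗ[ℂ] E, IsConnectionOn e.target (inChart 𝓘(ℂ, E) Q.quad e) A ∧
      ∀ z ∈ e.target, ∀ X Y, A z X Y = A z Y X := by
  have : IsManifold 𝓘(ℝ, E) ∞ M := isManifold_real
  have hpt : ∀ z₀ ∈ e.target, ∃ A : E →ₗ[ℂ] E →ₗ[ℂ] E, (∀ X Y, A X Y = A Y X) ∧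
      ∀ v X, wirt (fun ζ => ((inChart 𝓘(ℂ, E) Q.quad e ζ v : ℝ) : ℂ)) z₀ X =
        wirt (fun w => ((inChart 𝓘(ℂ, E) Q.quad e z₀ w : ℝ) : ℂ)) v (A X v) := by
    intro z₀ hz₀
    obtain ⟨s, hs⟩ := hsym (e.symm z₀)
    have hp : e.symm z₀ ∈ e.source := e.map_target hz₀
    have hsmem : ∀ᶠ z in nhds z₀, z ∈ e.target ∧ s (e.symm z) ∈ e.source := by
      have h1 : ContinuousAt (fun z => s (e.symm z)) z₀ :=
        hs.smooth.continuous.continuousAt.comp (e.continuousAt_symm hz₀)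
      have h0 : ∀ᶠ z in nhds z₀, z ∈ e.target := e.open_target.mem_nhds hz₀
      exact h0.and (h1.eventually_mem (by rw [hs.fixed]; exact e.open_source.mem_nhds hp))
    have hder : ∀ z, z ∈ e.target → s (e.symm z) ∈ e.source →
        ∃ D : E →L[ℂ] E, HasFDerivAt (fun w => e (s (e.symm w))) D z ∧ ∀ v : E, D v =
          mfderiv 𝓘(ℂ, E) 𝓘(ℂ, E) e (s (e.symm z)) (mfderiv 𝓘(ℂ, E) 𝓘(ℂ, E) s (e.symm z)
            (mfderiv 𝓘(ℂ, E) 𝓘(ℂ, E) e.symm z v)) := by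
      intro z hz hsz
      have h1 := ((chart_mdifferentiable he).mdifferentiableAt_symm hz).hasMFDerivAt
      have h2 := (hs.isometry (e.symm z)).1.hasMFDerivAt
      have h3 := ((chart_mdifferentiable he).mdifferentiableAt hsz).hasMFDerivAt
      exact ⟨_, (h3.comp z (h2.comp z h1)).hasFDerivAt, fun v => rfl⟩
    refine exists_connection_of_symmetry e.open_target (isLocalHermitian_inChart Q he) hz₀
      (φ := fun w => e (s (e.symm w))) ?_ ?_ ?_ ?_ ?_
    · refine (contDiffAt_chartExpression he he hz₀ hs.smooth.contMDiffAt ?_).of_le two_le_infty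
      rw [hs.fixed]
      exact hp
    · filter_upwards [hsmem] with z hz
      obtain ⟨D, hD, -⟩ := hder z hz.1 hz.2
      exact hD.differentiableAt
    · simp only [hs.fixed, e.right_inv hz₀]
    · intro v
      obtain ⟨D, hD, hDv⟩ := hder z₀ hz₀ (by rw [hs.fixed]; exact hp)
      rw [hD.fderiv, hDv, hs.deriv.mfderiv]
      have h1 : ∀ y, y = e.symm z₀ → ∀ w : E, (mfderiv 𝓘(ℂ, E) 𝓘(ℂ, E) e y : E →L[ℂ] E)
          (-(mfderiv 𝓘(ℂ, E) 𝓘(ℂ, E) e.symm z₀ : E →L[ℂ] E) w) = -w := by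
        rintro _ rfl w
        rw [map_neg]
        exact congrArg Neg.neg (mfderiv_chart_comp_symm he hz₀ w)
      exact h1 _ hs.fixed v
    · filter_upwards [hsmem] with z hz v
      obtain ⟨D, hD, hDv⟩ := hder z hz.1 hz.2
      rw [hD.fderiv, hDv]
      refine (inChart_mfderiv_chart he Q.quad hz.2 _).trans ?_
      exact (hs.isometry (e.symm z)).2 _
  -- A pointwise choice is enough: the connection equation imposes no regularity of `A` in the base
  -- point.
  choose! A hA using hpt
  exact ⟨A, fun z hz v _ X => (hA z hz).2 v X, fun z hz => (hA z hz).1⟩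

end ConnectionOfSymmetries

/-! ### Product manifolds: projections, product maps and product charts. -/

section ProductManifold

variable {n : ℕ} {E : Fin n → Type*} [∀ l, NormedAddCommGroup (E l)] [∀ l, NormedSpace ℂ (E l)]
  {M : Fin n → Type*} [∀ l, TopologicalSpace (M l)] [∀ l, ChartedSpace (E l) (M l)]

/-- The derivative of a projection from a product manifold. -/
lemma hasMFDerivAt_proj (x : ∀ l, M l) (l : Fin n) :
    HasMFDerivAt (prodModel E) 𝓘(ℂ, E l) (fun y : ∀ l, M l => y l) x
      (ContinuousLinearMap.proj l : (∀ l, E l) →L[ℂ] E l) := by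
  refine ⟨(continuous_apply l).continuousAt, ?_⟩
  have h : HasFDerivWithinAt (fun z : ∀ l, E l => z l)
      (ContinuousLinearMap.proj l : (∀ l, E l) →L[ℂ] E l) (Set.range (prodModel E))
      (extChartAt (prodModel E) x x) :=
    (ContinuousLinearMap.proj (R := ℂ) (φ := E) l).hasFDerivAt.hasFDerivWithinAt
  have hw : ∀ z : ∀ l, E l, (∀ j, z j ∈ (chartAt (E j) (x j)).target) →
      writtenInExtChartAt (prodModel E) 𝓘(ℂ, E l) x (fun y : ∀ l, M l => y l) z = z l := by
    intro z hz
    exact (chartAt (E l) (x l)).right_inv (hz l)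
  refine h.congr_of_eventuallyEq ?_ ?_
  · have hopen : IsOpen {z : ∀ l, E l | ∀ j, z j ∈ (chartAt (E j) (x j)).target} := by
      have := isOpen_set_pi (Set.finite_univ (α := Fin n))
        fun j (_ : j ∈ Set.univ) => (chartAt (E j) (x j)).open_target
      simpa [Set.pi] using this
    refine Filter.eventually_of_mem (mem_nhdsWithin_of_mem_nhds (hopen.mem_nhds ?_)) hw
    exact fun j => (chartAt (E j) (x j)).map_source (mem_chart_source (E j) (x j))
  · exact hw _ fun j => (chartAt (E j) (x j)).map_source (mem_chart_source (E j) (x j))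

lemma mfderiv_proj_apply (x : ∀ l, M l) (l : Fin n) (v : ∀ l, E l) :
    mfderiv (prodModel E) 𝓘(ℂ, E l) (fun y : ∀ l, M l => y l) x v = v l := by
  rw [(hasMFDerivAt_proj x l).mfderiv]
  rfl

end ProductManifold

section ProductMaps

variable {n : ℕ} {E : Fin n → Type*} [∀ l, NormedAddCommGroup (E l)] [∀ l, NormedSpace ℂ (E l)]
  {M : Fin n → Type*} [∀ l, TopologicalSpace (M l)] [∀ l, ChartedSpace (E l) (M l)]

/-- Maps into a product manifold are differentiated componentwise. -/
lemma hasMFDerivAt_pi {E' : Type*} [NormedAddCommGroup E'] [NormedSpace ℂ E'] {H' : Type*}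
    [TopologicalSpace H'] {J : ModelWithCorners ℂ E' H'} {N : Type*} [TopologicalSpace N]
    [ChartedSpace H' N] {f : N → ∀ l, M l} {x : N} {D : ∀ l, E' →L[ℂ] E l}
    (h : ∀ l, HasMFDerivAt J 𝓘(ℂ, E l) (fun y => f y l) x (D l)) :
    HasMFDerivAt J (prodModel E) f x (ContinuousLinearMap.pi D : E' →L[ℂ] ∀ l, E l) := by
  refine ⟨continuousAt_pi.mpr fun l => (h l).continuousAt, ?_⟩
  have h1 : HasFDerivWithinAt (fun z l => writtenInExtChartAt J 𝓘(ℂ, E l) x (fun y => f y l) z)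
      (ContinuousLinearMap.pi D) (Set.range J) (extChartAt J x x) :=
    hasFDerivWithinAt_pi.mpr fun l => (h l).2
  exact h1

/-- Derivative of a product map. -/
lemma hasMFDerivAt_piMap {f : ∀ l, M l → M l} {x : ∀ l, M l}
    {D : ∀ l, E l →L[ℂ] E l}
    (h : ∀ l, HasMFDerivAt 𝓘(ℂ, E l) 𝓘(ℂ, E l) (f l) (x l) (D l)) :
    HasMFDerivAt (prodModel E) (prodModel E) (fun (y : ∀ l, M l) l => f l (y l)) x
      (ContinuousLinearMap.pi fun l => (D l).comp (ContinuousLinearMap.proj l) :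
        (∀ l, E l) →L[ℂ] ∀ l, E l) :=
  hasMFDerivAt_pi fun l => (h l).comp x (hasMFDerivAt_proj x l)

/-- Isometry in each factor implies isometry in the product. -/
lemma prodFinsler_piMap (Q : ∀ l, (x : M l) → TangentSpace 𝓘(ℂ, E l) x → ℝ) (t : ℝ) (k : ℕ)
    {f : ∀ l, M l → M l} {x : ∀ l, M l} (h : ∀ l, IsHolomorphicIsometryAt (Q l) (f l) (x l))
    (v : TangentSpace (prodModel E) x) :
    prodFinsler Q t k (fun l => f l (x l))
      (mfderiv (prodModel E) (prodModel E) (fun (y : ∀ l, M l) l => f l (y l)) x v) =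
      prodFinsler Q t k x v := by
  have h1 := hasMFDerivAt_piMap fun l => (h l).1.hasMFDerivAt
  have h2 : ∀ l, Q l (f l (x l)) (mfderiv (prodModel E) 𝓘(ℂ, E l) (fun y : ∀ l, M l => y l)
      (fun l => f l (x l)) (mfderiv (prodModel E) (prodModel E)
        (fun (y : ∀ l, M l) l => f l (y l)) x v)) =
      Q l (x l) (mfderiv (prodModel E) 𝓘(ℂ, E l) (fun y : ∀ l, M l => y l) x v) := by
    intro l
    rw [h1.mfderiv, (hasMFDerivAt_proj x l).mfderiv, (hasMFDerivAt_proj _ l).mfderiv]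
    exact (h l).2 _
  simp only [prodFinsler, h2]

lemma prodFinsler_eq (Q : ∀ l, (x : M l) → TangentSpace 𝓘(ℂ, E l) x → ℝ) {t : ℝ} (ht : 0 ≤ t)
    (k : ℕ) (x : ∀ l, M l) (v : ∀ l, E l) :
    prodFinsler Q t k x v = Real.sqrt (mixFun t k fun l => Q l (x l) (v l)) := by
  have h : ∀ l, Q l (x l) (mfderiv (prodModel E) 𝓘(ℂ, E l) (fun y : ∀ l, M l => y l) x v) =
      Q l (x l) (v l) := fun l => congrArg (Q l (x l)) (mfderiv_proj_apply x l v)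
  simp only [prodFinsler, h]
  rw [mixFun, Real.sqrt_mul (by positivity), Real.sqrt_inv, one_div]

/-- In the preferred chart at `x`, the derivative at `x` of this chart is the identity. -/
lemma hasMFDerivAt_extChartAt_self {E' : Type*} [NormedAddCommGroup E'] [NormedSpace ℂ E']
    {H' : Type*} [TopologicalSpace H'] (J : ModelWithCorners ℂ E' H') {N : Type*}
    [TopologicalSpace N] [ChartedSpace H' N] (x : N) :
    HasMFDerivAt J 𝓘(ℂ, E') (extChartAt J x) x (ContinuousLinearMap.id ℂ E' : E' →L[ℂ] E') := by
  refine ⟨continuousAt_extChartAt x, ?_⟩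
  have h : HasFDerivWithinAt (fun z : E' => z) (ContinuousLinearMap.id ℂ E') (Set.range J)
      (extChartAt J x x) := hasFDerivWithinAt_id _ _
  have hw : ∀ z ∈ (extChartAt J x).target,
      writtenInExtChartAt J 𝓘(ℂ, E') x (extChartAt J x) z = z := fun z hz =>
    (extChartAt J x).right_inv hz
  exact h.congr_of_eventuallyEq
    (Filter.eventually_of_mem (extChartAt_target_mem_nhdsWithin x) hw)
    (hw _ (mem_extChartAt_target x))

variable {e : ∀ l, OpenPartialHomeomorph (M l) (E l)}

omit [∀ l, ChartedSpace (E l) (M l)] in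
lemma pi_extend_target : ((OpenPartialHomeomorph.pi e).extend (prodModel E)).target =
    Set.univ.pi fun l => (e l).target := by
  ext z
  rw [OpenPartialHomeomorph.extend_target]
  constructor
  · exact fun h => h.1
  · exact fun h => ⟨h, ⟨z, rfl⟩⟩

variable [∀ l, IsManifold 𝓘(ℂ, E l) ω (M l)]

lemma hasMFDerivAt_pi_extend_symm (he : ∀ l, e l ∈ atlas (E l) (M l)) {z : ∀ l, E l}
    (hz : z ∈ Set.univ.pi fun l => (e l).target) :
    HasMFDerivAt 𝓘(ℂ, ∀ l, E l) (prodModel E)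
      ((OpenPartialHomeomorph.pi e).extend (prodModel E)).symm z
      (ContinuousLinearMap.pi fun l => (mfderiv 𝓘(ℂ, E l) 𝓘(ℂ, E l) (e l).symm (z l) :
        E l →L[ℂ] E l).comp (ContinuousLinearMap.proj l) : (∀ l, E l) →L[ℂ] ∀ l, E l) := by
  refine hasMFDerivAt_pi fun l => ?_
  have h1 := ((chart_mdifferentiable (he l)).mdifferentiableAt_symm (hz l trivial)).hasMFDerivAt
  have h2 : HasMFDerivAt 𝓘(ℂ, ∀ l, E l) 𝓘(ℂ, E l) (fun y : ∀ l, E l => y l) z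
      (ContinuousLinearMap.proj l : (∀ l, E l) →L[ℂ] E l) :=
    (ContinuousLinearMap.proj (R := ℂ) (φ := E) l).hasFDerivAt.hasMFDerivAt
  exact h1.comp z h2

/-- The product metric in a product chart. -/
lemma inChart_prodFinsler (Q : ∀ l, (x : M l) → TangentSpace 𝓘(ℂ, E l) x → ℝ) {t : ℝ}
    (ht : 0 ≤ t) (k : ℕ) (he : ∀ l, e l ∈ atlas (E l) (M l)) {z : ∀ l, E l}
    (hz : z ∈ Set.univ.pi fun l => (e l).target) (v : ∀ l, E l) :
    inChart (prodModel E) (prodFinsler Q t k) (OpenPartialHomeomorph.pi e) z v =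
      Real.sqrt (mixSq (fun l => inChart 𝓘(ℂ, E l) (Q l) (e l)) t k z v) := by
  rw [inChart, (hasMFDerivAt_pi_extend_symm he hz).mfderiv]
  exact prodFinsler_eq Q ht k _ _

end ProductMaps

/-! ### Replacing a metric by one that agrees with it over an open set, and the curvature in the
preferred chart. -/

section Congruence

variable {E : Type*} [NormedAddCommGroup E] [NormedSpace ℂ E] {U : Set E} {g g' : E → E → ℝ}
  {A : E → E →ₗ[ℂ] E →ₗ[ℂ] E}

lemma FiberConvexAt.congr {z v : E} (hc : FiberConvexAt g' z v) (h : g z = g' z) :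
    FiberConvexAt g z v := by
  simp only [FiberConvexAt, h]
  exact hc

/-- The chart expression of the product metric agrees with `mixSq` only over the chart target;
openness of `U` makes this enough for derivatives along the base. -/
lemma IsConnectionOn.congr (hA : IsConnectionOn U g' A) (hU : IsOpen U)
    (h : ∀ z ∈ U, g z = g' z) : IsConnectionOn U g A := by
  intro z hz v hv X
  have h1 : (fun ζ => (g ζ v : ℂ)) =ᶠ[nhds z] fun ζ => (g' ζ v : ℂ) := by
    filter_upwards [hU.mem_nhds hz] with ζ hζ
    rw [h ζ hζ]
  rw [wirt_congr h1, h z hz]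
  exact hA z hz v hv X

lemma curvatureSum_congr {ι : Type*} [Fintype ι] (b : Module.Basis ι ℂ E) {z : E}
    (h : g z = g' z) (v : E) : curvatureSum b g A z v = curvatureSum b g' A z v := by
  simp only [curvatureSum, fiberDeriv, h]

end Congruence

section Curvature

/-- In the preferred chart, the holomorphic sectional curvature at `(x, v)` is the local one. -/
lemma holSecCurv_eq_local {E : Type*} [NormedAddCommGroup E] [NormedSpace ℂ E]
    {H : Type*} [TopologicalSpace H] (J : ModelWithCorners ℂ E H) {N : Type*}
    [TopologicalSpace N] [ChartedSpace H N] {ι : Type*} [Fintype ι] [DecidableEq ι]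
    (b : Module.Basis ι ℂ E) (F : (x : N) → TangentSpace J x → ℝ) (x : N) (v : E) :
    holSecCurv J b F x v = localHolSecCurv b (inChart J F (chartAt H x)) (extChartAt J x x) v := by
  unfold holSecCurv
  rw [(hasMFDerivAt_extChartAt_self J x).mfderiv]
  rfl

end Curvature

/-! ### Global properties of the product metric. -/

section ProductMetric

variable {n : ℕ} {E : Fin n → Type*} [∀ l, NormedAddCommGroup (E l)] [∀ l, NormedSpace ℂ (E l)]
  {M : Fin n → Type*} [∀ l, TopologicalSpace (M l)] [∀ l, ChartedSpace (E l) (M l)]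
  {ι : Fin n → Type*} [∀ l, Fintype (ι l)] [∀ l, DecidableEq (ι l)]
  (b : ∀ l, Module.Basis (ι l) ℂ (E l))
  (Q : ∀ l, HermitianMetric 𝓘(ℂ, E l) (M l)) {t : ℝ} {k : ℕ}

omit [∀ l, NormedSpace ℂ (E l)] in
lemma exists_of_mem_pi_atlas {e : OpenPartialHomeomorph (∀ l, M l) (ModelPi E)}
    (he : e ∈ atlas (ModelPi E) (∀ l, M l)) :
    ∃ e' : ∀ l, OpenPartialHomeomorph (M l) (E l), (∀ l, e' l ∈ atlas (E l) (M l)) ∧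
      e = OpenPartialHomeomorph.pi e' := by
  obtain ⟨e', he', rfl⟩ := he
  exact ⟨e', fun l => he' l trivial, rfl⟩

lemma HermitianMetric.quad_nonneg {E : Type*} [NormedAddCommGroup E] [NormedSpace ℂ E]
    {M : Type*} [TopologicalSpace M] [ChartedSpace E M] (Q : HermitianMetric 𝓘(ℂ, E) M) (x : M)
    (v : TangentSpace 𝓘(ℂ, E) x) : 0 ≤ Q.quad x v := by
  by_cases hv : v = 0
  · rw [hv, HermitianMetric.quad, map_zero, Complex.zero_re]
  · exact (Q.pos x v hv).le

lemma HermitianMetric.quad_smul {E : Type*} [NormedAddCommGroup E] [NormedSpace ℂ E]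
    {M : Type*} [TopologicalSpace M] [ChartedSpace E M] (Q : HermitianMetric 𝓘(ℂ, E) M) (x : M)
    (c : ℂ) (v : TangentSpace 𝓘(ℂ, E) x) : Q.quad x (c • v) = ‖c‖ ^ 2 * Q.quad x v := by
  simp only [HermitianMetric.quad, map_smul, LinearMap.map_smulₛₗ, LinearMap.smul_apply,
    smul_eq_mul]
  rw [← mul_assoc, mul_comm ((starRingEnd ℂ) c) c, Complex.mul_conj, Complex.re_ofReal_mul, Complex.normSq_eq_norm_sq]

lemma HermitianMetric.quad_neg {E : Type*} [NormedAddCommGroup E] [NormedSpace ℂ E]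
    {M : Type*} [TopologicalSpace M] [ChartedSpace E M] (Q : HermitianMetric 𝓘(ℂ, E) M) (x : M)
    (v : TangentSpace 𝓘(ℂ, E) x) : Q.quad x (-v) = Q.quad x v := by
  have := Q.quad_smul x (-1) v
  simpa using this

variable [∀ l, IsManifold 𝓘(ℂ, E l) ω (M l)] {e : ∀ l, OpenPartialHomeomorph (M l) (E l)}

/-- Squaring undoes the outer root because `mixFun` is nonnegative on squared lengths. Through this
identity the local results about `mixSq` become results about the product metric. -/
lemma inChart_sqMetric_eq (ht : 0 ≤ t) (he : ∀ l, e l ∈ atlas (E l) (M l)) {z : ∀ l, E l}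
    (hz : z ∈ Set.univ.pi fun l => (e l).target) :
    inChart (prodModel E) (sqMetric (prodModel E) (prodFinsler (fun l => (Q l).quad) t k))
      (OpenPartialHomeomorph.pi e) z =
      mixSq (fun l => inChart 𝓘(ℂ, E l) (Q l).quad (e l)) t k z := by
  funext v
  have h := inChart_prodFinsler (fun l => (Q l).quad) ht k he hz v
  have h1 : inChart (prodModel E) (sqMetric (prodModel E)
      (prodFinsler (fun l => (Q l).quad) t k)) (OpenPartialHomeomorph.pi e) z v =
      (inChart (prodModel E) (prodFinsler (fun l => (Q l).quad) t k)
        (OpenPartialHomeomorph.pi e) z v) ^ 2 := rfl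
  rw [h1, h, Real.sq_sqrt]
  exact mixFun_nonneg ht fun l => (Q l).quad_nonneg _ _

variable [∀ l, FiniteDimensional ℂ (E l)]

lemma contDiffOn_inChart_sqMetric (ht : 0 ≤ t) (he : ∀ l, e l ∈ atlas (E l) (M l)) :
    ContDiffOn ℝ ∞ (fun p : (∀ l, E l) × (∀ l, E l) => inChart (prodModel E)
      (sqMetric (prodModel E) (prodFinsler (fun l => (Q l).quad) t k))
      (OpenPartialHomeomorph.pi e) p.1 p.2) ((Set.univ.pi fun l => (e l).target) ×ˢ {0}ᶜ) := by
  refine (contDiffOn_mixSq (t := t) (k := k) (fun l => (e l).open_target)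
    (fun l => isLocalHermitian_inChart (Q l) (he l))).congr fun p hp => ?_
  exact congrFun (inChart_sqMetric_eq Q ht he hp.1) p.2

lemma fiberConvexAt_inChart_sqMetric (ht : 0 ≤ t) (hk : 2 ≤ k)
    (he : ∀ l, e l ∈ atlas (E l) (M l)) (z : ∀ l, E l)
    (hz : z ∈ Set.univ.pi fun l => (e l).target) (v : ∀ l, E l) (hv : v ≠ 0) :
    FiberConvexAt (inChart (prodModel E)
      (sqMetric (prodModel E) (prodFinsler (fun l => (Q l).quad) t k))
      (OpenPartialHomeomorph.pi e)) z v :=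
  (mixSq_fiberConvexAt (fun l => (e l).open_target)
    (fun l => isLocalHermitian_inChart (Q l) (he l)) ht hk hz hv).congr
    (inChart_sqMetric_eq Q ht he hz)

omit [∀ l, DecidableEq (ι l)] in
lemma isStronglyPseudoconvex_prodFinsler (ht : 0 ≤ t) (hk : 2 ≤ k) :
    IsStronglyPseudoconvex (prodModel E) (Pi.basis b) (prodFinsler (fun l => (Q l).quad) t k) where
  continuous e he := by
    obtain ⟨e, hea, rfl⟩ := exists_of_mem_pi_atlas he
    rw [pi_extend_target]
    refine ((continuousOn_mixSq (t := t) (k := k) (fun l => isLocalHermitian_inChart (Q l) (hea l))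
      (by omega)).sqrt).congr fun p hp => ?_
    exact inChart_prodFinsler (fun l => (Q l).quad) ht k hea hp.1 p.2
  nonneg x v :=
    (Real.sqrt_nonneg _).trans_eq (prodFinsler_eq (fun l => (Q l).quad) ht k x v).symm
  eq_zero_iff x v := by
    have hF := prodFinsler_eq (fun l => (Q l).quad) ht k x v
    rw [hF]
    constructor
    · intro h
      by_contra hv
      obtain ⟨l, hl⟩ := Function.ne_iff.mp (show (v : ∀ l, E l) ≠ 0 from hv)
      have hpos := mixFun_pos (t := t) (k := k) ht (x := fun l => (Q l).quad (x l) (v l))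
        (fun l => (Q l).quad_nonneg _ _) (l := l) ((Q l).pos (x l) (v l) hl).ne'
      exact (Real.sqrt_pos.mpr hpos).ne' h
    · rintro rfl
      have h0 : ∀ l, (Q l).quad (x l) ((0 : ∀ l, E l) l) = 0 := fun l => by
        have h := (Q l).quad_smul (x l) 0 0
        rw [zero_smul, norm_zero, zero_pow two_ne_zero, zero_mul] at h
        exact h
      -- Homogeneity with factor `0`.
      have h1 : mixFun t k (fun _ : Fin n => (0 : ℝ)) = 0 := by
        have h2 := mixFun_smul (t := t) (k := k) (κ := Fin n) (by omega) (x := fun _ => 0)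
          (fun _ => le_rfl) (c := 0) le_rfl
        simpa using h2
      have h3 : mixFun t k (fun l => (Q l).quad (x l) ((0 : ∀ l, E l) l)) = 0 := by
        simp only [h0, h1]
      exact (congrArg Real.sqrt h3).trans Real.sqrt_zero
  smooth e he := by
    obtain ⟨e, hea, rfl⟩ := exists_of_mem_pi_atlas he
    rw [pi_extend_target]
    exact contDiffOn_inChart_sqMetric Q ht hea
  homogeneous x c v := by
    have h1 : mixFun t k (fun l => (Q l).quad (x l) ((c • (v : ∀ l, E l)) l)) =
        mixFun t k fun l => ‖c‖ ^ 2 * (Q l).quad (x l) ((v : ∀ l, E l) l) :=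
      congrArg (mixFun t k) (funext fun l => (Q l).quad_smul (x l) c _)
    have h2 : mixFun t k (fun l => ‖c‖ ^ 2 * (Q l).quad (x l) ((v : ∀ l, E l) l)) =
        ‖c‖ ^ 2 * mixFun t k fun l => (Q l).quad (x l) ((v : ∀ l, E l) l) :=
      mixFun_smul (by omega) (fun l => (Q l).quad_nonneg _ _) (sq_nonneg _)
    have hsq : ∀ w : ∀ l, E l, sqMetric (prodModel E) (prodFinsler (fun l => (Q l).quad) t k) x w =
        mixFun t k fun l => (Q l).quad (x l) (w l) := fun w =>
      (congrArg (· ^ 2) (prodFinsler_eq (fun l => (Q l).quad) ht k x w)).trans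
        (Real.sq_sqrt (mixFun_nonneg ht fun l => (Q l).quad_nonneg _ _))
    exact (hsq _).trans ((h1.trans h2).trans (congrArg (‖c‖ ^ 2 * ·) (hsq v).symm))
  -- Strong pseudoconvexity is deduced from strong convexity.
  posDef e he z hz v hv := by
    obtain ⟨e, hea, rfl⟩ := exists_of_mem_pi_atlas he
    rw [pi_extend_target] at hz
    have h1 := contDiffAt_of_slit (isOpen_pi_univ fun l => (e l).open_target)
      (contDiffOn_inChart_sqMetric (k := k) Q ht hea) hz hv
    exact leviMatrix_posDef _ ((contDiffAt_fiber h1).of_le two_le_infty)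
      (fiberConvexAt_inChart_sqMetric Q ht hk hea z hz v hv)

/-- The product connection is a symmetric Chern connection of the product metric. -/
lemma exists_connection_inChart_sqMetric (hsym : ∀ l p, ∃ s, IsPointSymmetry (Q l).quad p s)
    (ht : 0 ≤ t) (hk : 2 ≤ k) (he : ∀ l, e l ∈ atlas (E l) (M l)) :
    ∃ A : ∀ l, E l → E l →ₗ[ℂ] E l →ₗ[ℂ] E l,
      (∀ l, IsConnectionOn (e l).target (inChart 𝓘(ℂ, E l) (Q l).quad (e l)) (A l)) ∧
      IsConnectionOn (Set.univ.pi fun l => (e l).target) (inChart (prodModel E)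
        (sqMetric (prodModel E) (prodFinsler (fun l => (Q l).quad) t k))
        (OpenPartialHomeomorph.pi e)) (piConnection A) ∧
      ∀ z ∈ Set.univ.pi fun l => (e l).target, ∀ X Y,
        piConnection A z X Y = piConnection A z Y X := by
  choose A hA hAs using fun l => exists_connection_inChart (Q l) (hsym l) (he l)
  refine ⟨A, hA, ?_, ?_⟩
  · exact (isConnectionOn_piConnection (fun l => (e l).open_target)
      (fun l => isLocalHermitian_inChart (Q l) (he l)) hA (by omega)).congr
      (isOpen_pi_univ fun l => (e l).open_target) fun z hz => inChart_sqMetric_eq Q ht he hz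
  · intro z hz X Y
    funext l
    exact hAs l (z l) (hz l trivial) (X l) (Y l)

/-- In every chart the horizontal coefficients are those of the product connection: its symmetry
makes each summand of the Kähler condition vanish, and its independence of `v` is the Berwald
condition. -/
theorem isStronglyConvexKahlerBerwald_prodFinsler
    (hsym : ∀ l p, ∃ s, IsPointSymmetry (Q l).quad p s) (ht : 0 ≤ t) (hk : 2 ≤ k) :
    IsStronglyConvexKahlerBerwald (prodModel E) (Pi.basis b)
      (prodFinsler (fun l => (Q l).quad) t k) where
  pseudoconvex := isStronglyPseudoconvex_prodFinsler b Q ht hk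
  convex e he z hz v hv := by
    obtain ⟨e, hea, rfl⟩ := exists_of_mem_pi_atlas he
    rw [pi_extend_target] at hz
    exact fiberConvexAt_inChart_sqMetric Q ht hk hea z hz v hv
  kahler e he z hz v hv α μ := by
    obtain ⟨e, hea, rfl⟩ := exists_of_mem_pi_atlas he
    rw [pi_extend_target] at hz
    obtain ⟨A, -, hA, hAs⟩ := exists_connection_inChart_sqMetric Q hsym ht hk hea
    refine Finset.sum_eq_zero fun ν _ => ?_
    rw [horizontalCoeff_eq (isOpen_pi_univ fun l => (e l).open_target)
      (contDiffOn_inChart_sqMetric Q ht hea) (fiberConvexAt_inChart_sqMetric Q ht hk hea) hA hz hv,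
      horizontalCoeff_eq (isOpen_pi_univ fun l => (e l).open_target)
      (contDiffOn_inChart_sqMetric Q ht hea) (fiberConvexAt_inChart_sqMetric Q ht hk hea) hA hz hv,
      hAs z hz, sub_self, zero_mul]
  berwald e he z hz v w hv hw α ν μ := by
    obtain ⟨e, hea, rfl⟩ := exists_of_mem_pi_atlas he
    rw [pi_extend_target] at hz
    obtain ⟨A, -, hA, -⟩ := exists_connection_inChart_sqMetric Q hsym ht hk hea
    rw [horizontalCoeff_eq (isOpen_pi_univ fun l => (e l).open_target)
      (contDiffOn_inChart_sqMetric Q ht hea) (fiberConvexAt_inChart_sqMetric Q ht hk hea) hA hz hv,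
      horizontalCoeff_eq (isOpen_pi_univ fun l => (e l).open_target)
      (contDiffOn_inChart_sqMetric Q ht hea) (fiberConvexAt_inChart_sqMetric Q ht hk hea) hA hz hw]

/-- The fixed point of a point symmetry is isolated. -/
lemma IsPointSymmetry.eventually_eq {E : Type*} [NormedAddCommGroup E] [NormedSpace ℂ E]
    {M : Type*} [TopologicalSpace M] [ChartedSpace E M]
    {F : (x : M) → TangentSpace 𝓘(ℂ, E) x → ℝ} {p : M} {s : M → M} (hs : IsPointSymmetry F p s) :
    ∀ᶠ x in nhds p, s x = x → x = p := by
  have hψ : p ∈ (chartAt E p).source := mem_chart_source E p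
  have hd : HasFDerivAt (writtenInExtChartAt 𝓘(ℂ, E) 𝓘(ℂ, E) p s)
      (-ContinuousLinearMap.id ℂ E) (chartAt E p p) := by
    have h1 : HasFDerivWithinAt (writtenInExtChartAt 𝓘(ℂ, E) 𝓘(ℂ, E) p s)
      (-ContinuousLinearMap.id ℂ E) (Set.range 𝓘(ℂ, E)) (chartAt E p p) := hs.deriv.2
    simpa [hasFDerivWithinAt_univ] using h1
  have hwr : ∀ w, writtenInExtChartAt 𝓘(ℂ, E) 𝓘(ℂ, E) p s w =
      chartAt E p (s ((chartAt E p).symm w)) := by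
    intro w
    simp only [writtenInExtChartAt, hs.fixed, extChartAt]
    rfl
  -- At another fixed point with coordinate difference `w`, the error of the linear approximation by
  -- `-1` is exactly `2 w`. The bound with constant `1` then gives `2 ‖w‖ ≤ ‖w‖`.
  have h2 := hd.isLittleO.def one_pos
  have h3 := ((chartAt E p).continuousAt hψ).eventually h2
  filter_upwards [h3, (chartAt E p).open_source.mem_nhds hψ] with x hx hxs hfix
  rw [hwr, hwr, (chartAt E p).left_inv hψ, (chartAt E p).left_inv hxs, hs.fixed, hfix] at hx
  set w := chartAt E p x - chartAt E p p with hw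
  have h4 : w - (-ContinuousLinearMap.id ℂ E) w = (2 : ℝ) • w := by
    simp [two_smul]
  rw [h4, norm_smul, Real.norm_ofNat, one_mul] at hx
  have h5 : w = 0 := norm_le_zero_iff.mp (by linarith)
  exact (chartAt E p).injOn hxs hψ (sub_eq_zero.mp h5)

omit [∀ l, DecidableEq (ι l)] in
-- The symmetries of the factors act componentwise. A point fixed by the product map is fixed in
-- each component, so a product of isolating neighbourhoods isolates `p`.
theorem isSymmetricComplexFinslerSpace_prodFinsler [∀ l, ConnectedSpace (M l)]
    (hsym : ∀ l p, ∃ s, IsPointSymmetry (Q l).quad p s) (ht : 0 ≤ t) (hk : 2 ≤ k) :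
    IsSymmetricComplexFinslerSpace (prodModel E) (Pi.basis b)
      (prodFinsler (fun l => (Q l).quad) t k) where
  pseudoconvex := isStronglyPseudoconvex_prodFinsler b Q ht hk
  connected := inferInstance
  symmetric p := by
    choose s hs using fun l => hsym l (p l)
    refine ⟨fun x l => s l (x l), fun x => ?_, fun x => ?_, fun x v => ?_, ?_, ?_⟩
    · funext l
      exact (hs l).involutive (x l)
    · exact (hasMFDerivAt_piMap fun l => ((hs l).isometry (x l)).1.hasMFDerivAt).mdifferentiableAt
    · exact prodFinsler_piMap _ t k (fun l => (hs l).isometry (x l)) v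
    · funext l
      exact (hs l).fixed
    · refine ⟨Set.univ.pi fun l => {y | s l y = y → y = p l},
        set_pi_mem_nhds Set.finite_univ fun l _ => (hs l).eventually_eq, fun x hx hfix => ?_⟩
      funext l
      exact hx l trivial (congrFun hfix l)

/-- Curvature of the product of metrics with the same constant holomorphic sectional curvature. -/
theorem holSecCurv_prodFinsler (hsym : ∀ l p, ∃ s, IsPointSymmetry (Q l).quad p s) (ht : 0 ≤ t)
    (hk : 2 ≤ k) (c : ℝ)
    (hc : ∀ l (x : M l) (v : TangentSpace 𝓘(ℂ, E l) x), v ≠ 0 →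
      holSecCurv 𝓘(ℂ, E l) (b l) (Q l).quad x v = c)
    (x : ∀ l, M l) (v : TangentSpace (prodModel E) x) (hv : v ≠ 0) :
    ∃ ρ : ℝ, (1 + t) / (n + t * (n : ℝ) ^ (1 / (k : ℝ))) ≤ ρ ∧ ρ ≤ 1 ∧
      holSecCurv (prodModel E) (Pi.basis b)
        (sqMetric _ (prodFinsler (fun l => (Q l).quad) t k)) x v = (ρ * c : ℝ) := by
  set e := fun l => chartAt (E l) (x l) with he
  have hea : ∀ l, e l ∈ atlas (E l) (M l) := fun l => chart_mem_atlas (E l) (x l)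
  set z : ∀ l, E l := fun l => e l (x l) with hz
  have hzt : z ∈ Set.univ.pi fun l => (e l).target := fun l _ =>
    (e l).map_source (mem_chart_source (E l) (x l))
  obtain ⟨A, hA, hA', -⟩ := exists_connection_inChart_sqMetric (t := t) (k := k) Q hsym ht hk hea
  have hc' : ∀ l, (v : ∀ l, E l) l ≠ 0 → localHolSecCurv (b l)
      (inChart 𝓘(ℂ, E l) (Q l).quad (e l)) (z l) ((v : ∀ l, E l) l) = c := by
    intro l hl
    have h := hc l (x l) ((v : ∀ l, E l) l) hl
    rwa [holSecCurv_eq_local] at h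
  obtain ⟨ρ, h1, h2, h3⟩ := localHolSecCurv_mixSq b (fun l => (e l).open_target)
    (fun l => isLocalHermitian_inChart (Q l) (hea l)) hA ht hk hzt (v := v) hv c hc'
  refine ⟨ρ, by simpa using h1, h2, ?_⟩
  have hopen := isOpen_pi_univ fun l => (e l).open_target
  have hq := fun l => isLocalHermitian_inChart (Q l) (hea l)
  -- Both metrics have the same connection near `z`, so their curvatures at `z` depend only on the
  -- fibre function there, where the two agree.
  have h4 : ∀ w : ∀ l, E l, w ≠ 0 → localHolSecCurv (Pi.basis b) (inChart (prodModel E)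
      (sqMetric (prodModel E) (prodFinsler (fun l => (Q l).quad) t k))
      (OpenPartialHomeomorph.pi e)) z w =
      localHolSecCurv (Pi.basis b)
        (mixSq (fun l => inChart 𝓘(ℂ, E l) (Q l).quad (e l)) t k) z w := by
    intro w hw
    rw [localHolSecCurv_eq hopen (contDiffOn_inChart_sqMetric Q ht hea)
      (fiberConvexAt_inChart_sqMetric Q ht hk hea) hA' hzt hw,
      localHolSecCurv_eq hopen (contDiffOn_mixSq (fun l => (e l).open_target) hq)
        (fun z hz v hv => mixSq_fiberConvexAt (fun l => (e l).open_target) hq ht hk hz hv)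
        (isConnectionOn_piConnection (fun l => (e l).open_target) hq hA (by omega)) hzt hw,
      curvatureSum_congr (Pi.basis b) (inChart_sqMetric_eq Q ht hea hzt),
      inChart_sqMetric_eq Q ht hea hzt]
  -- The preferred chart of the product at `x` is by definition the product of the preferred charts
  -- of the factors.
  exact (holSecCurv_eq_local (prodModel E) (Pi.basis b) _ x v).trans ((h4 v hv).trans h3)

end ProductMetric

end ComplexFinsler

end

theorem mainTheorem8 {n : ℕ} {d m : Fin n → ℕ}
    {G : Fin n → Type*} [∀ l, Group (G l)] [∀ l, TopologicalSpace (G l)]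
    [∀ l, ChartedSpace (EuclideanSpace ℝ (Fin (d l))) (G l)]
    [∀ l, LieGroup (𝓡 (d l)) ∞ (G l)]
    (H : ∀ l, Subgroup (G l))
    [∀ l, ChartedSpace (Cn (m l)) (G l ⧸ H l)]
    [∀ l, IsManifold 𝓘(ℂ, Cn (m l)) ω (G l ⧸ H l)]
    (hM : ∀ l, IsComplexSymmetricCoset (EuclideanSpace ℝ (Fin (d l))) (Cn (m l)) (H l))
    (Q : ∀ l, HermitianMetric 𝓘(ℂ, Cn (m l)) (G l ⧸ H l))
    (hQ : ∀ l, IsInvariantMetric 𝓘(ℂ, Cn (m l)) (G l) (Q l).quad)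
    (t : ℝ) (ht : 0 ≤ t) (k : ℕ) (hk : 2 ≤ k) :
    IsStronglyConvexKahlerBerwald (prodModel fun l => Cn (m l)) (prodBasis m)
      (prodFinsler (fun l => (Q l).quad) t k) ∧
    (IsInvariantMetric (prodModel fun l => Cn (m l)) (∀ l, G l)
        (prodFinsler (fun l => (Q l).quad) t k) ∧
      IsSymmetricComplexFinslerSpace (prodModel fun l => Cn (m l)) (prodBasis m)
        (prodFinsler (fun l => (Q l).quad) t k)) ∧
    (∀ c : ℝ, 0 ≤ c →
      (∀ l (x : G l ⧸ H l) (v : TangentSpace 𝓘(ℂ, Cn (m l)) x), v ≠ 0 →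
        holSecCurv 𝓘(ℂ, Cn (m l)) (stdBasis (m l)) (Q l).quad x v = c) →
      ∀ (x : ∀ l, G l ⧸ H l) (v : TangentSpace (prodModel fun l => Cn (m l)) x), v ≠ 0 →
        ∃ r ∈ Set.Icc ((1 + t) * c / (n + t * (n : ℝ) ^ (1 / (k : ℝ)))) c,
          holSecCurv (prodModel fun l => Cn (m l)) (prodBasis m)
            (sqMetric _ (prodFinsler (fun l => (Q l).quad) t k)) x v = r) ∧
    (∀ c : ℝ, c < 0 →
      (∀ l (x : G l ⧸ H l) (v : TangentSpace 𝓘(ℂ, Cn (m l)) x), v ≠ 0 →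
        holSecCurv 𝓘(ℂ, Cn (m l)) (stdBasis (m l)) (Q l).quad x v = c) →
      ∀ (x : ∀ l, G l ⧸ H l) (v : TangentSpace (prodModel fun l => Cn (m l)) x), v ≠ 0 →
        ∃ r ∈ Set.Icc c ((1 + t) * c / (n + t * (n : ℝ) ^ (1 / (k : ℝ)))),
          holSecCurv (prodModel fun l => Cn (m l)) (prodBasis m)
            (sqMetric _ (prodFinsler (fun l => (Q l).quad) t k)) x v = r) := by
  -- Hermitian metrics are even, so the differential `-1` of the symmetry at the base point
  -- preserves them.
  have hsym : ∀ l p, ∃ s, IsPointSymmetry (Q l).quad p s := fun l p =>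
    exists_isPointSymmetry (hM l) (hQ l) (fun x v => (Q l).quad_neg x v) p
  have : ∀ l, ConnectedSpace (G l ⧸ H l) := fun l => (hM l).connected
  refine ⟨isStronglyConvexKahlerBerwald_prodFinsler (fun l => stdBasis (m l)) Q hsym ht hk,
    ⟨fun a x v => prodFinsler_piMap _ t k
      (fun l => isHolomorphicIsometryAt_smul (hM l) (hQ l) (a l) (x l)) v,
      isSymmetricComplexFinslerSpace_prodFinsler (fun l => stdBasis (m l)) Q hsym ht hk⟩,
    fun c hc hK x v hv => ?_, fun c hc hK x v hv => ?_⟩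
  · obtain ⟨ρ, h1, h2, h3⟩ := holSecCurv_prodFinsler (fun l => stdBasis (m l)) Q hsym ht hk c hK
      x v hv
    refine ⟨ρ * c, ⟨?_, mul_le_of_le_one_left hc h2⟩, h3⟩
    rw [mul_div_right_comm]
    exact mul_le_mul_of_nonneg_right h1 hc
  · obtain ⟨ρ, h1, h2, h3⟩ := holSecCurv_prodFinsler (fun l => stdBasis (m l)) Q hsym ht hk c hK
      x v hv
    -- Multiplication by the negative `c` reverses the bounds on `ρ` and so exchanges the endpoints.
    refine ⟨ρ * c, ⟨?_, ?_⟩, h3⟩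
    · simpa using mul_le_mul_of_nonpos_right h2 hc.le
    · rw [mul_div_right_comm]
      exact mul_le_mul_of_nonpos_right h1 hc.le
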